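/- **The base system.** The base system is the three-sorted first-order theory with sorts for numbers ($m,n,\dots$), functions from numbers to numbers ($f,g,\dots$) and operators from functions to functions ($F,G,\dots$), equality being primitive for numbers only. Its arithmetical symbols are $0,1,+,\cdot,<$, the bit length $\mathrm{len}(x)$ and $x,y\mapsto x^{\mathrm{len}(y)}$ (hence also $x\mapsto x^{\mathrm{len}(x)}$). Write $\mu(m<t:\varphi(m))$ for the least $m<t$ with $\varphi(m)$, and for $t$ if there is none. *Bounded quantifier formulas* are built from equations and inequalities of number terms by Boolean connectives, number quantifiers $\exists z<S$, $\forall z<S$ ($S$ a term without $z$), and function and operator quantifiers of the form "for the $f$ with $\forall n\; f(n)=\mu(m<T(n):\varphi(m,n))$" and "for the $F$ with $\forall f\,\forall n\; F(f)(n)=\mu(m<T(n,f):\varphi(m,n,f))$". The axioms are: (1) the basic arithmetical axioms (discretely ordered commutative semiring, and the recursive equations of $\mathrm{len}$ and $x^{\mathrm{len}(y)}$); (2) induction for bounded quantifier formulas; (3) extensionality, $\forall n\, f(n)=g(n)\Rightarrow\forall m\,F(f)(m)=F(g)(m)$; (4) bounded quantifier comprehension, $\exists f\,\forall n\, f(n)=\mu(m<T(n):\varphi(m,n))$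 and $\exists F\,\forall f\,\forall n\, F(f)(n)=\mu(m<T(n,f):\varphi(m,n,f))$, for terms $T$ and bounded quantifier formulas $\varphi$ with arbitrary parameters. "Provable in the base system" means: true in every model of these axioms. **Reals and continuous functions in the base system.** A real is coded by an integer $n$ and a function $d$ with $d(2^i)\in\{0,1,2\}$ for every $i\ge 1$ such that $2^i$ exists, and is $n+\sum_{i\ge1}d(2^i)/2^i$. A continuous $f:[0,1]\to\mathbb R$ is coded by functions that give (a code of) the real $f(q)$ for each rational $q\in[0,1]$, together with a modulus of uniform continuity: a function $e$ with $e(k)>0$ and $|y-z|<1/e(k)\Rightarrow|f(y)-f(z)|<1/k$ for all $k\ge1$ and all rationals $y,z\in[0,1]$. For a real $x\in[0,1]$, $f(x)$ is the limit of $f(q)$ for rational $q\to x$. **Theorem.** The following are provable in the base system. 1. (Constructive intermediate value theorem.) If $f:[0,1]\to\mathbb R$ is continuous with $f(0)<0$ and $f(1)>0$, then there is a function $g$ such that for every number $n\ge1$, $g(n)$ is (the code of) a pair of rationals $(a_n,b_n)$ in $[0,1]$ such that for every real $x$ with $a_n<x<b_n$ the value $f(x)$ exists and $|f(x)|<1/n$,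 and such that $a_j<a_k<b_k<b_j$ whenever $1\le j<k$. 2. (Supremum.) Every continuous $f:[0,1]\to\mathbb R$ has a supremum, and a code for it is computed by bounded quantifier formulas: there are fixed bounded quantifier formulas, with the code of $f$ (including its modulus $e$) as parameters, that define the integer part and the graph of the digit function of a real which is provably the least upper bound of $f$ on $[0,1]$. -/

import Mathlib

universe u

namespace WeakAnalysis

/-! ### The language: numbers, functions on numbers, operators on functions -/

/-- A (Henkin) structure for the three-sorted language of numbers, functions and operators.
The arithmetical symbols are `0`, `1`, `+`, `·`, `x ↦ x ^ len x` (`omega`), together with `<`,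
the bit length `len` and `powLen x y = x ^ len y`, by which `omega` is computed.
As usual in first-order logic, every sort is nonempty. -/
structure BaseStructure where
  Num : Type u
  Fn : Type u
  Op : Type u
  app : Fn → Num → Num
  appOp : Op → Fn → Fn
  zero : Num
  one : Num
  add : Num → Num → Num
  mul : Num → Num → Num
  len : Num → Num
  powLen : Num → Num → Num
  omega : Num → Num
  lt : Num → Num → Prop
  fn_nonempty : Nonempty Fn
  op_nonempty : Nonempty Op

instance (M : BaseStructure.{u}) : Zero M.Num := ⟨M.zero⟩
instance (M : BaseStructure.{u}) : One M.Num := ⟨M.one⟩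
instance (M : BaseStructure.{u}) : Add M.Num := ⟨M.add⟩
instance (M : BaseStructure.{u}) : Mul M.Num := ⟨M.mul⟩
instance (M : BaseStructure.{u}) : LT M.Num := ⟨M.lt⟩
instance (M : BaseStructure.{u}) : LE M.Num := ⟨fun x y => x < y ∨ x = y⟩

/-- Terms for functions: `f` and `F(t)`. -/
inductive FnTerm where
  | var (i : ℕ)
  | app (i : ℕ) (t : FnTerm)

/-- Terms for numbers. -/
inductive NumTerm where
  | var (i : ℕ)
  | zero
  | one
  | add (s t : NumTerm)
  | mul (s t : NumTerm)
  | len (t : NumTerm)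
  | powLen (s t : NumTerm)
  | omega (t : NumTerm)
  | app (f : FnTerm) (t : NumTerm)

/-- Bounded quantifier formulas, with named variables of each sort.
* `exLt z S φ`, `allLt z S φ`: `∃ z < S, φ` and `∀ z < S, φ`, where `z` is not bound in `S`.
* `letFn f n m T φ ψ`: the function quantifier `∃ f, (∀ n, f(n) = μ(m < T : φ)) ∧ ψ`;
  `f` is bound in `ψ` only, `n` in `T` and `φ`, `m` in `φ`.
* `letOp F f n m T φ ψ`: the operator quantifier
  `∃ F, (∀ f n, F(f)(n) = μ(m < T : φ)) ∧ ψ`;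
  `F` is bound in `ψ` only, `f` and `n` in `T` and `φ`, `m` in `φ`. -/
inductive BForm where
  | eq (s t : NumTerm)
  | lt (s t : NumTerm)
  | neg (φ : BForm)
  | and (φ ψ : BForm)
  | or (φ ψ : BForm)
  | exLt (z : ℕ) (S : NumTerm) (φ : BForm)
  | allLt (z : ℕ) (S : NumTerm) (φ : BForm)
  | letFn (f n m : ℕ) (T : NumTerm) (φ ψ : BForm)
  | letOp (F f n m : ℕ) (T : NumTerm) (φ ψ : BForm)

/-- Assignments of values to the variables of the three sorts. -/
structure Val (M : BaseStructure.{u}) where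
  num : ℕ → M.Num
  fn : ℕ → M.Fn
  op : ℕ → M.Op

def Val.setNum {M : BaseStructure.{u}} (e : Val M) (i : ℕ) (x : M.Num) : Val M :=
  { e with num := Function.update e.num i x }

def Val.setFn {M : BaseStructure.{u}} (e : Val M) (i : ℕ) (f : M.Fn) : Val M :=
  { e with fn := Function.update e.fn i f }

def Val.setOp {M : BaseStructure.{u}} (e : Val M) (i : ℕ) (F : M.Op) : Val M :=
  { e with op := Function.update e.op i F }

def FnTerm.eval {M : BaseStructure.{u}} (e : Val M) : FnTerm → M.Fn
  | .var i => e.fn i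
  | .app i t => M.appOp (e.op i) (t.eval e)

def NumTerm.eval {M : BaseStructure.{u}} (e : Val M) : NumTerm → M.Num
  | .var i => e.num i
  | .zero => 0
  | .one => 1
  | .add s t => s.eval e + t.eval e
  | .mul s t => s.eval e * t.eval e
  | .len t => M.len (t.eval e)
  | .powLen s t => M.powLen (s.eval e) (t.eval e)
  | .omega t => M.omega (t.eval e)
  | .app f t => M.app (f.eval e) (t.eval e)

/-- `y = μ(x < n : P x)`: the least `x < n` with `P x`, and `n` if there is none. -/
def IsMu {M : BaseStructure.{u}} (n : M.Num) (P : M.Num → Prop) (y : M.Num) : Prop :=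
  (y < n ∧ P y ∧ ∀ x, x < y → ¬ P x) ∨ (y = n ∧ ∀ x, x < n → ¬ P x)

/-- Satisfaction of bounded quantifier formulas. -/
def BForm.Sat {M : BaseStructure.{u}} : BForm → Val M → Prop
  | .eq s t, e => s.eval e = t.eval e
  | .lt s t, e => s.eval e < t.eval e
  | .neg φ, e => ¬ φ.Sat e
  | .and φ ψ, e => φ.Sat e ∧ ψ.Sat e
  | .or φ ψ, e => φ.Sat e ∨ ψ.Sat e
  | .exLt z S φ, e => ∃ x, x < S.eval e ∧ φ.Sat (e.setNum z x)
  | .allLt z S φ, e => ∀ x, x < S.eval e → φ.Sat (e.setNum z x)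
  | .letFn f n m T φ ψ, e =>
      ∃ a : M.Fn,
        (∀ x, IsMu (T.eval (e.setNum n x)) (fun y => φ.Sat ((e.setNum n x).setNum m y))
          (M.app a x)) ∧
        ψ.Sat (e.setFn f a)
  | .letOp F f n m T φ ψ, e =>
      ∃ A : M.Op,
        (∀ a x, IsMu (T.eval ((e.setFn f a).setNum n x))
          (fun y => φ.Sat (((e.setFn f a).setNum n x).setNum m y))
          (M.app (M.appOp A a) x)) ∧
        ψ.Sat (e.setOp F A)

/-! ### The base system -/

/-- The basic arithmetical axioms: a discretely ordered commutative semiring, with the recursive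
equations for `len`, `powLen` and `omega`. -/
structure BasicArithmetic (M : BaseStructure.{u}) : Prop where
  add_assoc : ∀ x y z : M.Num, x + y + z = x + (y + z)
  add_comm : ∀ x y : M.Num, x + y = y + x
  add_zero : ∀ x : M.Num, x + 0 = x
  mul_assoc : ∀ x y z : M.Num, x * y * z = x * (y * z)
  mul_comm : ∀ x y : M.Num, x * y = y * x
  mul_zero : ∀ x : M.Num, x * 0 = 0
  mul_one : ∀ x : M.Num, x * 1 = x
  mul_add : ∀ x y z : M.Num, x * (y + z) = x * y + x * z
  lt_irrefl : ∀ x : M.Num, ¬ x < x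
  lt_trans : ∀ x y z : M.Num, x < y → y < z → x < z
  lt_trichotomy : ∀ x y : M.Num, x < y ∨ x = y ∨ y < x
  add_lt_add : ∀ x y z : M.Num, x < y → x + z < y + z
  mul_lt_mul : ∀ x y z : M.Num, 0 < z → x < y → x * z < y * z
  zero_le : ∀ x : M.Num, 0 ≤ x
  zero_lt_one : (0 : M.Num) < 1
  succ_le : ∀ x y : M.Num, x < y → x + 1 ≤ y
  len_zero : M.len 0 = 0
  len_even : ∀ x : M.Num, 0 < x → M.len ((1 + 1) * x) = M.len x + 1
  len_odd : ∀ x : M.Num, M.len ((1 + 1) * x + 1) = M.len x + 1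
  powLen_zero : ∀ x : M.Num, M.powLen x 0 = 1
  powLen_even : ∀ x y : M.Num, 0 < y → M.powLen x ((1 + 1) * y) = x * M.powLen x y
  powLen_odd : ∀ x y : M.Num, M.powLen x ((1 + 1) * y + 1) = x * M.powLen x y
  omega_eq : ∀ x : M.Num, M.omega x = M.powLen x x

/-- The axioms of the base system: basic arithmetic, induction for bounded quantifier formulas,
extensionality of operators, and bounded quantifier comprehension for functions and for operators
(parameters of all sorts are allowed in the schemes). -/
structure BaseSystem (M : BaseStructure.{u}) : Prop where
  basic : BasicArithmetic M
  induction : ∀ (φ : BForm) (n : ℕ) (e : Val M),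
    φ.Sat (e.setNum n 0) →
    (∀ x, φ.Sat (e.setNum n x) → φ.Sat (e.setNum n (x + 1))) →
    ∀ x, φ.Sat (e.setNum n x)
  extensionality : ∀ (F : M.Op) (f g : M.Fn), (∀ n, M.app f n = M.app g n) →
    ∀ m, M.app (M.appOp F f) m = M.app (M.appOp F g) m
  comprehensionFn : ∀ (n m : ℕ) (T : NumTerm) (φ : BForm) (e : Val M),
    ∃ f : M.Fn, ∀ x, IsMu (T.eval (e.setNum n x))
      (fun y => φ.Sat ((e.setNum n x).setNum m y)) (M.app f x)
  comprehensionOp : ∀ (f n m : ℕ) (T : NumTerm) (φ : BForm) (e : Val M),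
    ∃ F : M.Op, ∀ a x, IsMu (T.eval ((e.setFn f a).setNum n x))
      (fun y => φ.Sat (((e.setFn f a).setNum n x).setNum m y)) (M.app (M.appOp F a) x)

/-! ### Rational and real numbers inside a structure -/

/-- Pairing of numbers (injective). -/
def pair {M : BaseStructure.{u}} (x y : M.Num) : M.Num := (x + y) * (x + y) + x

/-- `w` is of the form `2 ^ i` with `i` a unary number, i.e. `i = len x` for a number `x`. -/
def IsPow2 {M : BaseStructure.{u}} (w : M.Num) : Prop := ∃ x : M.Num, w = M.powLen (1 + 1) x

/-- The rational number `(pos - neg) / den` (used with `den > 0` only). -/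
@[ext] structure QNum (M : BaseStructure.{u}) where
  pos : M.Num
  neg : M.Num
  den : M.Num

namespace QNum

variable {M : BaseStructure.{u}}

/-- The nonnegative fraction `p / q`. -/
def frac (p q : M.Num) : QNum M := ⟨p, 0, q⟩

def add (a b : QNum M) : QNum M :=
  ⟨a.pos * b.den + b.pos * a.den, a.neg * b.den + b.neg * a.den, a.den * b.den⟩

def sub (a b : QNum M) : QNum M := a.add ⟨b.neg, b.pos, b.den⟩

def Lt (a b : QNum M) : Prop :=
  a.pos * b.den + b.neg * a.den < b.pos * a.den + a.neg * b.den

/-- `|a - b| < r`. -/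
def DistLt (a b r : QNum M) : Prop := (a.sub b).Lt r ∧ (b.sub a).Lt r

end QNum

/-- A real number given through lower approximations: `x w a`, for `w` a power of two, says that
`a` is the approximation with error `2 / w`, so that the real lies in `[a, a + 2 / w]`. -/
abbrev Approx (M : BaseStructure.{u}) := M.Num → QNum M → Prop

namespace Approx

variable {M : BaseStructure.{u}}

def ofRat (q : QNum M) : Approx M := fun _ a => a = q

/-- The real `(p - m) + ∑_{i ≥ 1} d(2 ^ i) / 2 ^ i` with digits `d(2 ^ i) ∈ {0, 1, 2}`. For
`w = 2 ^ t` the approximation is `(p - m) + s / w` where `s = ∑_{i = 1}^t d(2 ^ i) 2 ^ (t - i)`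
is computed by the recursion `h(1) = 0`, `h(2 u) = 2 h(u) + d(2 u)` along powers of two. -/
def ofDigits (p m : M.Num) (d : M.Num → M.Num) : Approx M := fun w a =>
  ∃ h : M.Fn, M.app h 1 = 0 ∧
    (∀ u, IsPow2 u → u < w →
      M.app h ((1 + 1) * u) = (1 + 1) * M.app h u + d ((1 + 1) * u)) ∧
    a = ⟨p * w + M.app h w, m * w, w⟩

/-- `x < y` for reals. -/
def Lt (x y : Approx M) : Prop :=
  ∃ w a b, IsPow2 w ∧ x w a ∧ y w b ∧ (a.add (QNum.frac (1 + 1) w)).Lt b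

/-- `x ≤ y` for reals. -/
def Le (x y : Approx M) : Prop := ¬ y.Lt x

/-- `|x - y| < r` for reals `x`, `y` and a rational `r`. -/
def DistLt (x y : Approx M) (r : QNum M) : Prop :=
  ∃ w a b, IsPow2 w ∧ x w a ∧ y w b ∧
    ((a.sub b).add (QNum.frac (1 + 1) w)).Lt r ∧ ((b.sub a).add (QNum.frac (1 + 1) w)).Lt r

end Approx

/-- A code for a real: an integer `pos - neg` and a function that gives the digits. -/
structure RealCode (M : BaseStructure.{u}) where
  pos : M.Num
  neg : M.Num
  dig : M.Fn

namespace RealCode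

variable {M : BaseStructure.{u}}

/-- The digits at the places `2 ^ i`, `i ≥ 1`, are in `{0, 1, 2}`. -/
def Valid (x : RealCode M) : Prop := ∀ w, IsPow2 w → 1 < w → M.app x.dig w ≤ 1 + 1

def val (x : RealCode M) : Approx M := Approx.ofDigits x.pos x.neg (M.app x.dig)

/-- The coded real is in `[0, 1]`. -/
def InUnit (x : RealCode M) : Prop :=
  (Approx.ofRat (QNum.frac 0 1)).Le x.val ∧ x.val.Le (Approx.ofRat (QNum.frac 1 1))

end RealCode

/-! ### Continuous functions on the unit interval -/

/-- `p / q` is a point of the dense set of rationals in `[0, 1]`; its index is `pair p q`. -/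
def UnitPoint {M : BaseStructure.{u}} (p q : M.Num) : Prop := 0 < q ∧ p ≤ q

/-- A code for a continuous function `f : [0, 1] → ℝ`: the values of `f` at the rational points
(integer part and digits, as functions of the index) and a modulus of uniform continuity. -/
structure FunCode (M : BaseStructure.{u}) where
  valPos : M.Fn
  valNeg : M.Fn
  valDig : M.Fn
  modulus : M.Fn

namespace FunCode

variable {M : BaseStructure.{u}}

/-- The value `f(p / q)`. -/
def valueAt (f : FunCode M) (p q : M.Num) : Approx M :=
  Approx.ofDigits (M.app f.valPos (pair p q)) (M.app f.valNeg (pair p q))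
    (fun w => M.app f.valDig (pair (pair p q) w))

/-- `f` codes a continuous function: the values at rational points are reals, and `|y - z| < 1 / e`
with `e = modulus k > 0` implies `|f y - f z| < 1 / k`, for every number `k > 0`. -/
def Continuous (f : FunCode M) : Prop :=
  (∀ p q, UnitPoint p q → ∀ w, IsPow2 w → 1 < w →
    M.app f.valDig (pair (pair p q) w) ≤ 1 + 1) ∧
  ∀ k, 0 < k → 0 < M.app f.modulus k ∧
    ∀ p q p' q', UnitPoint p q → UnitPoint p' q' →
      (QNum.frac p q).DistLt (QNum.frac p' q') (QNum.frac 1 (M.app f.modulus k)) →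
      (f.valueAt p q).DistLt (f.valueAt p' q') (QNum.frac 1 k)

/-- `f(x) = y`: `y` is the limit of `f` along the rational points that tend to `x`. -/
def EvalsTo (f : FunCode M) (x y : RealCode M) : Prop :=
  ∀ k, 0 < k → ∃ e, 0 < e ∧ ∀ p q, UnitPoint p q →
    x.val.DistLt (Approx.ofRat (QNum.frac p q)) (QNum.frac 1 e) →
    (f.valueAt p q).DistLt y.val (QNum.frac 1 k)

/-- `z` is an upper bound of `f` on `[0, 1]`. -/
def IsUpperBound (f : FunCode M) (z : RealCode M) : Prop :=
  ∀ x : RealCode M, x.Valid → x.InUnit → ∀ v : RealCode M, v.Valid → f.EvalsTo x v →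
    v.val.Le z.val

/-- `y` is the supremum (least upper bound) of `f` on `[0, 1]`. -/
def IsSupremum (f : FunCode M) (y : RealCode M) : Prop :=
  f.IsUpperBound y ∧ ∀ z : RealCode M, z.Valid → f.IsUpperBound z → y.val.Le z.val

end FunCode

/-- `g(n)` is (the code of) the pair of nonnegative rationals `(p / q, r / s)`. -/
def Returns {M : BaseStructure.{u}} (g : M.Fn) (n p q r s : M.Num) : Prop :=
  M.app g n = pair (pair p q) (pair r s) ∧ 0 < q ∧ 0 < s

/-- The constructive intermediate value theorem, as a statement about a structure. -/
def ConstructiveIVT (M : BaseStructure.{u}) : Prop :=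
  ∀ f : FunCode M, f.Continuous →
    (f.valueAt 0 1).Lt (Approx.ofRat (QNum.frac 0 1)) →
    (Approx.ofRat (QNum.frac 0 1)).Lt (f.valueAt 1 1) →
    ∃ g : M.Fn,
      (∀ n, 0 < n → ∃ p q r s, Returns g n p q r s ∧ r ≤ s ∧
        ∀ x : RealCode M, x.Valid →
          (Approx.ofRat (QNum.frac p q)).Lt x.val → x.val.Lt (Approx.ofRat (QNum.frac r s)) →
          (∃ y : RealCode M, y.Valid ∧ f.EvalsTo x y) ∧
          ∀ y : RealCode M, y.Valid → f.EvalsTo x y →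
            y.val.DistLt (Approx.ofRat (QNum.frac 0 1)) (QNum.frac 1 n)) ∧
      ∀ j k, 0 < j → j < k → ∀ p q r s p' q' r' s',
        Returns g j p q r s → Returns g k p' q' r' s' →
        (QNum.frac p q).Lt (QNum.frac p' q') ∧ (QNum.frac p' q').Lt (QNum.frac r' s') ∧
        (QNum.frac r' s').Lt (QNum.frac r s)

/-- The formulas `φp`, `φm`, `φd` compute the supremum of every continuous function on `[0, 1]`:
with the code of `f` as the function variables `0, 1, 2, 3`, they define the graphs of the two
numbers and of the digit function of a code for the supremum (number variable `0` is the output,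
number variable `1` the argument of the digit function). -/
def ComputesSupremum (M : BaseStructure.{u}) (φp φm φd : BForm) : Prop :=
  ∀ f : FunCode M, f.Continuous →
    ∃ y : RealCode M, y.Valid ∧ f.IsSupremum y ∧
      ∀ e : Val M, e.fn 0 = f.valPos → e.fn 1 = f.valNeg → e.fn 2 = f.valDig →
        e.fn 3 = f.modulus →
        (∀ z, φp.Sat (e.setNum 0 z) ↔ z = y.pos) ∧
        (∀ z, φm.Sat (e.setNum 0 z) ↔ z = y.neg) ∧
        ∀ n z, φd.Sat ((e.setNum 1 n).setNum 0 z) ↔ z = M.app y.dig n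

end WeakAnalysis

/-! A modulus of continuity reduces both statements to bounded searches on rational grids. For a
power of two `u`, the moduli for all precisions up to `16 u` have a maximum; on a grid finer than
this maximum (`grid`), the values of `f` at grid points, computed with precision `16 u`, determine
`f` up to a multiple of `1 / u`. A search through the grid is a bounded number quantifier, however
many points the grid has.

Bounded search does not by itself give recursion, which is needed to add up the digits of a real and
to choose nested intervals. Both recursions run along the powers of two up to `w`, hence have only
about `len w` steps, and their values stay below a bound `b w`. In base `B = b w + 1` such a run is
coded by one number below `B ^ len w * B`, and this power is a term of the language (`powLen`). So
"some code of a correct run ends in `y`" is a bounded quantifier formula; this is `recFun`,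
justified by `exists_recSeq` and `RecSeq.digit_eq`.

Real numbers are produced by `exists_limit`. If `|T (2 u) - T u| ≤ 1 / (4 u)`, the integer parts `A
u` of `u T u + u ν - 1 / 2` satisfy `A (2 u) - 2 A u ∈ {0, 1, 2}`, and these differences are the
digits of the limit of `T`. The redundant digit set absorbs the errors, so no digit ever has to be
revised. With `T u` the largest value at the grid points this gives the supremum; with `T u` the
value at a rational point close to a real `x` it gives `f(x)`.

For the intermediate value theorem a power of two `κ` is fixed that makes `f(0)` and `f(1)` large in
the unit `1 / (16 κ)`. At stage `u` values are measured in the unit `1 / (16 κ u)`; a grid point is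
clearly negative if its value is at most `-9`, clearly positive if it is at least `9`, and
neighbouring values differ by less than `3`. Passing to stage `2 u` roughly doubles the measured
values, so inside an interval with clear signs at its ends there is a strictly smaller one: from the
last clearly negative point before the first clearly positive one up to that one (`exists_ivStep`).
Within it all grid values are at most `12` in absolute value, so `f` is of order `1 / u`. The
intervals need not shrink to a point. Mediants of the ends of two successive stages turn the
sequence over powers of two into one over all `n` (`ends_strictMono`).

Inequalities are computed in the ordered field `Frac M` generated by the numbers of the model, while
induction is applied only to statements about the numbers themselves. The classes `Def` and `UFun`
assemble the formulas by instance search. Each formula is found once for all models, as the second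
claim demands. -/

namespace WeakAnalysis

set_option synthInstance.maxSize 4000
set_option synthInstance.maxHeartbeats 400000

/-! ### The ordered field of fractions of an ordered semiring with subtraction -/

section DiffRing

variable (N : Type u) [CommSemiring N] [LinearOrder N] [IsStrictOrderedRing N]

/-- Pairs `(a, b)`, read as `a - b`, with equal differences. -/
def diffSetoid : Setoid (N × N) where
  r x y := x.1 + y.2 = y.1 + x.2
  iseqv := ⟨fun _ => rfl, fun h => h.symm, fun {x y z} h k => by
    have : x.1 + z.2 + (y.1 + y.2) = z.1 + x.2 + (y.1 + y.2) := by
      calc x.1 + z.2 + (y.1 + y.2) = (x.1 + y.2) + (y.1 + z.2) := by ring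
        _ = (y.1 + x.2) + (z.1 + y.2) := by rw [h, k]
        _ = _ := by ring
    exact add_right_cancel this⟩

/-- The ring of formal differences of elements of `N`. -/
def DiffRing : Type u := Quotient (diffSetoid N)

variable {N}

namespace DiffRing

def mk (a b : N) : DiffRing N := Quotient.mk (diffSetoid N) (a, b)

theorem mk_eq {a b c d : N} : mk a b = mk c d ↔ a + d = c + b :=
  ⟨fun h => Quotient.exact h, fun h => Quotient.sound h⟩

theorem mk_surj (x : DiffRing N) : ∃ a b, x = mk a b := by
  induction x using Quotient.inductionOn with
  | h p => exact ⟨p.1, p.2, rfl⟩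

def add : DiffRing N → DiffRing N → DiffRing N :=
  Quotient.map₂ (fun x y => (x.1 + y.1, x.2 + y.2)) fun x x' h y y' k => by
    have h' : x.1 + x'.2 = x'.1 + x.2 := h
    have k' : y.1 + y'.2 = y'.1 + y.2 := k
    change x.1 + y.1 + (x'.2 + y'.2) = x'.1 + y'.1 + (x.2 + y.2)
    calc _ = (x.1 + x'.2) + (y.1 + y'.2) := by ring
      _ = _ := by rw [h', k']; ring

def neg : DiffRing N → DiffRing N :=
  Quotient.map (fun x => (x.2, x.1)) fun x x' h => by
    have h' : x.1 + x'.2 = x'.1 + x.2 := h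
    change x.2 + x'.1 = x'.2 + x.1
    rw [add_comm, ← h', add_comm]

def mul : DiffRing N → DiffRing N → DiffRing N :=
  Quotient.map₂ (fun x y => (x.1 * y.1 + x.2 * y.2, x.1 * y.2 + x.2 * y.1)) fun x x' h y y' k => by
    have h' : x.1 + x'.2 = x'.1 + x.2 := h
    have k' : y.1 + y'.2 = y'.1 + y.2 := k
    change x.1 * y.1 + x.2 * y.2 + (x'.1 * y'.2 + x'.2 * y'.1) =
      x'.1 * y'.1 + x'.2 * y'.2 + (x.1 * y.2 + x.2 * y.1)
    grind

instance : Zero (DiffRing N) := ⟨mk 0 0⟩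
instance : One (DiffRing N) := ⟨mk 1 0⟩
instance : Add (DiffRing N) := ⟨add⟩
instance : Neg (DiffRing N) := ⟨neg⟩
instance : Mul (DiffRing N) := ⟨mul⟩

theorem mk_add (a b c d : N) : mk a b + mk c d = mk (a + c) (b + d) := rfl
theorem mk_neg (a b : N) : -mk a b = mk b a := rfl
theorem mk_mul (a b c d : N) : mk a b * mk c d = mk (a * c + b * d) (a * d + b * c) := rfl
theorem zero_def : (0 : DiffRing N) = mk 0 0 := rfl
theorem one_def : (1 : DiffRing N) = mk 1 0 := rfl

instance : CommRing (DiffRing N) where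
  add_assoc x y z := by
    obtain ⟨a, b, rfl⟩ := mk_surj x; obtain ⟨c, d, rfl⟩ := mk_surj y
    obtain ⟨e, f, rfl⟩ := mk_surj z
    simp only [mk_add, mk_eq]; ring
  zero_add x := by
    obtain ⟨a, b, rfl⟩ := mk_surj x
    simp only [zero_def, mk_add, mk_eq]; ring
  add_zero x := by
    obtain ⟨a, b, rfl⟩ := mk_surj x
    simp only [zero_def, mk_add, mk_eq]; ring
  add_comm x y := by
    obtain ⟨a, b, rfl⟩ := mk_surj x; obtain ⟨c, d, rfl⟩ := mk_surj y
    simp only [mk_add, mk_eq]; ring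
  neg_add_cancel x := by
    obtain ⟨a, b, rfl⟩ := mk_surj x
    simp only [zero_def, mk_neg, mk_add, mk_eq]; ring
  mul_assoc x y z := by
    obtain ⟨a, b, rfl⟩ := mk_surj x; obtain ⟨c, d, rfl⟩ := mk_surj y
    obtain ⟨e, f, rfl⟩ := mk_surj z
    simp only [mk_mul, mk_eq]; ring
  one_mul x := by
    obtain ⟨a, b, rfl⟩ := mk_surj x
    simp only [one_def, mk_mul, mk_eq]; ring
  mul_one x := by
    obtain ⟨a, b, rfl⟩ := mk_surj x
    simp only [one_def, mk_mul, mk_eq]; ring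
  mul_comm x y := by
    obtain ⟨a, b, rfl⟩ := mk_surj x; obtain ⟨c, d, rfl⟩ := mk_surj y
    simp only [mk_mul, mk_eq]; ring
  left_distrib x y z := by
    obtain ⟨a, b, rfl⟩ := mk_surj x; obtain ⟨c, d, rfl⟩ := mk_surj y
    obtain ⟨e, f, rfl⟩ := mk_surj z
    simp only [mk_mul, mk_add, mk_eq]; ring
  right_distrib x y z := by
    obtain ⟨a, b, rfl⟩ := mk_surj x; obtain ⟨c, d, rfl⟩ := mk_surj y
    obtain ⟨e, f, rfl⟩ := mk_surj z
    simp only [mk_mul, mk_add, mk_eq]; ring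
  zero_mul x := by
    obtain ⟨a, b, rfl⟩ := mk_surj x
    simp only [zero_def, mk_mul, mk_eq]; ring
  mul_zero x := by
    obtain ⟨a, b, rfl⟩ := mk_surj x
    simp only [zero_def, mk_mul, mk_eq]; ring
  nsmul := nsmulRec
  zsmul := zsmulRec

/-- The embedding of the semiring. -/
def of (a : N) : DiffRing N := mk a 0

theorem of_injective : Function.Injective (of : N → DiffRing N) := fun a b h => by
  simpa using mk_eq.1 h

theorem of_add (a b : N) : of (a + b) = of a + of b := by
  simp [of, mk_add]

theorem of_mul (a b : N) : of (a * b) = of a * of b := by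
  simp [of, mk_mul]

theorem of_zero : of (0 : N) = 0 := rfl
theorem of_one : of (1 : N) = 1 := rfl

variable [ExistsAddOfLE N]

/-- Subtraction in `N` removes the smaller component of a formal difference. The absence of zero
divisors then passes from `N` to the ring. -/
theorem eq_of_or_neg (x : DiffRing N) : ∃ a : N, x = of a ∨ x = -of a := by
  obtain ⟨a, b, rfl⟩ := mk_surj x
  rcases le_total b a with h | h
  · obtain ⟨c, rfl⟩ := exists_add_of_le h
    exact ⟨c, .inl (by rw [of, mk_eq]; ring)⟩
  · obtain ⟨c, rfl⟩ := exists_add_of_le h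
    exact ⟨c, .inr (by rw [of, mk_neg, mk_eq]; ring)⟩

instance : Nontrivial (DiffRing N) :=
  ⟨0, 1, fun h => zero_ne_one (of_injective (of_zero.trans (h.trans of_one.symm)))⟩

instance : IsDomain (DiffRing N) := by
  have : NoZeroDivisors (DiffRing N) := ⟨by
    intro x y h
    obtain ⟨a, ha⟩ := eq_of_or_neg x
    obtain ⟨b, hb⟩ := eq_of_or_neg y
    have h0 : of (a * b) = of 0 := by
      rw [of_mul, of_zero]
      rcases ha with rfl | rfl <;> rcases hb with rfl | rfl <;> simpa using h
    have h1 : a = 0 ∨ b = 0 := mul_eq_zero.1 (of_injective h0)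
    rcases h1 with rfl | rfl
    · left; rcases ha with rfl | rfl <;> simp [of_zero]
    · right; rcases hb with rfl | rfl <;> simp [of_zero]⟩
  exact NoZeroDivisors.to_isDomain _

end DiffRing

variable (N) in
/-- The ordered field of fractions of formal differences. -/
def DiffField [ExistsAddOfLE N] : Type u := FractionRing (DiffRing N)

namespace DiffField

variable [ExistsAddOfLE N]

noncomputable instance : Field (DiffField N) := inferInstanceAs (Field (FractionRing (DiffRing N)))

/-- The embedding of the ring of differences. -/
noncomputable def ofDiff : DiffRing N →+* DiffField N :=
  algebraMap (DiffRing N) (FractionRing (DiffRing N))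

/-- The embedding of the semiring. -/
noncomputable def of (a : N) : DiffField N := ofDiff (DiffRing.of a)

theorem of_injective : Function.Injective (of : N → DiffField N) := fun _ _ h =>
  DiffRing.of_injective (IsFractionRing.injective (DiffRing N) (FractionRing (DiffRing N)) h)

theorem of_add (a b : N) : of (a + b) = of a + of b := by
  simp only [of, DiffRing.of_add, map_add]

theorem of_mul (a b : N) : of (a * b) = of a * of b := by
  simp only [of, DiffRing.of_mul, map_mul]

theorem of_zero : of (0 : N) = 0 := by
  simp only [of, DiffRing.of_zero, map_zero]

theorem of_one : of (1 : N) = 1 := by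
  simp only [of, DiffRing.of_one, map_one]

theorem of_ne_zero {a : N} (h : 0 < a) : of a ≠ 0 := fun h' =>
  h.ne' (of_injective (h'.trans of_zero.symm))

/-- Signs of numerator and denominator can be collected in front of the fraction; this makes the
cone of nonnegative elements total. -/
theorem exists_eq (x : DiffField N) :
    ∃ a b : N, 0 ≤ a ∧ 0 < b ∧ (x = of a / of b ∨ x = -(of a / of b)) := by
  have norm : ∀ z : DiffRing N, ∃ a : N, 0 ≤ a ∧ (z = DiffRing.of a ∨ z = -DiffRing.of a) := by
    intro z
    obtain ⟨a, ha⟩ := DiffRing.eq_of_or_neg z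
    rcases le_total 0 a with h | h
    · exact ⟨a, h, ha⟩
    · obtain ⟨c, hc⟩ := exists_add_of_le h
      have e : DiffRing.of a = -DiffRing.of c := by
        rw [eq_neg_iff_add_eq_zero, ← DiffRing.of_add, ← hc, DiffRing.of_zero]
      refine ⟨c, ?_, ?_⟩
      · by_contra hc0
        have : a + c < 0 + 0 := add_lt_add_of_le_of_lt h (not_le.1 hc0)
        rw [← hc] at this; simp at this
      · rw [← neg_eq_iff_eq_neg] at e
        rcases ha with rfl | rfl
        · right; rw [← e, neg_neg]
        · left; rw [← e]
  obtain ⟨p, q, hq, hx⟩ := IsFractionRing.div_surjective (A := DiffRing N)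
    (K := FractionRing (DiffRing N)) x
  obtain ⟨a, ha, ha'⟩ := norm p
  obtain ⟨b, hb, hb'⟩ := norm q
  have hb0 : 0 < b := by
    refine lt_of_le_of_ne hb fun h => nonZeroDivisors.ne_zero hq ?_
    subst h
    rcases hb' with rfl | rfl <;> simp [DiffRing.of_zero]
  refine ⟨a, b, ha, hb0, ?_⟩
  have hx' : x = ofDiff p / ofDiff q := hx.symm
  rw [hx']
  unfold of
  rcases ha' with rfl | rfl <;> rcases hb' with rfl | rfl
  · exact .inl rfl
  · right; rw [map_neg, div_neg]
  · right; rw [map_neg, neg_div]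
  · left; rw [map_neg, map_neg, neg_div_neg_eq]

variable (N) in
/-- The nonnegative elements. -/
noncomputable def cone : RingCone (DiffField N) where
  carrier := {x | ∃ a b : N, 0 ≤ a ∧ 0 < b ∧ x = of a / of b}
  mul_mem' := by
    rintro _ _ ⟨a, b, ha, hb, rfl⟩ ⟨c, d, hc, hd, rfl⟩
    exact ⟨a * c, b * d, mul_nonneg ha hc, mul_pos hb hd, by rw [of_mul, of_mul, div_mul_div_comm]⟩
  one_mem' := ⟨1, 1, zero_le_one, one_pos, by simp [of_one]⟩
  add_mem' := by
    rintro _ _ ⟨a, b, ha, hb, rfl⟩ ⟨c, d, hc, hd, rfl⟩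
    exact ⟨a * d + b * c, b * d, add_nonneg (mul_nonneg ha hd.le) (mul_nonneg hb.le hc),
      mul_pos hb hd, by
        rw [of_mul, of_add, of_mul, of_mul, div_add_div _ _ (of_ne_zero hb) (of_ne_zero hd)]⟩
  zero_mem' := ⟨0, 1, le_rfl, one_pos, by simp [of_zero]⟩
  eq_zero_of_mem_of_neg_mem' := by
    rintro _ ⟨a, b, ha, hb, rfl⟩ ⟨c, d, hc, hd, h⟩
    have h1 : of a / of b + of c / of d = 0 := by rw [← h]; ring
    rw [div_add_div _ _ (of_ne_zero hb) (of_ne_zero hd), div_eq_zero_iff] at h1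
    have h2 : a * d + b * c = 0 := by
      apply of_injective
      rw [of_add, of_mul, of_mul, of_zero]
      exact h1.resolve_right (mul_ne_zero (of_ne_zero hb) (of_ne_zero hd))
    have h3 : a = 0 := by
      by_contra hne
      have h4 : 0 < a * d := mul_pos (lt_of_le_of_ne ha (Ne.symm hne)) hd
      have h5 : 0 ≤ b * c := mul_nonneg hb.le hc
      exact (add_pos_of_pos_of_nonneg h4 h5).ne' h2
    rw [h3, of_zero, zero_div]

instance : HasMemOrNegMem (cone N) where
  mem_or_neg_mem x := by
    obtain ⟨a, b, ha, hb, rfl | rfl⟩ := exists_eq x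
    · exact .inl ⟨a, b, ha, hb, rfl⟩
    · exact .inr ⟨a, b, ha, hb, by rw [neg_neg]⟩

noncomputable instance : LinearOrder (DiffField N) :=
  haveI : DecidablePred (· ∈ cone N) := Classical.decPred _
  .mkOfAddGroupCone (cone N) 

instance : IsStrictOrderedRing (DiffField N) :=
  have : IsOrderedRing (DiffField N) := .mkOfCone (cone N)
  IsOrderedRing.toIsStrictOrderedRing _

theorem of_nonneg {a : N} (h : 0 ≤ a) : 0 ≤ of a := by
  change of a - 0 ∈ cone N
  exact ⟨a, 1, h, one_pos, by simp [of_one]⟩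

theorem of_lt {a b : N} : of a < of b ↔ a < b := by
  have key : ∀ {a b : N}, a < b → of a < of b := by
    intro a b h
    obtain ⟨c, rfl⟩ := exists_add_of_le h.le
    have hc : 0 ≤ c := by
      by_contra hn
      have := add_lt_add_right (not_le.1 hn) a
      rw [add_zero] at this
      exact lt_asymm h this
    refine lt_of_le_of_ne ?_ fun h' => h.ne (of_injective h')
    rw [of_add]
    exact le_add_of_nonneg_right (of_nonneg hc)
  refine ⟨fun h => ?_, key⟩
  by_contra hn
  rcases (not_lt.1 hn).lt_or_eq with h' | h'
  · exact lt_asymm h (key h')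
  · exact h.ne (by rw [h'])

/-- Discreteness makes every denominator at least `1`, so a fraction is bounded by its numerator.
The field is therefore Archimedean relative to the numbers of the model. -/
theorem exists_lt_of (h1 : ∀ b : N, 0 < b → 1 ≤ b) (x : DiffField N) : ∃ a : N, x < of a := by
  obtain ⟨a, b, ha, hb, hx⟩ := exists_eq x
  have hb1 : (1 : DiffField N) ≤ of b := by
    rw [← of_one]; exact not_lt.1 fun h => (h1 b hb).not_gt (of_lt.1 h)
  have ha1 : 0 ≤ of a := of_nonneg ha
  have hd : 0 ≤ of a / of b := div_nonneg ha1 (zero_le_one.trans hb1)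
  have hc : of a / of b ≤ of a := div_le_self ha1 hb1
  refine ⟨a + 1, ?_⟩
  rw [of_add, of_one]
  rcases hx with rfl | rfl <;> linarith

end DiffField

end DiffRing

/-! ### The ordered field of fractions of a model -/

section Model

variable {M : BaseStructure.{u}}

theorem BasicArithmetic.zero_add (h : BasicArithmetic M) (x : M.Num) : 0 + x = x := by
  rw [h.add_comm, h.add_zero]

theorem BasicArithmetic.lt_succ (h : BasicArithmetic M) (x : M.Num) : x < x + 1 := by
  have := h.add_lt_add 0 1 x h.zero_lt_one
  rwa [h.zero_add, h.add_comm] at this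

theorem BasicArithmetic.lt_asymm (h : BasicArithmetic M) {x y : M.Num} (hxy : x < y) : ¬ y < x :=
  fun hyx => h.lt_irrefl _ (h.lt_trans _ _ _ hxy hyx)

/-- Subtraction is not among the axioms. It follows by induction on `y` for the formula "`y < x` or
`x + z = y` for some `z < y + 1`", where the bound on `z` keeps the formula within the induction
scheme. -/
theorem BaseSystem.exists_add (h : BaseSystem M) {x y : M.Num} (hxy : x < y) :
    ∃ z, y = x + z := by
  have hb := h.basic
  obtain ⟨a⟩ := M.fn_nonempty
  obtain ⟨A⟩ := M.op_nonempty
  have key := h.induction (.or (.lt (.var 0) (.var 1))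
    (.exLt 2 (.add (.var 0) .one) (.eq (.add (.var 1) (.var 2)) (.var 0)))) 0
    ⟨fun _ => x, fun _ => a, fun _ => A⟩
  simp only [BForm.Sat, NumTerm.eval, Val.setNum, Function.update_self, ne_eq,
    Function.update_of_ne, not_false_eq_true, one_ne_zero, OfNat.zero_ne_ofNat, OfNat.one_ne_ofNat] at key
  have h0 : 0 < x ∨ ∃ z, z < 0 + 1 ∧ x + z = 0 := by
    rcases hb.zero_le x with h0 | h0
    · exact .inl h0
    · exact .inr ⟨0, by rw [hb.zero_add]; exact hb.zero_lt_one, by rw [← h0, hb.add_zero]⟩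
  have hs : ∀ z, (z < x ∨ ∃ t, t < z + 1 ∧ x + t = z) →
      (z + 1 < x ∨ ∃ t, t < z + 1 + 1 ∧ x + t = z + 1) := by
    rintro z (hz | ⟨t, ht, hz⟩)
    · rcases hb.succ_le _ _ hz with h1 | h1
      · exact .inl h1
      · refine .inr ⟨0, ?_, by rw [hb.add_zero, h1]⟩
        have h2 := hb.lt_succ (z + 1)
        rcases hb.zero_le (z + 1) with h3 | h3
        · exact hb.lt_trans _ _ _ h3 h2
        · rwa [← h3] at h2 ⊢
    · exact .inr ⟨t + 1, hb.add_lt_add _ _ _ ht, by rw [← hb.add_assoc, hz]⟩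
  rcases key h0 hs y with h1 | ⟨z, -, hz⟩
  · exact absurd hxy (hb.lt_asymm h1)
  · exact ⟨z, hz.symm⟩

/-- The semiring of numbers of a model. -/
abbrev BaseSystem.commSemiring (h : BaseSystem M) : CommSemiring M.Num where
  add_assoc := h.basic.add_assoc
  zero_add := h.basic.zero_add
  add_zero := h.basic.add_zero
  add_comm := h.basic.add_comm
  mul_assoc := h.basic.mul_assoc
  one_mul x := by rw [h.basic.mul_comm, h.basic.mul_one]
  mul_one := h.basic.mul_one
  mul_comm := h.basic.mul_comm
  left_distrib := h.basic.mul_add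
  right_distrib x y z := by
    rw [h.basic.mul_comm, h.basic.mul_add, h.basic.mul_comm z, h.basic.mul_comm z]
  zero_mul x := by rw [h.basic.mul_comm, h.basic.mul_zero]
  mul_zero := h.basic.mul_zero
  nsmul := nsmulRec

open Classical in
/-- The order of the numbers of a model. -/
noncomputable abbrev BaseSystem.linearOrder (h : BaseSystem M) : LinearOrder M.Num where
  le_refl x := .inr rfl
  le_trans x y z := by
    rintro (hxy | rfl) (hyz | rfl)
    · exact .inl (h.basic.lt_trans _ _ _ hxy hyz)
    · exact .inl hxy
    · exact .inl hyz
    · exact .inr rfl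
  le_antisymm x y := by
    rintro (hxy | rfl) (hyx | hyx)
    · exact absurd hyx (h.basic.lt_asymm hxy)
    · exact hyx.symm
    · rfl
    · rfl
  le_total x y := by
    rcases h.basic.lt_trichotomy x y with h1 | h1 | h1
    · exact .inl (.inl h1)
    · exact .inl (.inr h1)
    · exact .inr (.inl h1)
  lt_iff_le_not_ge x y := by
    refine ⟨fun hxy => ⟨.inl hxy, ?_⟩, ?_⟩
    · rintro (h1 | rfl)
      · exact h.basic.lt_asymm hxy h1
      · exact h.basic.lt_irrefl _ hxy
    · rintro ⟨h1 | rfl, h2⟩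
      · exact h1
      · exact absurd (.inr rfl) h2
  toDecidableLE := fun _ _ => Classical.propDecidable _

theorem BaseSystem.isStrictOrderedRing (h : BaseSystem M) :
    letI := h.commSemiring
    letI := h.linearOrder
    IsStrictOrderedRing M.Num :=
  letI := h.commSemiring
  letI := h.linearOrder
  have h1 : ∀ a b : M.Num, a ≤ b → ∀ c, c + a ≤ c + b := by
    rintro a b (hab | rfl) c
    · left; rw [h.basic.add_comm c, h.basic.add_comm c]; exact h.basic.add_lt_add _ _ _ hab
    · exact le_rfl
  have h2 : ∀ a b c : M.Num, a + b ≤ a + c → b ≤ c := by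
    intro a b c habc
    by_contra hn
    have h3 := h.basic.add_lt_add _ _ a (not_le.1 hn)
    rw [h.basic.add_comm c, h.basic.add_comm b] at h3
    exact absurd habc (not_le.2 h3)
  { add_le_add_left := fun a b hab c => by
      rw [add_comm a, add_comm b]; exact h1 a b hab c
    le_of_add_le_add_left := h2
    zero_le_one := .inl h.basic.zero_lt_one
    exists_pair_ne := ⟨0, 1, fun h01 => h.basic.lt_irrefl 0 (by
      have := h.basic.zero_lt_one
      rwa [← h01] at this)⟩
    mul_lt_mul_of_pos_left := fun a ha b c hbc => by
      change a * b < a * c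
      rw [mul_comm a, mul_comm a]; exact h.basic.mul_lt_mul _ _ _ ha hbc
    mul_lt_mul_of_pos_right := fun a ha b c hbc => h.basic.mul_lt_mul _ _ _ ha hbc }

theorem BaseSystem.existsAddOfLE (h : BaseSystem M) :
    letI := h.commSemiring
    letI := h.linearOrder
    ExistsAddOfLE M.Num :=
  letI := h.commSemiring
  letI := h.linearOrder
  ⟨by
    rintro a b (hab | rfl)
    · exact h.exists_add hab
    · exact ⟨0, (add_zero _).symm⟩⟩

variable [hM : Fact (BaseSystem M)]

variable (M) in
/-- The ordered field generated by the numbers of a model. -/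
def Frac : Type u :=
  letI := hM.out.commSemiring
  letI := hM.out.linearOrder
  haveI := hM.out.isStrictOrderedRing
  haveI := hM.out.existsAddOfLE
  DiffField M.Num

noncomputable instance : Field (Frac M) :=
  letI := hM.out.commSemiring
  letI := hM.out.linearOrder
  haveI := hM.out.isStrictOrderedRing
  haveI := hM.out.existsAddOfLE
  inferInstanceAs (Field (DiffField M.Num))

noncomputable instance : LinearOrder (Frac M) :=
  letI := hM.out.commSemiring
  letI := hM.out.linearOrder
  haveI := hM.out.isStrictOrderedRing
  haveI := hM.out.existsAddOfLE
  inferInstanceAs (LinearOrder (DiffField M.Num))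

instance : IsStrictOrderedRing (Frac M) :=
  letI := hM.out.commSemiring
  letI := hM.out.linearOrder
  haveI := hM.out.isStrictOrderedRing
  haveI := hM.out.existsAddOfLE
  inferInstanceAs (IsStrictOrderedRing (DiffField M.Num))

/-- A number as an element of the field. -/
@[coe]
noncomputable def Frac.of (x : M.Num) : Frac M :=
  letI := hM.out.commSemiring
  letI := hM.out.linearOrder
  haveI := hM.out.isStrictOrderedRing
  haveI := hM.out.existsAddOfLE
  DiffField.of x

noncomputable instance : Coe M.Num (Frac M) := ⟨Frac.of⟩

namespace Frac

@[norm_cast]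
theorem coe_inj {x y : M.Num} : (x : Frac M) = y ↔ x = y := by
  let _ := hM.out.commSemiring
  let _ := hM.out.linearOrder
  have := hM.out.isStrictOrderedRing
  have := hM.out.existsAddOfLE
  exact DiffField.of_injective.eq_iff

@[norm_cast]
theorem coe_lt {x y : M.Num} : (x : Frac M) < y ↔ x < y := by
  let _ := hM.out.commSemiring
  let _ := hM.out.linearOrder
  have := hM.out.isStrictOrderedRing
  have := hM.out.existsAddOfLE
  exact DiffField.of_lt

@[norm_cast]
theorem coe_le {x y : M.Num} : (x : Frac M) ≤ y ↔ x ≤ y := by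
  rw [le_iff_lt_or_eq, coe_lt, coe_inj]; rfl

@[simp, norm_cast]
theorem coe_add (x y : M.Num) : ((x + y : M.Num) : Frac M) = x + y := by
  let _ := hM.out.commSemiring
  let _ := hM.out.linearOrder
  have := hM.out.isStrictOrderedRing
  have := hM.out.existsAddOfLE
  exact DiffField.of_add x y

@[simp, norm_cast]
theorem coe_mul (x y : M.Num) : ((x * y : M.Num) : Frac M) = x * y := by
  let _ := hM.out.commSemiring
  let _ := hM.out.linearOrder
  have := hM.out.isStrictOrderedRing
  have := hM.out.existsAddOfLE
  exact DiffField.of_mul x y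

@[simp, norm_cast]
theorem coe_zero : ((0 : M.Num) : Frac M) = 0 := by
  let _ := hM.out.commSemiring
  let _ := hM.out.linearOrder
  have := hM.out.isStrictOrderedRing
  have := hM.out.existsAddOfLE
  exact DiffField.of_zero

@[simp, norm_cast]
theorem coe_one : ((1 : M.Num) : Frac M) = 1 := by
  let _ := hM.out.commSemiring
  let _ := hM.out.linearOrder
  have := hM.out.isStrictOrderedRing
  have := hM.out.existsAddOfLE
  exact DiffField.of_one

theorem coe_nonneg (x : M.Num) : (0 : Frac M) ≤ x := by
  rw [← coe_zero, coe_le]; exact hM.out.basic.zero_le x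

theorem coe_add_one_le {x y : M.Num} (h : (x : Frac M) < y) : (x : Frac M) + 1 ≤ y := by
  rw [← coe_one, ← coe_add, coe_le]
  exact hM.out.basic.succ_le _ _ (coe_lt.1 h)

theorem coe_le_of_lt_add_one {x y : M.Num} (h : (x : Frac M) < y + 1) : (x : Frac M) ≤ y :=
  not_lt.1 fun h' => absurd h (not_lt.2 (coe_add_one_le h'))

theorem one_le_coe {x : M.Num} (h : (0 : Frac M) < x) : (1 : Frac M) ≤ x := by
  rw [← coe_zero] at h
  simpa using coe_add_one_le h

/-- Subtraction of numbers. -/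
theorem exists_sub {x y : M.Num} (h : (x : Frac M) ≤ y) : ∃ z : M.Num, (y : Frac M) = x + z := by
  rcases coe_le.1 h with h1 | rfl
  · obtain ⟨z, rfl⟩ := hM.out.exists_add h1
    exact ⟨z, by simp⟩
  · exact ⟨0, by simp⟩

theorem exists_lt_coe (x : Frac M) : ∃ a : M.Num, x < a := by
  let _ := hM.out.commSemiring
  let _ := hM.out.linearOrder
  have := hM.out.isStrictOrderedRing
  have := hM.out.existsAddOfLE
  refine DiffField.exists_lt_of (fun b hb => ?_) x
  have := hM.out.basic.succ_le _ _ hb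
  rwa [hM.out.basic.zero_add] at this

end Frac

end Model

/-! ### Pairs -/

section Pairs

variable {M : BaseStructure.{u}}

/-- With `s = a + b`, the code `s * s + a` lies between `s * s` and `(s + 1) * (s + 1)`. So it
determines `s`, then `a`, then `b`. -/
theorem pair_inj [Fact (BaseSystem M)] {a b c d : M.Num} (h : pair a b = pair c d) :
    a = c ∧ b = d := by
  have h' : ((a : Frac M) + b) * (a + b) + a = (c + d) * (c + d) + c := by
    exact_mod_cast (Frac.coe_inj (M := M)).2 h
  have ha := Frac.coe_nonneg a; have hb := Frac.coe_nonneg b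
  have hc := Frac.coe_nonneg c; have hd := Frac.coe_nonneg d
  have hs : (a : Frac M) + b = c + d := by
    rcases lt_trichotomy ((a : Frac M) + b) (c + d) with hlt | heq | hlt
    · have : ((a + b : M.Num) : Frac M) + 1 ≤ ((c + d : M.Num) : Frac M) :=
        Frac.coe_add_one_le (by push_cast; exact hlt)
      push_cast at this
      nlinarith
    · exact heq
    · have : ((c + d : M.Num) : Frac M) + 1 ≤ ((a + b : M.Num) : Frac M) :=
        Frac.coe_add_one_le (by push_cast; exact hlt)
      push_cast at this
      nlinarith
  rw [hs] at h'
  have hac : (a : Frac M) = c := by linarith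
  exact ⟨Frac.coe_inj.1 hac, Frac.coe_inj.1 (by linarith)⟩

theorem pair_mono [Fact (BaseSystem M)] {a b c d : M.Num} (h : a ≤ c) (k : b ≤ d) :
    pair a b ≤ pair c d := by
  rw [← Frac.coe_le] at *
  simp only [pair, Frac.coe_add, Frac.coe_mul]
  have ha := Frac.coe_nonneg a; have hb := Frac.coe_nonneg b
  nlinarith

theorem left_le_pair [Fact (BaseSystem M)] (a b : M.Num) : a ≤ pair a b := by
  rw [← Frac.coe_le]
  simp only [pair, Frac.coe_add, Frac.coe_mul]
  have ha := Frac.coe_nonneg a; have hb := Frac.coe_nonneg b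
  nlinarith

theorem right_le_pair [Fact (BaseSystem M)] (a b : M.Num) : b ≤ pair a b := by
  rcases eq_or_lt_of_le (Frac.coe_nonneg b) with h | h
  · rw [← Frac.coe_le, ← h]; exact Frac.coe_nonneg _
  · have := Frac.one_le_coe h
    rw [← Frac.coe_le]
    simp only [pair, Frac.coe_add, Frac.coe_mul]
    have ha := Frac.coe_nonneg a
    nlinarith

open Classical in
/-- First component of a pair, zero for numbers that are not pairs. -/
noncomputable def fst (x : M.Num) : M.Num :=
  if h : ∃ a b, x = pair a b then h.choose else 0

open Classical in
/-- Second component of a pair, zero for numbers that are not pairs. -/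
noncomputable def snd (x : M.Num) : M.Num :=
  if h : ∃ b a, x = pair a b then h.choose else 0

@[simp]
theorem fst_pair [Fact (BaseSystem M)] (a b : M.Num) : fst (pair a b) = a := by
  have h : ∃ c d, pair a b = pair c d := ⟨a, b, rfl⟩
  rw [fst, dif_pos h]
  obtain ⟨d, hd⟩ := h.choose_spec
  exact (pair_inj hd).1.symm

@[simp]
theorem snd_pair [Fact (BaseSystem M)] (a b : M.Num) : snd (pair a b) = b := by
  have h : ∃ d c, pair a b = pair c d := ⟨b, a, rfl⟩
  rw [snd, dif_pos h]
  obtain ⟨d, hd⟩ := h.choose_spec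
  exact (pair_inj hd).2.symm

theorem lt_add_one_iff [Fact (BaseSystem M)] {x y : M.Num} : x < y + 1 ↔ x ≤ y := by
  rw [← Frac.coe_lt, ← Frac.coe_le]
  push_cast
  exact ⟨Frac.coe_le_of_lt_add_one, fun h => by linarith⟩

/-- Components never exceed their pair, so the graph of the projection needs bounded quantifiers
only. The second disjunct accounts for the default value `0`. -/
theorem eq_fst_iff [Fact (BaseSystem M)] {x y : M.Num} : y = fst x ↔
    (∃ b, b < x + 1 ∧ x = pair y b) ∨
      ((¬ ∃ a, a < x + 1 ∧ ∃ b, b < x + 1 ∧ x = pair a b) ∧ y = 0) := by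
  by_cases h : ∃ a b, x = pair a b
  · obtain ⟨a, b, rfl⟩ := h
    rw [fst_pair]
    constructor
    · rintro rfl
      exact .inl ⟨b, lt_add_one_iff.2 (right_le_pair _ _), rfl⟩
    · rintro (⟨c, -, hc⟩ | ⟨hn, -⟩)
      · exact (pair_inj hc).1.symm
      · exact absurd ⟨a, lt_add_one_iff.2 (left_le_pair _ _), b,
          lt_add_one_iff.2 (right_le_pair _ _), rfl⟩ hn
  · rw [fst, dif_neg h]
    refine ⟨fun hy => .inr ⟨fun ⟨a, _, b, _, hab⟩ => h ⟨a, b, hab⟩, hy⟩, ?_⟩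
    rintro (⟨c, -, hc⟩ | ⟨-, hy⟩)
    · exact absurd ⟨_, _, hc⟩ h
    · exact hy

theorem eq_snd_iff [Fact (BaseSystem M)] {x y : M.Num} : y = snd x ↔
    (∃ a, a < x + 1 ∧ x = pair a y) ∨
      ((¬ ∃ a, a < x + 1 ∧ ∃ b, b < x + 1 ∧ x = pair a b) ∧ y = 0) := by
  by_cases h : ∃ b a, x = pair a b
  · obtain ⟨b, a, rfl⟩ := h
    rw [snd_pair]
    constructor
    · rintro rfl
      exact .inl ⟨a, lt_add_one_iff.2 (left_le_pair _ _), rfl⟩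
    · rintro (⟨c, -, hc⟩ | ⟨hn, -⟩)
      · exact (pair_inj hc).2.symm
      · exact absurd ⟨a, lt_add_one_iff.2 (left_le_pair _ _), b,
          lt_add_one_iff.2 (right_le_pair _ _), rfl⟩ hn
  · rw [snd, dif_neg h]
    refine ⟨fun hy => .inr ⟨fun ⟨a, _, b, _, hab⟩ => h ⟨b, a, hab⟩, hy⟩, ?_⟩
    rintro (⟨c, -, hc⟩ | ⟨-, hy⟩)
    · exact absurd ⟨_, _, hc⟩ h
    · exact hy

theorem fst_le [Fact (BaseSystem M)] (x : M.Num) : fst x ≤ x := by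
  rcases eq_fst_iff.1 (rfl : fst x = fst x) with ⟨b, -, h⟩ | ⟨-, h⟩
  · conv_rhs => rw [h]
    exact left_le_pair _ _
  · rw [h, ← Frac.coe_le, Frac.coe_zero]; exact Frac.coe_nonneg _

theorem snd_le [Fact (BaseSystem M)] (x : M.Num) : snd x ≤ x := by
  rcases eq_snd_iff.1 (rfl : snd x = snd x) with ⟨b, -, h⟩ | ⟨-, h⟩
  · conv_rhs => rw [h]
    exact right_le_pair _ _
  · rw [h, ← Frac.coe_le, Frac.coe_zero]; exact Frac.coe_nonneg _

end Pairs

/-! ### Definability by bounded quantifier formulas -/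

/-- Values of the parameters of a formula: the function variables `0, …, 7` and the number variables
from `20` on. -/
@[ext] structure Par (M : BaseStructure.{u}) where
  fn : Fin 8 → M.Fn
  num : ℕ → M.Num

def Val.par {M : BaseStructure.{u}} (e : Val M) : Par M := ⟨fun i => e.fn i, fun i => e.num (i + 20)⟩

section Val

variable {M : BaseStructure.{u}} (e : Val M)

theorem Val.setNum_par {k : ℕ} (hk : k < 20) (x : M.Num) : (e.setNum k x).par = e.par := by
  ext i
  · rfl
  · simp only [Val.par, Val.setNum]
    rw [Function.update_of_ne (by omega)]

theorem Val.setFn_par {k : ℕ} (hk : 8 ≤ k) (f : M.Fn) : (e.setFn k f).par = e.par := by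
  ext i
  · simp only [Val.par, Val.setFn]
    rw [Function.update_of_ne (by omega)]
  · rfl

theorem Val.setNum_num_self (k : ℕ) (x : M.Num) : (e.setNum k x).num k = x := by
  simp [Val.setNum]

theorem Val.setNum_num_ne {i k : ℕ} (h : i ≠ k) (x : M.Num) : (e.setNum k x).num i = e.num i := by
  simp [Val.setNum, h]

theorem Par.exists_val (p : Par M) : ∃ e : Val M, e.par = p := by
  obtain ⟨a⟩ := M.fn_nonempty
  obtain ⟨A⟩ := M.op_nonempty
  refine ⟨⟨fun i => p.num (i - 20), fun i => if h : i < 8 then p.fn ⟨i, h⟩ else a, fun _ => A⟩, ?_⟩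
  ext i
  · simp [Val.par]
  · simp [Val.par]

end Val

/-- Properties of the values of all variables that are defined by a bounded quantifier formula. -/
def FDef (P : ∀ M : BaseStructure.{u}, Val M → Prop) : Prop :=
  ∃ φ : BForm, ∀ M, BaseSystem M → ∀ e, φ.Sat e ↔ P M e

/-- The term for a pair. -/
def NumTerm.pair (s t : NumTerm) : NumTerm := .add (.mul (.add s t) (.add s t)) s

theorem NumTerm.eval_pair {M : BaseStructure.{u}} (e : Val M) (s t : NumTerm) :
    (NumTerm.pair s t).eval e = WeakAnalysis.pair (s.eval e) (t.eval e) := rfl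

namespace FDef

variable {P Q : ∀ M : BaseStructure.{u}, Val M → Prop}

theorem congr (h : FDef P) (hPQ : ∀ M, Fact (BaseSystem M) → ∀ e, P M e ↔ Q M e) : FDef Q := by
  obtain ⟨φ, hφ⟩ := h
  exact ⟨φ, fun M hM e => (hφ M hM e).trans (hPQ M ⟨hM⟩ e)⟩

theorem not (h : FDef P) : FDef fun M e => ¬ P M e := by
  obtain ⟨φ, hφ⟩ := h
  exact ⟨.neg φ, fun M hM e => not_congr (hφ M hM e)⟩

theorem and (h : FDef P) (k : FDef Q) : FDef fun M e => P M e ∧ Q M e := by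
  obtain ⟨φ, hφ⟩ := h; obtain ⟨ψ, hψ⟩ := k
  exact ⟨.and φ ψ, fun M hM e => and_congr (hφ M hM e) (hψ M hM e)⟩

theorem or (h : FDef P) (k : FDef Q) : FDef fun M e => P M e ∨ Q M e := by
  obtain ⟨φ, hφ⟩ := h; obtain ⟨ψ, hψ⟩ := k
  exact ⟨.or φ ψ, fun M hM e => or_congr (hφ M hM e) (hψ M hM e)⟩

theorem exLt (h : FDef P) (k : ℕ) (T : NumTerm) :
    FDef fun M e => ∃ x, x < T.eval e ∧ P M (e.setNum k x) := by
  obtain ⟨φ, hφ⟩ := h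
  exact ⟨.exLt k T φ, fun M hM e => exists_congr fun x => and_congr_right fun _ => hφ M hM _⟩

theorem eq (s t : NumTerm) : FDef.{u} fun _ e => s.eval e = t.eval e :=
  ⟨.eq s t, fun _ _ _ => Iff.rfl⟩

theorem lt (s t : NumTerm) : FDef.{u} fun _ e => s.eval e < t.eval e :=
  ⟨.lt s t, fun _ _ _ => Iff.rfl⟩

/-- Substitution is expressed by `∃ x < T + 1, x = T ∧ …` instead of being carried out in the
syntax, so no variable can be captured. The hypothesis `hT` keeps `T` from referring to the variable
that is being assigned. -/
theorem letTerm (h : FDef P) (k : ℕ) (T : NumTerm)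
    (hT : ∀ (M : BaseStructure.{u}) (e : Val M) (x), T.eval (e.setNum k x) = T.eval e) :
    FDef fun M e => P M (e.setNum k (T.eval e)) := by
  refine (((eq (.var k) T).and h).exLt k (.add T .one)).congr fun M hM e => ?_
  simp only [NumTerm.eval, Val.setNum_num_self, hT]
  constructor
  · rintro ⟨x, -, rfl, hx⟩; exact hx
  · exact fun h => ⟨_, hM.out.basic.lt_succ _, rfl, h⟩

/-- The variables `18` and `19` are reserved for the quantifiers in the graph of the projection;
this is the reason for the bounds on `j` and `k`. -/
theorem letFst (h : FDef P) {j k : ℕ} (hjk : j ≠ k) (hj : j < 18) (hk : k < 18) :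
    FDef fun M e => P M (e.setNum k (fst (e.num j))) := by
  have h1 := (eq.{u} (.var j) (.pair (.var k) (.var 19))).exLt 19 (.add (.var j) .one)
  have h2 := ((eq.{u} (.var j) (.pair (.var 18) (.var 19))).exLt 19 (.add (.var j) .one)).exLt 18
    (.add (.var j) .one)
  have h3 := eq.{u} (.var k) .zero
  refine (((h1.or (h2.not.and h3)).and h).exLt k (.add (.var j) .one)).congr
    fun M _ e => ?_
  simp only [NumTerm.eval, NumTerm.eval_pair, Val.setNum_num_self, Val.setNum_num_ne _ hjk,
    Val.setNum_num_ne _ (show j ≠ 18 by omega), Val.setNum_num_ne _ (show j ≠ 19 by omega),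
    Val.setNum_num_ne _ (show k ≠ 19 by omega), Val.setNum_num_ne _ (show 18 ≠ 19 by omega),
    ← eq_fst_iff]
  constructor
  · rintro ⟨x, -, rfl, hx⟩; exact hx
  · exact fun h => ⟨_, lt_add_one_iff.2 (fst_le _), rfl, h⟩

theorem letSnd (h : FDef P) {j k : ℕ} (hjk : j ≠ k) (hj : j < 18) (hk : k < 18) :
    FDef fun M e => P M (e.setNum k (snd (e.num j))) := by
  have h1 := (eq.{u} (.var j) (.pair (.var 19) (.var k))).exLt 19 (.add (.var j) .one)
  have h2 := ((eq.{u} (.var j) (.pair (.var 18) (.var 19))).exLt 19 (.add (.var j) .one)).exLt 18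
    (.add (.var j) .one)
  have h3 := eq.{u} (.var k) .zero
  refine (((h1.or (h2.not.and h3)).and h).exLt k (.add (.var j) .one)).congr
    fun M _ e => ?_
  simp only [NumTerm.eval, NumTerm.eval_pair, Val.setNum_num_self, Val.setNum_num_ne _ hjk,
    Val.setNum_num_ne _ (show j ≠ 18 by omega), Val.setNum_num_ne _ (show j ≠ 19 by omega),
    Val.setNum_num_ne _ (show k ≠ 19 by omega), Val.setNum_num_ne _ (show 18 ≠ 19 by omega),
    ← eq_snd_iff]
  constructor
  · rintro ⟨x, -, rfl, hx⟩; exact hx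
  · exact fun h => ⟨_, lt_add_one_iff.2 (snd_le _), rfl, h⟩

end FDef

/-- Definable relations between two numbers. -/
def Def2 (P : ∀ M : BaseStructure.{u}, Par M → M.Num → M.Num → Prop) : Prop :=
  FDef fun M e => P M e.par (e.num 0) (e.num 1)

/-- Definable properties of numbers. -/
class Def (P : ∀ M : BaseStructure.{u}, Par M → M.Num → Prop) : Prop where
  out : FDef fun M e => P M e.par (e.num 0)

/-- Functions that may be substituted into definable relations, and are functions of the model. -/
class UFun (F : ∀ M : BaseStructure.{u}, Par M → M.Num → M.Num) : Prop where
  subst : ∀ P, Def2 P → Def2 fun M p x c => P M p (F M p x) c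
  repr : ∀ M, BaseSystem M → ∀ p, ∃ g : M.Fn, ∀ x, M.app g x = F M p x

section Def2

variable {P Q : ∀ M : BaseStructure.{u}, Par M → M.Num → M.Num → Prop}

theorem Def2.congr (h : Def2 P) (hPQ : ∀ M, Fact (BaseSystem M) → ∀ p x c, P M p x c ↔ Q M p x c) :
    Def2 Q :=
  FDef.congr h fun M hM e => hPQ M hM _ _ _

theorem Def2.letTerms (h : Def2 P) (s t : NumTerm) (a b : ∀ M : BaseStructure.{u}, M.Num → M.Num → M.Num)
    (hs : ∀ M (e : Val M), s.eval e = a M (e.num 0) (e.num 1)) (ht : ∀ M (e : Val M), t.eval e = b M (e.num 0) (e.num 1)) :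
    Def2 fun M p x c => P M p (a M x c) (b M x c) := by
  -- The assignments take effect in the reverse of the order written: `t` and `s` are first stored
  -- in the variables `2` and `3`, and only then moved to `1` and `0`. Both terms are thus evaluated
  -- at the old values.
  have h1 := ((((h.letTerm 0 (.var 3) fun M e x => by simp [NumTerm.eval, Val.setNum_num_ne]).letTerm
    1 (.var 2) fun M e x => by simp [NumTerm.eval, Val.setNum_num_ne]).letTerm 3 s fun M e x => by
      simp [hs, Val.setNum_num_ne]).letTerm 2 t fun M e x => by simp [ht, Val.setNum_num_ne])
  refine h1.congr fun M hM e => ?_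
  simp [NumTerm.eval, Val.setNum_num_ne, Val.setNum_num_self, Val.setNum_par, hs, ht]

theorem Def2.letFst (h : Def2 P) : Def2 fun M p x c => P M p (fst x) c := by
  have h1 := (FDef.letTerm h 0 (.var 2) fun M e x => by simp [NumTerm.eval, Val.setNum_num_ne]).letFst
    (j := 0) (k := 2) (by decide) (by decide) (by decide)
  refine h1.congr fun M hM e => ?_
  simp [NumTerm.eval, Val.setNum_num_ne, Val.setNum_num_self, Val.setNum_par]

theorem Def2.letSnd (h : Def2 P) : Def2 fun M p x c => P M p (snd x) c := by
  have h1 := (FDef.letTerm h 0 (.var 2) fun M e x => by simp [NumTerm.eval, Val.setNum_num_ne]).letSnd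
    (j := 0) (k := 2) (by decide) (by decide) (by decide)
  refine h1.congr fun M hM e => ?_
  simp [NumTerm.eval, Val.setNum_num_ne, Val.setNum_num_self, Val.setNum_par]

/-- Unpacking the second variable. -/
theorem Def2.unpack (a b : ∀ M : BaseStructure.{u}, M.Num → M.Num → M.Num → M.Num)
    (s t : NumTerm) (hs : ∀ M e, s.eval e = a M (e.num 0) (e.num 1) (e.num 2))
    (ht : ∀ M e, t.eval e = b M (e.num 0) (e.num 1) (e.num 2)) (h : Def2 P) :
    Def2 fun M p x c => P M p (a M x (fst c) (snd c)) (b M x (fst c) (snd c)) := by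
  have h1 := ((((((FDef.letTerm h 0 (.var 3) fun M e x => by
    simp [NumTerm.eval, Val.setNum_num_ne]).letTerm
    1 (.var 4) fun M e x => by simp [NumTerm.eval, Val.setNum_num_ne]).letTerm 3 s fun M e x => by
      simp [hs, Val.setNum_num_ne]).letTerm 4 t fun M e x => by
      simp [ht, Val.setNum_num_ne]).letTerm 1 (.var 5) fun M e x => by
      simp [NumTerm.eval, Val.setNum_num_ne]).letSnd
    (j := 1) (k := 2) (by decide) (by decide) (by decide)).letFst
    (j := 1) (k := 5) (by decide) (by decide) (by decide)
  refine h1.congr fun M hM e => ?_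
  simp [NumTerm.eval, Val.setNum_num_ne, Val.setNum_num_self, Val.setNum_par, hs, ht]

end Def2

/-- Comprehension only provides values of searches, so `T` is presented as `μ(y < T + 1 : y = T)`, a
search that always succeeds. The function variables `8` and `9` lie outside the parameters and hold
functions obtained earlier. -/
theorem UFun.repr_of {M : BaseStructure.{u}} {F : M.Num → M.Num}
    (hM : BaseSystem M) (p : Par M) (G H : M.Fn) (T : NumTerm)
    (hT : ∀ e : Val M, e.par = p → e.fn 8 = G → e.fn 9 = H → T.eval e = F (e.num 0)) :
    ∃ g : M.Fn, ∀ x, M.app g x = F x := by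
  obtain ⟨e, rfl⟩ := p.exists_val
  obtain ⟨g, hg⟩ := hM.comprehensionFn 0 1 (.add T .one) (.eq (.var 1) T) ((e.setFn 8 G).setFn 9 H)
  have : Fact (BaseSystem M) := ⟨hM⟩
  refine ⟨g, fun x => ?_⟩
  have hpar : ∀ k (_ : k < 20) x, ∀ e' : Val M, e'.par = e.par → (e'.setNum k x).par = e.par :=
    fun k hk x e' he' => (e'.setNum_par hk x).trans he'
  have hp : ((e.setFn 8 G).setFn 9 H).par = e.par := by
    rw [Val.setFn_par _ (by decide), Val.setFn_par _ (by decide)]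
  have h0 : ∀ y, T.eval ((((e.setFn 8 G).setFn 9 H).setNum 0 x).setNum 1 y) = F x := by
    intro y
    rw [hT]
    · rw [Val.setNum_num_ne _ (by decide), Val.setNum_num_self]
    · exact hpar _ (by decide) _ _ (hpar _ (by decide) _ _ hp)
    · simp [Val.setNum, Val.setFn]
    · simp [Val.setNum, Val.setFn]
  have h1 : T.eval (((e.setFn 8 G).setFn 9 H).setNum 0 x) = F x := by
    rw [hT]
    · rw [Val.setNum_num_self]
    · exact hpar _ (by decide) _ _ hp
    · simp [Val.setNum, Val.setFn]
    · simp [Val.setNum, Val.setFn]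
  have h2 := hg x
  simp only [NumTerm.eval, BForm.Sat, h0, h1, Val.setNum_num_self] at h2
  rcases h2 with ⟨-, h2, -⟩ | ⟨-, h2⟩
  · exact h2
  · exact absurd rfl (h2 _ (hM.basic.lt_succ _))

section UFun

variable {P Q : ∀ M : BaseStructure.{u}, Par M → M.Num → Prop}
  {F G S : ∀ M : BaseStructure.{u}, Par M → M.Num → M.Num}

theorem UFun.comp [hF : UFun F] [hG : UFun G] : UFun fun M p x => F M p (G M p x) where
  subst P h := hG.subst _ (hF.subst P h)
  repr M hM p := by
    obtain ⟨f, hf⟩ := hF.repr M hM p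
    obtain ⟨g, hg⟩ := hG.repr M hM p
    refine repr_of hM p f g (.app (.var 8) (.app (.var 9) (.var 0))) fun e _ h8 h9 => ?_
    simp [NumTerm.eval, FnTerm.eval, h8, h9, hf, hg]

instance UFun.id : UFun.{u} fun _ _ x => x where
  subst P h := h
  repr M hM p := repr_of hM p M.fn_nonempty.some M.fn_nonempty.some (.var 0) fun e _ _ _ => rfl

/-- The second variable of a definable relation serves as a stack. While `F` and `G` are substituted
one after the other into the first variable, the data still needed are kept paired with `c` in the
second. -/
instance UFun.pair [hF : UFun F] [hG : UFun G] : UFun fun M p x => pair (F M p x) (G M p x) where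
  subst P h := by
    have h1 := Def2.unpack (P := P) (fun M b a _ => WeakAnalysis.pair a b) (fun M _ _ c => c)
      (.pair (.var 1) (.var 0)) (.var 2) (fun _ _ => rfl) (fun _ _ => rfl) h
    have h2 := Def2.unpack (fun M _ x _ => x) (fun M a _ c => WeakAnalysis.pair a c)
      (.var 1) (.pair (.var 0) (.var 2)) (fun _ _ => rfl) (fun _ _ => rfl) (hG.subst _ h1)
    have h3 := (hF.subst _ h2).letTerms (.var 0) (.pair (.var 0) (.var 1)) (fun M x _ => x)
      (fun M x c => WeakAnalysis.pair x c) (fun _ _ => rfl) (fun _ _ => rfl)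
    refine h3.congr fun M hM p x c => ?_
    simp
  repr M hM p := by
    obtain ⟨f, hf⟩ := hF.repr M hM p
    obtain ⟨g, hg⟩ := hG.repr M hM p
    refine repr_of hM p f g (.pair (.app (.var 8) (.var 0)) (.app (.var 9) (.var 0)))
      fun e _ h8 h9 => ?_
    simp [NumTerm.eval_pair, NumTerm.eval, FnTerm.eval, h8, h9, hf, hg]

theorem UFun.of_term (T : NumTerm) (hT : ∀ M e, T.eval e = F M e.par (e.num 0)) : UFun F where
  subst P h := by
    have h1 := (FDef.letTerm h 0 (.var 2) fun M e x => by
      simp [NumTerm.eval, Val.setNum_num_ne]).letTerm 2 T fun M e x => by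
        simp [hT, Val.setNum_num_ne, Val.setNum_par]
    refine h1.congr fun M hM e => ?_
    simp [NumTerm.eval, Val.setNum_num_ne, Val.setNum_num_self, Val.setNum_par, hT]
  repr M hM p := repr_of hM p M.fn_nonempty.some M.fn_nonempty.some T fun e he _ _ => by rw [hT, he]

theorem UFun.of_fst_aux : UFun.{u} fun _ _ x => WeakAnalysis.fst x where
  subst P h := h.letFst
  repr M hM p := by
    have : Fact (BaseSystem M) := ⟨hM⟩
    obtain ⟨e, he⟩ := p.exists_val
    have h1 := ((FDef.eq.{u} (.var 2) (.var 1)).letFst (j := 0) (k := 2)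
      (by decide) (by decide) (by decide))
    obtain ⟨φ, hφ⟩ := h1
    obtain ⟨g, hg⟩ := hM.comprehensionFn 0 1 (.add (.var 0) .one) φ e
    refine ⟨g, fun x => ?_⟩
    have h2 := hg x
    simp only [hφ M hM, NumTerm.eval, Val.setNum_num_self] at h2
    simp only [Val.setNum_num_self, Val.setNum_num_ne _ (show 0 ≠ 1 by decide),
      Val.setNum_num_ne _ (show 1 ≠ 2 by decide)] at h2
    rcases h2 with ⟨-, h2, -⟩ | ⟨-, h2⟩
    · exact h2.symm
    · exact absurd rfl (h2 _ (lt_add_one_iff.2 (fst_le x)))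

theorem UFun.of_snd_aux : UFun.{u} fun _ _ x => WeakAnalysis.snd x where
  subst P h := h.letSnd
  repr M hM p := by
    have : Fact (BaseSystem M) := ⟨hM⟩
    obtain ⟨e, he⟩ := p.exists_val
    have h1 := ((FDef.eq.{u} (.var 2) (.var 1)).letSnd (j := 0) (k := 2)
      (by decide) (by decide) (by decide))
    obtain ⟨φ, hφ⟩ := h1
    obtain ⟨g, hg⟩ := hM.comprehensionFn 0 1 (.add (.var 0) .one) φ e
    refine ⟨g, fun x => ?_⟩
    have h2 := hg x
    simp only [hφ M hM, NumTerm.eval, Val.setNum_num_self] at h2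
    simp only [Val.setNum_num_self, Val.setNum_num_ne _ (show 0 ≠ 1 by decide),
      Val.setNum_num_ne _ (show 1 ≠ 2 by decide)] at h2
    rcases h2 with ⟨-, h2, -⟩ | ⟨-, h2⟩
    · exact h2.symm
    · exact absurd rfl (h2 _ (lt_add_one_iff.2 (snd_le x)))

instance UFun.fst [UFun F] : UFun fun M p x => fst (F M p x) :=
  UFun.comp (hF := UFun.of_fst_aux)

instance UFun.snd [UFun F] : UFun fun M p x => snd (F M p x) :=
  UFun.comp (hF := UFun.of_snd_aux)

instance UFun.zero : UFun.{u} fun _ _ _ => 0 := .of_term .zero fun _ _ => rfl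
instance UFun.one : UFun.{u} fun _ _ _ => 1 := .of_term .one fun _ _ => rfl
instance UFun.num (i : ℕ) : UFun.{u} fun _ p _ => p.num i := .of_term (.var (i + 20)) fun _ _ => rfl

theorem UFun.app_aux (i : Fin 8) : UFun.{u} fun M p x => M.app (p.fn i) x :=
  .of_term (.app (.var i) (.var 0)) fun _ _ => rfl

instance UFun.app (i : Fin 8) [UFun F] : UFun fun M p x => M.app (p.fn i) (F M p x) :=
  UFun.comp (hF := UFun.app_aux i)

theorem UFun.binary (t : NumTerm → NumTerm → NumTerm)
    (op : ∀ M : BaseStructure.{u}, M.Num → M.Num → M.Num)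
    (h : ∀ M (e : Val M) a b, (t a b).eval e = op M (a.eval e) (b.eval e)) [hF : UFun F]
    [hG : UFun G] : UFun fun M p x => op M (F M p x) (G M p x) where
  subst P hP := by
    have h1 := ((FDef.letTerm hP 0 (t (.var 3) (.var 2)) fun M e x => by
        simp [h, NumTerm.eval, Val.setNum_num_ne]).letSnd
        (j := 0) (k := 2) (by decide) (by decide) (by decide)).letFst
        (j := 0) (k := 3) (by decide) (by decide) (by decide)
    have h2 : Def2 fun M p x c => P M p (op M (WeakAnalysis.fst x) (WeakAnalysis.snd x)) c := by
      refine h1.congr fun M hM e => ?_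
      simp [h, NumTerm.eval, Val.setNum_num_ne, Val.setNum_num_self, Val.setNum_par]
    refine ((UFun.pair (F := F) (G := G)).subst _ h2).congr fun M hM p x c => ?_
    simp
  repr M hM p := by
    obtain ⟨f, hf⟩ := hF.repr M hM p
    obtain ⟨g, hg⟩ := hG.repr M hM p
    refine repr_of hM p f g (t (.app (.var 8) (.var 0)) (.app (.var 9) (.var 0)))
      fun e _ h8 h9 => ?_
    simp [h, NumTerm.eval, FnTerm.eval, h8, h9, hf, hg]

instance UFun.add [UFun F] [UFun G] : UFun fun M p x => F M p x + G M p x :=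
  .binary .add (fun _ x y => x + y) fun _ _ _ _ => rfl

instance UFun.mul [UFun F] [UFun G] : UFun fun M p x => F M p x * G M p x :=
  .binary .mul (fun _ x y => x * y) fun _ _ _ _ => rfl

instance UFun.powLen [UFun F] [UFun G] : UFun fun M p x => M.powLen (F M p x) (G M p x) :=
  .binary .powLen (fun M x y => M.powLen x y) fun _ _ _ _ => rfl

/-! Definable properties are closed under the usual operations. -/

theorem Def.congr [h : Def P] (hPQ : ∀ M, Fact (BaseSystem M) → ∀ p x, P M p x ↔ Q M p x) :
    Def Q :=
  ⟨h.out.congr fun M hM _ => hPQ M hM _ _⟩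

theorem Def.comp [h : Def P] [hF : UFun F] : Def fun M p x => P M p (F M p x) := by
  have h1 : Def2 fun M p x _ => P M p x := h.out
  exact ⟨hF.subst _ h1⟩

theorem Def.eq_aux : Def.{u} fun _ _ x => fst x = snd x :=
  ⟨(((FDef.eq.{u} (.var 3) (.var 2)).letSnd (j := 0) (k := 2) (by decide) (by decide)
    (by decide)).letFst (j := 0) (k := 3) (by decide) (by decide) (by decide)).congr fun M hM e => by
      simp [NumTerm.eval, Val.setNum_num_ne, Val.setNum_num_self]⟩

theorem Def.lt_aux : Def.{u} fun _ _ x => fst x < snd x :=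
  ⟨(((FDef.lt.{u} (.var 3) (.var 2)).letSnd (j := 0) (k := 2) (by decide) (by decide)
    (by decide)).letFst (j := 0) (k := 3) (by decide) (by decide) (by decide)).congr fun M hM e => by
      simp [NumTerm.eval, Val.setNum_num_ne, Val.setNum_num_self]⟩

instance Def.eq [UFun F] [UFun G] : Def fun M p x => F M p x = G M p x :=
  (Def.comp (h := Def.eq_aux) (F := fun M p x => WeakAnalysis.pair (F M p x) (G M p x))).congr
    fun M hM p x => by simp

instance Def.lt [UFun F] [UFun G] : Def fun M p x => F M p x < G M p x :=
  (Def.comp (h := Def.lt_aux) (F := fun M p x => WeakAnalysis.pair (F M p x) (G M p x))).congr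
    fun M hM p x => by simp

instance Def.not [h : Def P] : Def fun M p x => ¬ P M p x := ⟨h.out.not⟩

instance Def.and [h : Def P] [k : Def Q] : Def fun M p x => P M p x ∧ Q M p x := ⟨h.out.and k.out⟩

instance Def.or [h : Def P] [k : Def Q] : Def fun M p x => P M p x ∨ Q M p x := ⟨h.out.or k.out⟩

instance Def.imp [h : Def P] [k : Def Q] : Def fun M p x => P M p x → Q M p x :=
  ⟨(h.out.not.or k.out).congr fun _ _ _ => imp_iff_not_or.symm⟩

instance Def.le [UFun F] [UFun G] : Def fun M p x => F M p x ≤ G M p x :=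
  Def.or (P := fun M p x => F M p x < G M p x) (Q := fun M p x => F M p x = G M p x)

instance Def.exLt {R : ∀ M : BaseStructure.{u}, Par M → M.Num → M.Num → Prop} [hS : UFun S]
    [h : Def fun M p z => R M p (WeakAnalysis.fst z) (WeakAnalysis.snd z)] :
    Def fun M p x => ∃ y, y < S M p x ∧ R M p x y := by
  have h1 := (h.out.letTerm 0 (.pair (.var 1) (.var 2)) fun M e x => by
    simp [NumTerm.eval, NumTerm.pair, Val.setNum_num_ne]).exLt 2 (.var 0)
  have h2 : Def2 fun M p s x => ∃ y, y < s ∧ R M p x y := by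
    refine h1.congr fun M hM e => ?_
    simp [NumTerm.eval, NumTerm.eval_pair, Val.setNum_num_ne, Val.setNum_num_self, Val.setNum_par]
  exact ⟨(hS.subst _ h2).letTerms (.var 0) (.var 0) (fun _ x _ => x) (fun _ x _ => x)
    (fun _ _ => rfl) (fun _ _ => rfl)⟩

instance Def.allLt {R : ∀ M : BaseStructure.{u}, Par M → M.Num → M.Num → Prop} [hS : UFun S]
    [h : Def fun M p z => R M p (WeakAnalysis.fst z) (WeakAnalysis.snd z)] :
    Def fun M p x => ∀ y, y < S M p x → R M p x y :=
  (Def.congr (P := fun M p x => ¬ ∃ y, y < S M p x ∧ ¬ R M p x y)) fun _ _ _ _ => by simp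

end UFun

/-! ### Induction and the least number principle -/

section Induction

variable {M : BaseStructure.{u}} [hM : Fact (BaseSystem M)]

theorem Def.toDef2 (R : ∀ M : BaseStructure.{u}, Par M → M.Num → M.Num → Prop)
    [h : Def fun M p z => R M p (fst z) (snd z)] : Def2 R := by
  have h1 := (h.out.letTerm 0 (.pair (.var 2) (.var 1)) fun M e x => by
    simp [NumTerm.eval, NumTerm.pair, Val.setNum_num_ne]).letTerm 2 (.var 0) fun M e x => by
      simp [NumTerm.eval, Val.setNum_num_ne]
  refine h1.congr fun M hM e => ?_
  simp [NumTerm.eval, NumTerm.eval_pair, Val.setNum_num_ne, Val.setNum_num_self, Val.setNum_par]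

/-- The extra argument `c` can hold any number of additional parameters through pairing, which is
how the later inductions use it. -/
theorem Def.induction₂ (R : ∀ M : BaseStructure.{u}, Par M → M.Num → M.Num → Prop)
    [h : Def fun M p z => R M p (fst z) (snd z)] (p : Par M) (c : M.Num)
    (h0 : R M p c 0) (hs : ∀ x, R M p c x → R M p c (x + 1)) (x : M.Num) : R M p c x := by
  obtain ⟨φ, hφ⟩ := Def.toDef2 R
  obtain ⟨e, rfl⟩ := p.exists_val
  have key : ∀ x, φ.Sat ((e.setNum 0 c).setNum 1 x) ↔ R M e.par c x := fun x => by
    rw [hφ M hM.out]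
    simp [Val.setNum_par, Val.setNum_num_self, Val.setNum_num_ne]
  have := hM.out.induction φ 1 (e.setNum 0 c)
  simp only [key] at this
  exact this h0 hs x

theorem Def.strong_induction₂ (R : ∀ M : BaseStructure.{u}, Par M → M.Num → M.Num → Prop)
    [h : Def fun M p z => R M p (fst z) (snd z)] (p : Par M) (c : M.Num)
    (hs : ∀ x, (∀ y, y < x → R M p c y) → R M p c x) (x : M.Num) : R M p c x := by
  have h1 : Def fun M p z => R M p (fst (fst z)) (snd z) :=
    (Def.comp (h := h) (F := fun _ _ z => pair (fst (fst z)) (snd z))).congr fun _ _ _ _ => by simp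
  refine Def.induction₂ (fun M p c x => ∀ y, y < x → R M p c y) p c ?_ ?_ (x + 1) x
    (hM.out.basic.lt_succ x)
  · intro y hy
    rw [← Frac.coe_lt, Frac.coe_zero] at hy
    exact absurd hy (not_lt.2 (Frac.coe_nonneg y))
  · intro x hx y hy
    rcases lt_add_one_iff.1 hy with h1 | rfl
    · exact hx y h1
    · exact hs y hx

theorem Def.exists_least₂ (R : ∀ M : BaseStructure.{u}, Par M → M.Num → M.Num → Prop)
    [h : Def fun M p z => R M p (fst z) (snd z)]
    (p : Par M) (c : M.Num) (hP : ∃ x, R M p c x) : ∃ x, R M p c x ∧ ∀ y, y < x → ¬ R M p c y := by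
  by_contra hn
  push Not at hn
  obtain ⟨x, hx⟩ := hP
  refine Def.strong_induction₂ (fun M p c x => ¬ R M p c x) p c (fun x ih hx => ?_) x hx
  obtain ⟨y, hy, hPy⟩ := hn x hx
  exact ih y hy hPy

theorem Def.comp_snd (P : ∀ M : BaseStructure.{u}, Par M → M.Num → Prop) [Def P] :
    Def fun M p z => P M p (WeakAnalysis.snd z) := Def.comp (F := fun _ _ z => WeakAnalysis.snd z)

theorem Def.induction (P : ∀ M : BaseStructure.{u}, Par M → M.Num → Prop) [Def P] (p : Par M)
    (h0 : P M p 0) (hs : ∀ x, P M p x → P M p (x + 1)) (x : M.Num) : P M p x :=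
  have := Def.comp_snd P
  Def.induction₂ (fun M p _ x => P M p x) p 0 h0 hs x

theorem Def.strong_induction (P : ∀ M : BaseStructure.{u}, Par M → M.Num → Prop) [Def P]
    (p : Par M) (hs : ∀ x, (∀ y, y < x → P M p y) → P M p x) (x : M.Num) : P M p x :=
  have := Def.comp_snd P
  Def.strong_induction₂ (fun M p _ x => P M p x) p 0 hs x

theorem IsMu.unique {n : M.Num} {P : M.Num → Prop} {y z : M.Num} (hy : IsMu n P y)
    (hz : IsMu n P z) : y = z := by
  rcases hy with ⟨h1, h2, h3⟩ | ⟨rfl, h3⟩ <;> rcases hz with ⟨k1, k2, k3⟩ | ⟨rfl, k3⟩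
  · rcases hM.out.basic.lt_trichotomy y z with h | h | h
    · exact absurd h2 (k3 _ h)
    · exact h
    · exact absurd k2 (h3 _ h)
  · exact absurd h2 (k3 _ h1)
  · exact absurd k2 (h3 _ k1)
  · rfl

end Induction

open Classical in
/-- The least `x < n` with `P x`, and `n` if there is none. -/
noncomputable def mu {M : BaseStructure.{u}} (n : M.Num) (P : M.Num → Prop) : M.Num :=
  if h : ∃ y, IsMu n P y then h.choose else 0

/-! ### Bounded minimization. -/

section Mu

variable {S : ∀ M : BaseStructure.{u}, Par M → M.Num → M.Num}
  {R : ∀ M : BaseStructure.{u}, Par M → M.Num → M.Num → Prop}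

theorem IsMu.exists {M : BaseStructure.{u}} [hM : Fact (BaseSystem M)] {n : M.Num}
    {P : M.Num → Prop} (h : (∃ x, x < n ∧ P x) → ∃ x, P x ∧ ∀ y, y < x → ¬ P y) :
    ∃ y, IsMu n P y := by
  by_cases hP : ∃ x, x < n ∧ P x
  · obtain ⟨y, hy, hl⟩ := h hP
    obtain ⟨x, hxn, hx⟩ := hP
    refine ⟨y, .inl ⟨?_, hy, hl⟩⟩
    rw [← Frac.coe_lt] at *
    have : (y : Frac M) ≤ x := not_lt.1 fun hxy => hl x (Frac.coe_lt.1 hxy) hx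
    exact this.trans_lt hxn
  · push Not at hP
    exact ⟨n, .inr ⟨rfl, hP⟩⟩

theorem IsMu.exists_of_def (R : ∀ M : BaseStructure.{u}, Par M → M.Num → M.Num → Prop)
    [h : Def fun M p z => R M p (fst z) (snd z)] {M : BaseStructure.{u}}
    [hM : Fact (BaseSystem M)] (p : Par M) (n x : M.Num) : ∃ y, IsMu n (R M p x) y :=
  IsMu.exists fun ⟨y, _, hy⟩ => Def.exists_least₂ R p x ⟨y, hy⟩

theorem mu_spec (R : ∀ M : BaseStructure.{u}, Par M → M.Num → M.Num → Prop)
    [h : Def fun M p z => R M p (fst z) (snd z)] {M : BaseStructure.{u}}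
    [hM : Fact (BaseSystem M)] (p : Par M) (n x : M.Num) : IsMu n (R M p x) (mu n (R M p x)) := by
  have := IsMu.exists_of_def R p n x
  rw [mu, dif_pos this]
  exact this.choose_spec

theorem IsMu.le {M : BaseStructure.{u}} {n y : M.Num} {P : M.Num → Prop} (h : IsMu n P y) :
    y ≤ n := by
  rcases h with ⟨h, -⟩ | ⟨h, -⟩
  · exact .inl h
  · exact .inr h

theorem IsMu.of_exists {M : BaseStructure.{u}} {n y : M.Num} {P : M.Num → Prop} (h : IsMu n P y)
    (hP : ∃ x, x < n ∧ P x) : P y := by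
  rcases h with ⟨-, h, -⟩ | ⟨-, h⟩
  · exact h
  · obtain ⟨x, hx, hPx⟩ := hP; exact absurd hPx (h x hx)

instance Def.isMu {S T : ∀ M : BaseStructure.{u}, Par M → M.Num → M.Num}
    [UFun S] [UFun T] [h : Def fun M p z => R M p (WeakAnalysis.fst z) (WeakAnalysis.snd z)] :
    Def fun M p x => IsMu (S M p x) (fun y => R M p x y) (T M p x) := by
  have h1 : Def fun M p z => R M p z (T M p z) :=
    (Def.comp (h := h) (F := fun M p z => WeakAnalysis.pair z (T M p z))).congr
      fun _ _ _ _ => by simp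
  unfold IsMu
  infer_instance

/-- The result of a search is at most its bound. So a property of the result can be stated as "some
`y < S + 1` is the result and has the property", with a bounded quantifier. -/
instance UFun.mu [hS : UFun S] [h : Def fun M p z => R M p (WeakAnalysis.fst z) (WeakAnalysis.snd z)] :
    UFun fun M p x => mu (S M p x) (fun y => R M p x y) where
  subst P hP := by
    have hR : Def fun M p z => R M p (WeakAnalysis.fst (WeakAnalysis.fst z)) (WeakAnalysis.snd z) :=
      (Def.comp (h := h) (F := fun _ _ z => WeakAnalysis.pair
        (WeakAnalysis.fst (WeakAnalysis.fst z)) (WeakAnalysis.snd z))).congr fun _ _ _ _ => by simp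
    have hP' : Def fun M p z => P M p (WeakAnalysis.fst z) (WeakAnalysis.snd z) := by
      have h1 := ((FDef.letTerm hP 0 (.var 2) fun M e x => by
        simp [NumTerm.eval, Val.setNum_num_ne]).letSnd
        (j := 0) (k := 1) (by decide) (by decide) (by decide)).letFst
        (j := 0) (k := 2) (by decide) (by decide) (by decide)
      refine ⟨h1.congr fun M hM e => ?_⟩
      simp [NumTerm.eval, Val.setNum_num_ne, Val.setNum_num_self, Val.setNum_par]
    have hP2 : Def fun M p z => P M p (WeakAnalysis.snd z) (WeakAnalysis.snd (WeakAnalysis.fst z)) :=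
      (Def.comp (h := hP') (F := fun _ _ z => WeakAnalysis.pair
        (WeakAnalysis.snd z) (WeakAnalysis.snd (WeakAnalysis.fst z)))).congr
        fun _ _ _ _ => by simp
    have hS' : UFun fun M p z => S M p (WeakAnalysis.fst z) :=
      UFun.comp (hF := hS) (G := fun _ _ z => WeakAnalysis.fst z)
    have hS2 : UFun fun M p z => S M p (WeakAnalysis.fst (WeakAnalysis.fst z)) :=
      UFun.comp (hF := hS) (G := fun _ _ z => WeakAnalysis.fst (WeakAnalysis.fst z))
    have hR2 : Def fun M p z => R M p (WeakAnalysis.fst (WeakAnalysis.fst (WeakAnalysis.fst z)))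
        (WeakAnalysis.snd z) :=
      (Def.comp (h := h) (F := fun _ _ z => WeakAnalysis.pair
        (WeakAnalysis.fst (WeakAnalysis.fst (WeakAnalysis.fst z))) (WeakAnalysis.snd z))).congr
        fun _ _ _ _ => by simp
    have h3 := Def.toDef2 (fun M p x c => ∃ y, y < S M p x + 1 ∧
      (IsMu (S M p x) (fun y => R M p x y) y ∧ P M p y c))
    refine h3.congr fun M hM p x c => ?_
    have hmu := mu_spec R p (S M p x) x
    constructor
    · rintro ⟨y, -, hy, hPy⟩
      rwa [hmu.unique hy]
    · intro hPc
      exact ⟨_, lt_add_one_iff.2 hmu.le, hmu, hPc⟩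
  repr M hM p := by
    have : Fact (BaseSystem M) := ⟨hM⟩
    obtain ⟨e, rfl⟩ := p.exists_val
    obtain ⟨s, hs⟩ := hS.repr M hM e.par
    obtain ⟨φ, hφ⟩ := Def.toDef2 R
    obtain ⟨g, hg⟩ := hM.comprehensionFn 0 1 (.app (.var 8) (.var 0)) φ (e.setFn 8 s)
    refine ⟨g, fun x => ?_⟩
    have h2 := hg x
    have hs8 : (((e.setFn 8 s).setNum 0 x).fn 8) = s := by simp [Val.setNum, Val.setFn]
    simp only [hφ M hM, NumTerm.eval, FnTerm.eval, Val.setNum_num_self, hs8, hs,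
      Val.setNum_par _ (show 0 < 20 by decide), Val.setNum_par _ (show 1 < 20 by decide),
      Val.setFn_par _ (show 8 ≤ 8 by decide), Val.setNum_num_ne _ (show 0 ≠ 1 by decide)] at h2
    exact h2.unique (mu_spec R e.par _ _)

end Mu

/-! ### Definable functions of several arguments. -/

section Arity

/-- Definable unary functions, in a form that can be composed by instance search. -/
class UFun₁ (F : ∀ M : BaseStructure.{u}, Par M → M.Num → M.Num) : Prop where
  out : UFun F

class UFun₂ (F : ∀ M : BaseStructure.{u}, Par M → M.Num → M.Num → M.Num) : Prop where
  out : UFun fun M p z => F M p (fst z) (snd z)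

class UFun₃ (F : ∀ M : BaseStructure.{u}, Par M → M.Num → M.Num → M.Num → M.Num) : Prop where
  out : UFun fun M p z => F M p (fst z) (fst (snd z)) (snd (snd z))

variable {A B C : ∀ M : BaseStructure.{u}, Par M → M.Num → M.Num}

theorem UFun.congr [h : UFun A] (hAB : ∀ M, Fact (BaseSystem M) → ∀ p x, A M p x = B M p x) :
    UFun B where
  subst P hP := (h.subst P hP).congr fun M hM p x c => by rw [hAB M hM]
  repr M hM p := by
    obtain ⟨g, hg⟩ := h.repr M hM p
    exact ⟨g, fun x => (hg x).trans (hAB M ⟨hM⟩ p x)⟩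

instance (priority := low) UFun₁.toUFun {F : ∀ M : BaseStructure.{u}, Par M → M.Num → M.Num}
    [h : UFun₁ F] : UFun F := h.out

instance (priority := low) UFun₁.app {F : ∀ M : BaseStructure.{u}, Par M → M.Num → M.Num}
    [h : UFun₁ F] [UFun A] : UFun fun M p x => F M p (A M p x) :=
  UFun.comp (hF := h.out)

instance (priority := low) UFun₂.app {F : ∀ M : BaseStructure.{u}, Par M → M.Num → M.Num → M.Num}
    [h : UFun₂ F] [UFun A] [UFun B] : UFun fun M p x => F M p (A M p x) (B M p x) :=
  (UFun.comp (hF := h.out) (G := fun M p x => pair (A M p x) (B M p x))).congr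
    fun M hM p x => by simp

instance (priority := low) UFun₃.app
    {F : ∀ M : BaseStructure.{u}, Par M → M.Num → M.Num → M.Num → M.Num}
    [h : UFun₃ F] [UFun A] [UFun B] [UFun C] :
    UFun fun M p x => F M p (A M p x) (B M p x) (C M p x) :=
  (UFun.comp (hF := h.out)
    (G := fun M p x => pair (A M p x) (pair (B M p x) (C M p x)))).congr fun M hM p x => by simp

end Arity

/-! ### Powers of two -/

section Pow2

variable {M : BaseStructure.{u}} [hM : Fact (BaseSystem M)]

/-- These are the forms of a nonzero number to which the recursive equations of `powLen` apply, so
that strong induction by halving becomes available. -/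
theorem Num.half (p : Par M) (x : M.Num) :
    x = 0 ∨ ∃ y, y < x ∧ (0 < y ∧ x = (1 + 1) * y ∨ x = (1 + 1) * y + 1) := by
  refine Def.induction (fun M p x => x = 0 ∨ ∃ y, y < x ∧
    (0 < y ∧ x = (1 + 1) * y ∨ x = (1 + 1) * y + 1)) p (.inl rfl) ?_ x
  rintro x (rfl | ⟨y, hy, ⟨hy0, rfl⟩ | rfl⟩)
  · refine .inr ⟨0, hM.out.basic.lt_succ 0, .inr ?_⟩
    rw [← Frac.coe_inj (M := M)]; push_cast; ring
  · refine .inr ⟨y, hM.out.basic.lt_trans _ _ _ hy (hM.out.basic.lt_succ _), .inr rfl⟩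
  · refine .inr ⟨y + 1, ?_, .inl ⟨?_, ?_⟩⟩
    · exact hM.out.basic.add_lt_add _ _ _ hy
    · have := Frac.coe_nonneg y
      rw [← Frac.coe_lt (M := M)]; push_cast; linarith
    · rw [← Frac.coe_inj (M := M)]; push_cast; ring

/-- Some parameters, for formulas without parameters. -/
noncomputable def Par.any (M : BaseStructure.{u}) : Par M := ⟨fun _ => M.fn_nonempty.some, fun _ => 0⟩

theorem powLen_cases (x : M.Num) : x = 0 ∨ ∃ y, y < x ∧
    (x = (1 + 1) * y ∨ x = (1 + 1) * y + 1) ∧ ∀ B, M.powLen B x = B * M.powLen B y := by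
  rcases Num.half (Par.any M) x with h | ⟨y, hy, ⟨hy0, rfl⟩ | rfl⟩
  · exact .inl h
  · exact .inr ⟨y, hy, .inl rfl, fun B => hM.out.basic.powLen_even _ _ hy0⟩
  · exact .inr ⟨y, hy, .inr rfl, fun B => hM.out.basic.powLen_odd _ _⟩

theorem powLen_pos {B : M.Num} (hB : (0 : Frac M) < B) (x : M.Num) :
    (0 : Frac M) < M.powLen B x := by
  have := Def.strong_induction₂ (fun M p B x => 0 < B → 0 < M.powLen B x) (Par.any M) B ?_ x
  · rw [← Frac.coe_lt, ← Frac.coe_lt, Frac.coe_zero] at this; exact this hB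
  · intro x ih hB
    rcases powLen_cases x with rfl | ⟨y, hy, -, h⟩
    · rw [hM.out.basic.powLen_zero]; exact hM.out.basic.zero_lt_one
    · rw [h, ← Frac.coe_lt, Frac.coe_mul, Frac.coe_zero]
      have h1 := ih y hy hB
      rw [← Frac.coe_lt, Frac.coe_zero] at h1 hB
      positivity

/-- This makes the powers of two cofinal, and bounds the witness in `IsPow2` so that being a power
of two is definable. -/
theorem lt_powLen_two (x : M.Num) : (x : Frac M) < M.powLen (1 + 1) x := by
  rw [Frac.coe_lt]
  refine Def.strong_induction (fun M p x => x < M.powLen (1 + 1) x) (Par.any M) ?_ x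
  intro x ih
  rcases powLen_cases x with rfl | ⟨y, hy, hxy, h⟩
  · rw [hM.out.basic.powLen_zero]; exact hM.out.basic.zero_lt_one
  · have h1 := Frac.coe_add_one_le (Frac.coe_lt.2 (ih y hy))
    rw [h, ← Frac.coe_lt]
    rcases hxy with rfl | rfl <;> push_cast <;> linarith

theorem powLen_two_mono {x y : M.Num} (h : x ≤ y) :
    (M.powLen (1 + 1) x : Frac M) ≤ M.powLen (1 + 1) y := by
  rw [Frac.coe_le]
  refine Def.strong_induction (fun M p y => ∀ x, x < y + 1 →
    M.powLen (1 + 1) x ≤ M.powLen (1 + 1) y) (Par.any M) ?_ y x (lt_add_one_iff.2 h)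
  intro y ih x hxy
  rcases powLen_cases y with rfl | ⟨y', hy', hyy, hy⟩
  · rw [lt_add_one_iff, ← Frac.coe_le, Frac.coe_zero] at hxy
    have : x = 0 := Frac.coe_inj.1 (by
      rw [Frac.coe_zero]; exact le_antisymm hxy (Frac.coe_nonneg x))
    rw [this]; exact .inr rfl
  · rcases powLen_cases x with rfl | ⟨x', hx', hxx, hx⟩
    · rw [hM.out.basic.powLen_zero, ← Frac.coe_le, Frac.coe_one]
      exact Frac.one_le_coe (powLen_pos (by push_cast; positivity) _)
    · rw [hx, hy, ← Frac.coe_le, Frac.coe_mul, Frac.coe_mul]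
      refine mul_le_mul_of_nonneg_left ?_ (Frac.coe_nonneg _)
      refine Frac.coe_le.2 (ih y' hy' x' ?_)
      rw [lt_add_one_iff] at *
      rw [← Frac.coe_le] at *
      by_contra hn
      have h1 := Frac.coe_add_one_le (not_le.1 hn)
      rcases hxx with rfl | rfl <;> rcases hyy with rfl | rfl <;> push_cast at * <;> linarith

theorem isPow2_iff {w : M.Num} : IsPow2 w ↔ ∃ x, x < w ∧ w = M.powLen (1 + 1) x := by
  refine ⟨fun ⟨x, hx⟩ => ⟨x, ?_, hx⟩, fun ⟨x, _, hx⟩ => ⟨x, hx⟩⟩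
  rw [hx, ← Frac.coe_lt]; exact lt_powLen_two x

instance Def.isPow2 {A : ∀ M : BaseStructure.{u}, Par M → M.Num → M.Num} [UFun A] :
    Def fun M p x => IsPow2 (A M p x) := by
  have h1 : Def.{u} fun M p x => IsPow2 x :=
    (inferInstance : Def.{u} fun M p w => ∃ x, x < w ∧ w = M.powLen (1 + 1) x).congr
      fun M hM p x => isPow2_iff.symm
  exact Def.comp (h := h1)

theorem isPow2_powLen (x : M.Num) : IsPow2 (M.powLen (1 + 1) x) := ⟨x, rfl⟩

theorem IsPow2.one : IsPow2 (1 : M.Num) := ⟨0, (hM.out.basic.powLen_zero _).symm⟩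

theorem IsPow2.double {w : M.Num} (h : IsPow2 w) : IsPow2 ((1 + 1) * w) := by
  obtain ⟨x, rfl⟩ := h
  exact ⟨(1 + 1) * x + 1, (hM.out.basic.powLen_odd _ _).symm⟩

theorem IsPow2.pos {w : M.Num} (h : IsPow2 w) : (0 : Frac M) < w := by
  obtain ⟨x, rfl⟩ := h
  exact powLen_pos (by push_cast; positivity) _

theorem IsPow2.one_le {w : M.Num} (h : IsPow2 w) : (1 : Frac M) ≤ w := Frac.one_le_coe h.pos

theorem IsPow2.cases {w : M.Num} (h : IsPow2 w) :
    w = 1 ∨ ∃ u, IsPow2 u ∧ u < w ∧ w = (1 + 1) * u := by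
  obtain ⟨x, rfl⟩ := h
  rcases powLen_cases x with rfl | ⟨y, hy, -, h⟩
  · exact .inl (hM.out.basic.powLen_zero _)
  · refine .inr ⟨_, isPow2_powLen y, ?_, h _⟩
    have := (isPow2_powLen y).pos
    rw [h, ← Frac.coe_lt]; push_cast; linarith

/-- A power of two other than `1` has a smaller power of two as its half, so induction on the
exponent is an instance of strong induction on numbers. -/
theorem IsPow2.induction₂ (R : ∀ M : BaseStructure.{u}, Par M → M.Num → M.Num → Prop)
    [h : Def fun M p z => R M p (fst z) (snd z)] (p : Par M) (c : M.Num)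
    (h1 : R M p c 1) (hs : ∀ u, IsPow2 u → R M p c u → R M p c ((1 + 1) * u)) {w : M.Num}
    (hw : IsPow2 w) : R M p c w := by
  refine Def.strong_induction₂ (fun M p c w => IsPow2 w → R M p c w) p c ?_ w hw
  intro w ih hw
  rcases hw.cases with rfl | ⟨u, hu, huw, rfl⟩
  · exact h1
  · exact hs u hu (ih u huw hu)

theorem IsPow2.induction (R : ∀ M : BaseStructure.{u}, Par M → M.Num → Prop)
    [h : Def R] (p : Par M) (h1 : R M p 1)
    (hs : ∀ u, IsPow2 u → R M p u → R M p ((1 + 1) * u)) {w : M.Num} (hw : IsPow2 w) : R M p w :=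
  have := Def.comp_snd R
  IsPow2.induction₂ (fun M p _ x => R M p x) p 0 h1 hs hw

theorem IsPow2.two_mul_le {u v : M.Num} (hu : IsPow2 u) (hv : IsPow2 v) (h : (u : Frac M) < v) :
    (2 : Frac M) * u ≤ v := by
  have := IsPow2.induction (fun M p v => ∀ u, u < v → IsPow2 u → (1 + 1) * u ≤ v) (Par.any M)
    ?_ ?_ hv u (Frac.coe_lt.1 h) hu
  · rw [← Frac.coe_le] at this; push_cast at this; linarith
  · intro u hu1 hu
    have := hu.one_le
    rw [← Frac.coe_lt, Frac.coe_one] at hu1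
    linarith
  · intro v hv ih u huv hu
    rw [← Frac.coe_le]; rw [← Frac.coe_lt] at huv; push_cast at *
    rcases hu.cases with rfl | ⟨u', hu', -, rfl⟩
    · have := hv.one_le; push_cast; linarith
    · push_cast at *
      have := ih u' (Frac.coe_lt.1 (by linarith)) hu'
      rw [← Frac.coe_le] at this; push_cast at this; linarith

theorem IsPow2.exists_mul {u v : M.Num} (hu : IsPow2 u) (hv : IsPow2 v) (h : (u : Frac M) ≤ v) :
    ∃ t, IsPow2 t ∧ v = u * t := by
  have := IsPow2.induction (fun M p v => ∀ u, u < v + 1 → IsPow2 u →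
    ∃ t, t < v + 1 ∧ (IsPow2 t ∧ v = u * t)) (Par.any M)
    ?_ ?_ hv u (lt_add_one_iff.2 (Frac.coe_le.1 h)) hu
  · obtain ⟨t, -, ht⟩ := this; exact ⟨t, ht⟩
  · intro u hu1 hu
    have h1 := hu.one_le
    rw [lt_add_one_iff, ← Frac.coe_le, Frac.coe_one] at hu1
    refine ⟨1, hM.out.basic.lt_succ _, .one, ?_⟩
    rw [← Frac.coe_inj (M := M)]; push_cast; linarith
  · intro v hv ih u huv hu
    rw [lt_add_one_iff, ← Frac.coe_le] at huv
    rcases huv.lt_or_eq with h1 | h1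
    · have h2 := hu.two_mul_le hv.double h1
      push_cast at h2
      obtain ⟨t, htv, ht, hvt⟩ := ih u (lt_add_one_iff.2 (Frac.coe_le.1 (by linarith))) hu
      refine ⟨(1 + 1) * t, ?_, ht.double, ?_⟩
      · rw [lt_add_one_iff, ← Frac.coe_le] at *; push_cast; linarith
      · rw [← Frac.coe_inj (M := M)] at *; push_cast; rw [hvt]; push_cast; ring
    · refine ⟨1, ?_, .one, ?_⟩
      · rw [lt_add_one_iff, ← Frac.coe_le, Frac.coe_one]; exact hv.double.one_le
      · rw [← Frac.coe_inj (M := M)]; push_cast at *; linarith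

theorem IsPow2.mul {u v : M.Num} (hu : IsPow2 u) (hv : IsPow2 v) : IsPow2 (u * v) := by
  refine IsPow2.induction₂ (fun M p u v => IsPow2 (u * v)) (Par.any M) u ?_ ?_ hv
  · rwa [hM.out.basic.mul_one]
  · intro v hv ih
    have : u * ((1 + 1) * v) = (1 + 1) * (u * v) := by
      rw [← Frac.coe_inj (M := M)]; push_cast; ring
    rw [this]; exact ih.double

theorem exists_isPow2_gt (x : Frac M) : ∃ w : M.Num, IsPow2 w ∧ x < w := by
  obtain ⟨n, hn⟩ := Frac.exists_lt_coe x
  exact ⟨_, isPow2_powLen n, hn.trans (lt_powLen_two n)⟩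

theorem exists_floor (c d : M.Num) (hd : (0 : Frac M) < d) :
    ∃ q : M.Num, (d : Frac M) * q ≤ c ∧ (c : Frac M) < d * q + d := by
  have := Def.induction₂ (fun M p d c => 0 < d → ∃ q, q < c + 1 ∧ (d * q ≤ c ∧ c < d * q + d))
    (Par.any M) d ?_ ?_ c (Frac.coe_lt.1 (by rwa [Frac.coe_zero]))
  · obtain ⟨q, -, h1, h2⟩ := this
    exact ⟨q, by exact_mod_cast Frac.coe_le.2 h1, by exact_mod_cast Frac.coe_lt.2 h2⟩
  · intro hd
    refine ⟨0, hM.out.basic.lt_succ _, ?_, ?_⟩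
    · rw [← Frac.coe_le]; push_cast; linarith
    · rw [← Frac.coe_lt] at *; push_cast at *; linarith
  · intro c ih hd
    obtain ⟨q, hq, h1, h2⟩ := ih hd
    rw [← Frac.coe_le] at h1; rw [← Frac.coe_lt] at h2 hq; push_cast at h1 h2 hq
    have h3 : (c : Frac M) + 1 ≤ d * q + d := by
      have := Frac.coe_add_one_le (x := c) (y := d * q + d) (by push_cast; exact h2)
      push_cast at this; exact this
    rcases h3.lt_or_eq with h4 | h4
    · refine ⟨q, ?_, ?_, ?_⟩
      · rw [← Frac.coe_lt]; push_cast; linarith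
      · rw [← Frac.coe_le]; push_cast; linarith
      · rw [← Frac.coe_lt]; push_cast; linarith
    · refine ⟨q + 1, ?_, ?_, ?_⟩
      · rw [← Frac.coe_lt]; push_cast; linarith
      · rw [← Frac.coe_le]; push_cast; linarith
      · rw [← Frac.coe_lt] at *; push_cast at *; linarith

end Pow2

/-! ### Recursion along the powers of two -/

section Digits

variable {M : BaseStructure.{u}}

/-- `y` is the digit of `c` in base `B` at the place that belongs to the power of two `v`. -/
def Digit (B c v y : M.Num) : Prop :=
  -- For `v = 2 ^ k` one has `len v = k + 1`, so the digit meant is the coefficient of `B ^ (k +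
  -- 1)`; the lowest place stays unused. Here `r` is the part of `c` below this digit and `q` the
  -- part above it.
  y < B ∧ ∃ q, q < c + 1 ∧ ∃ r, r < M.powLen B v ∧ c = r + M.powLen B v * (y + B * q)

instance Def.digit {B c v y : ∀ M : BaseStructure.{u}, Par M → M.Num → M.Num}
    [UFun B] [UFun c] [UFun v] [UFun y] :
    Def fun M p x => Digit (B M p x) (c M p x) (v M p x) (y M p x) := by
  have h : Def.{u} fun M p z => Digit (fst (fst z)) (snd (fst z)) (fst (snd z)) (snd (snd z)) := by
    unfold Digit; infer_instance
  exact (Def.comp (h := h) (F := fun M p x => pair (pair (B M p x) (c M p x))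
    (pair (v M p x) (y M p x)))).congr fun M hM p x => by simp

/-- `c` codes, in base `B`, the values up to `w` of the function with the value `s` at `1` and with
`h (2 v) = g v (h v)` for powers of two `v`. -/
def RecSeq (g : M.Num → M.Num → M.Num) (s B w c : M.Num) : Prop :=
  Digit B c 1 s ∧ ∀ v, v < w → IsPow2 v → ∃ y, y < B ∧
    (Digit B c v y ∧ Digit B c ((1 + 1) * v) (g v y))

variable [hM : Fact (BaseSystem M)]

theorem divMod_unique {P k k' r r' : M.Num} (hr : (r : Frac M) < P) (hr' : (r' : Frac M) < P)
    (h : (r : Frac M) + P * k = r' + P * k') : k = k' := by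
  have h0 := Frac.coe_nonneg r; have h0' := Frac.coe_nonneg r'
  have key : ∀ {k k' r r' : M.Num}, (r : Frac M) < P → (0 : Frac M) ≤ r' →
      (r : Frac M) + P * k = r' + P * k' → (k' : Frac M) ≤ k := by
    intro k k' r r' hr hr' h
    by_contra hn
    have h1 := Frac.coe_add_one_le (not_le.1 hn)
    have hP : (0 : Frac M) < P := (Frac.coe_nonneg r).trans_lt hr
    nlinarith
  exact Frac.coe_inj.1 (le_antisymm (key hr' h0 h.symm) (key hr h0' h))

theorem Digit.unique {B c v y y' : M.Num} (h : Digit B c v y) (h' : Digit B c v y') : y = y' := by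
  obtain ⟨hy, q, -, r, hr, hc⟩ := h
  obtain ⟨hy', q', -, r', hr', hc'⟩ := h'
  have h1 : y + B * q = y' + B * q' := by
    refine divMod_unique (Frac.coe_lt.2 hr) (Frac.coe_lt.2 hr') ?_
    exact_mod_cast congrArg (Frac.of (M := M)) (hc.symm.trans hc')
  have h2 : q = q' := by
    refine divMod_unique (Frac.coe_lt.2 hy) (Frac.coe_lt.2 hy') ?_
    exact_mod_cast congrArg (Frac.of (M := M)) h1
  rw [← Frac.coe_inj (M := M)] at *
  push_cast at h1
  rw [h2] at h1
  linarith

theorem Digit.intro {B c v y : M.Num} (q r : M.Num) (hy : (y : Frac M) < B)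
    (hr : (r : Frac M) < M.powLen B v)
    (hc : (c : Frac M) = r + M.powLen B v * (y + B * q)) : Digit B c v y := by
  refine ⟨Frac.coe_lt.1 hy, q, ?_, r, Frac.coe_lt.1 hr, ?_⟩
  · rw [lt_add_one_iff, ← Frac.coe_le, hc]
    have h0 := Frac.coe_nonneg y; have h1 := Frac.coe_nonneg q; have h2 := Frac.coe_nonneg r
    have hB : (1 : Frac M) ≤ B := Frac.one_le_coe (h0.trans_lt hy)
    have hP : (1 : Frac M) ≤ M.powLen B v := Frac.one_le_coe (h2.trans_lt hr)
    have h3 : (q : Frac M) ≤ B * q := le_mul_of_one_le_left h1 hB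
    have h4 : (B * q : Frac M) ≤ M.powLen B v * (B * q) :=
      le_mul_of_one_le_left (h1.trans h3) hP
    have h5 : 0 ≤ (M.powLen B v : Frac M) * y := mul_nonneg (zero_le_one.trans hP) h0
    nlinarith
  · rw [← Frac.coe_inj (M := M), hc]; push_cast; ring

theorem powLen_double (B : M.Num) {v : M.Num} (hv : IsPow2 v) :
    M.powLen B ((1 + 1) * v) = B * M.powLen B v :=
  hM.out.basic.powLen_even _ _ (Frac.coe_lt.1 (by rw [Frac.coe_zero]; exact hv.pos))

theorem powLen_one (B : M.Num) : M.powLen B 1 = B := by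
  have h := hM.out.basic.powLen_odd B 0
  rwa [hM.out.basic.mul_zero, hM.out.basic.zero_add, hM.out.basic.powLen_zero,
    hM.out.basic.mul_one] at h

theorem exists_powLen_eq_mul (B : M.Num) {v w : M.Num} (hv : IsPow2 v) (hw : IsPow2 w)
    (h : (v : Frac M) ≤ w) : ∃ t, M.powLen B w = M.powLen B v * t := by
  obtain ⟨t, ht, rfl⟩ := hv.exists_mul hw h
  -- The base is quantified below a number parameter, since the induction already uses its argument
  -- `c` for `v`. The bound on `s` keeps the formula bounded.
  have := IsPow2.induction₂ (fun M p v t => ∀ B, B < p.num 0 + 1 → ∃ s, s < M.powLen B t + 1 ∧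
    M.powLen B (v * t) = M.powLen B v * s) ⟨(Par.any M).fn, fun _ => B⟩ v ?_ ?_ ht B
    (hM.out.basic.lt_succ _)
  · obtain ⟨s, -, hs⟩ := this; exact ⟨s, hs⟩
  · intro B _
    -- For `B = 0` the quotient `1` would exceed the bound `powLen B 1 = 0`; the quotient `0` works
    -- because both powers vanish.
    by_cases hB : B = 0
    · refine ⟨0, ?_, ?_⟩
      · exact lt_add_one_iff.2 (hM.out.basic.zero_le _)
      · rw [hM.out.basic.mul_one, hM.out.basic.mul_zero]
        rcases hv.cases with rfl | ⟨u, hu, -, rfl⟩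
        · rw [powLen_one, hB]
        · rw [powLen_double _ hu, hB, hM.out.basic.mul_comm, hM.out.basic.mul_zero]
    · refine ⟨1, ?_, by rw [hM.out.basic.mul_one, hM.out.basic.mul_one]⟩
      rw [powLen_one, lt_add_one_iff, ← Frac.coe_le, Frac.coe_one]
      refine Frac.one_le_coe ((Frac.coe_nonneg B).lt_of_ne fun h => hB ?_)
      rw [← Frac.coe_zero, Frac.coe_inj] at h; exact h.symm
  · intro t ht ih B hB
    obtain ⟨s, hs, h1⟩ := ih B hB
    refine ⟨B * s, ?_, ?_⟩
    · rw [lt_add_one_iff, powLen_double _ ht, ← Frac.coe_le]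
      rw [lt_add_one_iff, ← Frac.coe_le] at hs
      push_cast
      exact mul_le_mul_of_nonneg_left hs (Frac.coe_nonneg _)
    · have h2 : v * ((1 + 1) * t) = (1 + 1) * (v * t) := by
        rw [← Frac.coe_inj (M := M)]; push_cast; ring
      rw [h2, powLen_double _ (hv.mul ht), h1]
      rw [← Frac.coe_inj (M := M)]; push_cast; ring

/-- `B ^ len w` is a multiple of `B ^ len (2 v)`, so the added term changes only the part above the
digit at `v`. -/
theorem Digit.extend {B c v y w : M.Num} (h : Digit B c v y) (hv : IsPow2 v) (hw : IsPow2 w)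
    (hvw : (v : Frac M) < w) (z : M.Num) : Digit B (c + M.powLen B w * z) v y := by
  obtain ⟨hy, q, -, r, hr, hc⟩ := h
  have h2 := hv.two_mul_le hw hvw
  obtain ⟨t, ht⟩ := exists_powLen_eq_mul B hv.double hw (by push_cast; linarith)
  refine Digit.intro (q + t * z) r (Frac.coe_lt.2 hy) (Frac.coe_lt.2 hr) ?_
  rw [ht, powLen_double _ hv]
  rw [← Frac.coe_inj (M := M)] at hc
  push_cast at *
  rw [hc]; ring

/-- The recursion determines the coded values, whatever the base. Different bases must be compared
because `recFun` uses the base `b w + 1`, which changes with `w`. -/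
theorem RecSeq.digit_eq {g : M.Num → M.Num → M.Num} {s B B' w w' c c' v y : M.Num}
    (h : RecSeq g s B w c) (h' : RecSeq g s B' w' c') (hv : IsPow2 v) (hw : (v : Frac M) ≤ w)
    (hw' : (v : Frac M) ≤ w') (hy : Digit B c v y) : Digit B' c' v y := by
  have := IsPow2.induction₂ (fun M p d v => v ≤ fst (fst d) → v ≤ snd (fst d) →
    ∀ y, y < fst (fst (snd d)) → Digit (fst (fst (snd d))) (snd (fst (snd d))) v y →
      Digit (fst (snd (snd d))) (snd (snd (snd d))) v y) (Par.any M)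
    (pair (pair w w') (pair (pair B c) (pair B' c'))) ?_ ?_ hv
  · simp only [fst_pair, snd_pair] at this
    exact this (Frac.coe_le.1 hw) (Frac.coe_le.1 hw') y hy.1 hy
  · simp only [fst_pair, snd_pair]
    intro _ _ y _ hy
    rw [hy.unique h.1]; exact h'.1
  · simp only [fst_pair, snd_pair]
    intro u hu ih huw huw' y hyB hy
    rw [← Frac.coe_le] at huw huw'
    push_cast at huw huw'
    have hp := hu.pos
    obtain ⟨z, hzB, hz, hz'⟩ := h.2 u (Frac.coe_lt.1 (by linarith)) hu
    obtain ⟨z₁, hzB₁, hz₁, hz₁'⟩ := h'.2 u (Frac.coe_lt.1 (by linarith)) hu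
    have h1 := ih (Frac.coe_le.1 (by linarith)) (Frac.coe_le.1 (by linarith)) z hzB hz
    rw [hz₁.unique h1] at hz₁'
    rw [hy.unique hz']; exact hz₁'

end Digits

/-! ### Existence and recursive equations of functions defined by recursion of logarithmic length.
-/

section RecFun

/-- The function `h` with `h x 1 = S x` and `h x (2 u) = G x u (h x u)` for powers of two `u`, if
`h x` is bounded by `b x`. -/
noncomputable def recFun
    (G : ∀ M : BaseStructure.{u}, Par M → M.Num → M.Num → M.Num → M.Num)
    (S : ∀ M : BaseStructure.{u}, Par M → M.Num → M.Num)
    (b : ∀ M : BaseStructure.{u}, Par M → M.Num → M.Num → M.Num)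
    (M : BaseStructure.{u}) (p : Par M) (x w : M.Num) : M.Num :=
  mu (b M p x w + 1) fun y => ∃ c, c < M.powLen (b M p x w + 1) w * (b M p x w + 1) ∧
    (RecSeq (G M p x) (S M p x) (b M p x w + 1) w c ∧ Digit (b M p x w + 1) c w y)

variable {G : ∀ M : BaseStructure.{u}, Par M → M.Num → M.Num → M.Num → M.Num}
  {S : ∀ M : BaseStructure.{u}, Par M → M.Num → M.Num}
  {b : ∀ M : BaseStructure.{u}, Par M → M.Num → M.Num → M.Num}
  [hG : UFun₃ G] [hS : UFun₁ S] [hb : UFun₂ b]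

instance : UFun₂ (recFun G S b) := ⟨by unfold recFun RecSeq; infer_instance⟩

variable {M : BaseStructure.{u}} [hM : Fact (BaseSystem M)] {p : Par M} {x : M.Num}

/-- The base is fixed by the final stage `W`; monotonicity of the bound makes it large enough for
all earlier stages. Each step writes the next value as a new leading digit, which leaves the lower
digits unchanged. -/
theorem exists_recSeq
    (hmono : ∀ u v, IsPow2 u → IsPow2 v → (u : Frac M) ≤ v → (b M p x u : Frac M) ≤ b M p x v)
    (h1 : S M p x ≤ b M p x 1)
    (hstep : ∀ u y, IsPow2 u → y ≤ b M p x u → G M p x u y ≤ b M p x ((1 + 1) * u))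
    {w W : M.Num} (hw : IsPow2 w) (hW : IsPow2 W) (hwW : w ≤ W) :
    ∃ c, c < M.powLen (b M p x W + 1) w * (b M p x W + 1) ∧
      (RecSeq (G M p x) (S M p x) (b M p x W + 1) w c ∧
        ∃ y, y < b M p x W + 1 ∧ (Digit (b M p x W + 1) c w y ∧ y ≤ b M p x w)) := by
  have := IsPow2.induction₂ (fun M p d w => w ≤ snd d →
    ∃ c, c < M.powLen (b M p (fst d) (snd d) + 1) w * (b M p (fst d) (snd d) + 1) ∧
      (RecSeq (G M p (fst d)) (S M p (fst d)) (b M p (fst d) (snd d) + 1) w c ∧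
        ∃ y, y < b M p (fst d) (snd d) + 1 ∧
          (Digit (b M p (fst d) (snd d) + 1) c w y ∧ y ≤ b M p (fst d) w)))
    (h := by unfold RecSeq; infer_instance) p (pair x W) ?_ ?_ hw
  · simp only [fst_pair, snd_pair] at this
    exact this hwW
  · simp only [fst_pair, snd_pair]
    intro h1W
    set B := b M p x W + 1 with hB
    have hSB : (S M p x : Frac M) < B := by
      rw [hB]; push_cast
      rw [← Frac.coe_le] at h1W h1
      have := hmono 1 W .one hW h1W
      linarith
    have hBpos : (0 : Frac M) < B := (Frac.coe_nonneg _).trans_lt hSB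
    have hd : Digit B (M.powLen B 1 * S M p x) 1 (S M p x) := by
      refine Digit.intro 0 0 hSB ?_ ?_
      · rw [powLen_one, Frac.coe_zero]; exact hBpos
      · push_cast; ring
    refine ⟨M.powLen B 1 * S M p x, ?_, ⟨hd, ?_⟩, S M p x, Frac.coe_lt.1 hSB, hd, h1⟩
    · rw [powLen_one, ← Frac.coe_lt]; push_cast
      exact mul_lt_mul_of_pos_left hSB hBpos
    · intro v hv1 hv
      rw [← Frac.coe_lt, Frac.coe_one] at hv1
      exact absurd hv.one_le (not_le.2 hv1)
  · simp only [fst_pair, snd_pair]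
    intro u hu ih huW
    set B := b M p x W + 1 with hB
    have hu0 := hu.pos
    rw [← Frac.coe_le] at huW
    have huW' := huW
    push_cast at huW'
    obtain ⟨c, hc, ⟨hseq1, hseq2⟩, y, hyB, hy, hyb⟩ := ih (Frac.coe_le.1 (by linarith))
    have hyn := hstep u y hu hyb
    have hnB : (G M p x u y : Frac M) < B := by
      rw [hB]; push_cast
      rw [← Frac.coe_le] at hyn
      have := hmono _ W hu.double hW huW
      linarith
    have hnd : Digit B (c + M.powLen B ((1 + 1) * u) * G M p x u y) ((1 + 1) * u)
        (G M p x u y) := by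
      refine Digit.intro 0 c hnB ?_ ?_
      · rw [powLen_double _ hu]
        rw [← Frac.coe_lt] at hc; push_cast at *; linarith
      · push_cast; ring
    have hlt : ∀ v : M.Num, IsPow2 v → (v : Frac M) ≤ u → (v : Frac M) < ((1 + 1) * u : M.Num) := by
      intro v hv hvu; push_cast; linarith
    refine ⟨c + M.powLen B ((1 + 1) * u) * G M p x u y, ?_, ⟨?_, ?_⟩, G M p x u y,
      Frac.coe_lt.1 hnB, hnd, hyn⟩
    · rw [← Frac.coe_lt] at *
      have h3 := Frac.coe_add_one_le hnB
      rw [powLen_double _ hu] at *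
      push_cast at *
      have h4 : (0 : Frac M) ≤ B * M.powLen B u := mul_nonneg (Frac.coe_nonneg _) (Frac.coe_nonneg _)
      nlinarith
    · exact hseq1.extend .one hu.double (hlt 1 .one (by rw [Frac.coe_one]; exact hu.one_le)) _
    · intro v hv2 hv
      have hvu : (v : Frac M) ≤ u := by
        by_contra hn
        have := hu.two_mul_le hv (not_le.1 hn)
        rw [← Frac.coe_lt] at hv2; push_cast at hv2; linarith
      rcases hvu.lt_or_eq with h3 | h3
      · obtain ⟨z, hzB, hz, hz'⟩ := hseq2 v (Frac.coe_lt.1 h3) hv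
        refine ⟨z, hzB, hz.extend hv hu.double (hlt v hv hvu) _, hz'.extend hv.double hu.double ?_ _⟩
        push_cast; linarith
      · rw [Frac.coe_inj] at h3
        subst h3
        exact ⟨y, hyB, hy.extend hv hv.double (hlt v hv hvu) _, hnd⟩

theorem recFun_spec
    (hmono : ∀ u v, IsPow2 u → IsPow2 v → (u : Frac M) ≤ v → (b M p x u : Frac M) ≤ b M p x v)
    (h1 : S M p x ≤ b M p x 1)
    (hstep : ∀ u y, IsPow2 u → y ≤ b M p x u → G M p x u y ≤ b M p x ((1 + 1) * u))
    {w : M.Num} (hw : IsPow2 w) :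
    ∃ c, RecSeq (G M p x) (S M p x) (b M p x w + 1) w c ∧
      Digit (b M p x w + 1) c w (recFun G S b M p x w) := by
  obtain ⟨c, hc, hseq, y, hy, hyd, -⟩ := exists_recSeq hmono h1 hstep hw hw (.inr rfl)
  have h2 := mu_spec (fun M p z y => ∃ c, c < M.powLen (b M p (fst z) (snd z) + 1) (snd z) *
      (b M p (fst z) (snd z) + 1) ∧
    (RecSeq (G M p (fst z)) (S M p (fst z)) (b M p (fst z) (snd z) + 1) (snd z) c ∧
      Digit (b M p (fst z) (snd z) + 1) c (snd z) y))
    (h := by unfold RecSeq; infer_instance) p (b M p x w + 1) (pair x w)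
  simp only [fst_pair, snd_pair] at h2
  obtain ⟨c', -, h3, h4⟩ := h2.of_exists ⟨y, hy, c, hc, hseq, hyd⟩
  exact ⟨c', h3, h4⟩

theorem recFun_one
    (hmono : ∀ u v, IsPow2 u → IsPow2 v → (u : Frac M) ≤ v → (b M p x u : Frac M) ≤ b M p x v)
    (h1 : S M p x ≤ b M p x 1)
    (hstep : ∀ u y, IsPow2 u → y ≤ b M p x u → G M p x u y ≤ b M p x ((1 + 1) * u)) :
    recFun G S b M p x 1 = S M p x := by
  obtain ⟨c, hc, hd⟩ := recFun_spec hmono h1 hstep .one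
  exact hd.unique hc.1

theorem recFun_double
    (hmono : ∀ u v, IsPow2 u → IsPow2 v → (u : Frac M) ≤ v → (b M p x u : Frac M) ≤ b M p x v)
    (h1 : S M p x ≤ b M p x 1)
    (hstep : ∀ u y, IsPow2 u → y ≤ b M p x u → G M p x u y ≤ b M p x ((1 + 1) * u))
    {w : M.Num} (hw : IsPow2 w) :
    recFun G S b M p x ((1 + 1) * w) = G M p x w (recFun G S b M p x w) := by
  obtain ⟨c, hc, hd⟩ := recFun_spec hmono h1 hstep hw
  obtain ⟨c', hc', hd'⟩ := recFun_spec hmono h1 hstep hw.double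
  have hw0 := hw.pos
  have hlt : (w : Frac M) < ((1 + 1) * w : M.Num) := by push_cast; linarith
  have h2 := hc.digit_eq hc' hw le_rfl hlt.le hd
  obtain ⟨y, -, hy, hy'⟩ := hc'.2 w (Frac.coe_lt.1 hlt) hw
  rw [hd'.unique hy', hy.unique h2]

end RecFun

/-! ### Rational numbers and approximations -/

section Approx

variable {M : BaseStructure.{u}} [hM : Fact (BaseSystem M)]

/-- The value of a rational number in the field. -/
noncomputable def QNum.val (a : QNum M) : Frac M := ((a.pos : Frac M) - a.neg) / a.den

theorem QNum.lt_iff {a b : QNum M} (ha : (0 : Frac M) < a.den) (hb : (0 : Frac M) < b.den) :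
    a.Lt b ↔ a.val < b.val := by
  rw [QNum.val, QNum.val, div_lt_div_iff₀ ha hb, QNum.Lt, ← Frac.coe_lt]
  push_cast
  constructor <;> intro h <;> linarith

theorem QNum.den_add (a b : QNum M) : ((a.add b).den : Frac M) = a.den * b.den := by
  simp [QNum.add]

theorem QNum.den_sub (a b : QNum M) : ((a.sub b).den : Frac M) = a.den * b.den := by
  simp [QNum.sub, QNum.add]

theorem QNum.val_add {a b : QNum M} (ha : (0 : Frac M) < a.den) (hb : (0 : Frac M) < b.den) :
    (a.add b).val = a.val + b.val := by
  simp only [QNum.val, QNum.add, Frac.coe_add, Frac.coe_mul]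
  field_simp
  ring

theorem QNum.val_sub {a b : QNum M} (ha : (0 : Frac M) < a.den) (hb : (0 : Frac M) < b.den) :
    (a.sub b).val = a.val - b.val := by
  simp only [QNum.val, QNum.sub, QNum.add, Frac.coe_add, Frac.coe_mul]
  field_simp
  ring

@[simp]
theorem QNum.val_frac (p q : M.Num) : (QNum.frac p q).val = (p : Frac M) / q := by
  simp [QNum.val, QNum.frac]

@[simp]
theorem QNum.den_frac (p q : M.Num) : (QNum.frac p q).den = q := rfl

theorem QNum.distLt_iff {a b r : QNum M} (ha : (0 : Frac M) < a.den) (hb : (0 : Frac M) < b.den)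
    (hr : (0 : Frac M) < r.den) : QNum.DistLt a b r ↔ |a.val - b.val| < r.val := by
  rw [QNum.DistLt, QNum.lt_iff (by rw [den_sub]; positivity) hr,
    QNum.lt_iff (by rw [den_sub]; positivity) hr, QNum.val_sub ha hb, QNum.val_sub hb ha, abs_lt]
  constructor <;> rintro ⟨h1, h2⟩ <;> constructor <;> linarith

/-- `L w` is the lower approximation with error `2 / w` of the real `X`. -/
structure Approx.Conv (X : Approx M) (L : M.Num → Frac M) : Prop where
  ex : ∀ w, IsPow2 w → ∃ a, X w a
  val : ∀ w a, IsPow2 w → X w a → (0 : Frac M) < a.den ∧ a.val = L w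
  mono : ∀ u w, IsPow2 u → IsPow2 w → (u : Frac M) ≤ w → L u ≤ L w ∧ L w + 2 / w ≤ L u + 2 / u

namespace Approx.Conv

variable {X Y : Approx M} {L K : M.Num → Frac M} (hX : X.Conv L) (hY : Y.Conv K)

include hX in
theorem cross {u w : M.Num} (hu : IsPow2 u) (hw : IsPow2 w) : L u ≤ L w + 2 / w := by
  have h1 : (0 : Frac M) < 2 / w := div_pos two_pos hw.pos
  have h2 : (0 : Frac M) < 2 / u := div_pos two_pos hu.pos
  rcases le_total (u : Frac M) w with h | h
  · have := (hX.mono u w hu hw h).1; linarith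
  · have := (hX.mono w u hw hu h).2; linarith

include hX hY in
theorem lt_iff : X.Lt Y ↔ ∃ w, IsPow2 w ∧ L w + 2 / w < K w := by
  constructor
  · rintro ⟨w, a, b, hw, ha, hb, h⟩
    obtain ⟨ha1, ha2⟩ := hX.val w a hw ha
    obtain ⟨hb1, hb2⟩ := hY.val w b hw hb
    have hf : (0 : Frac M) < (QNum.frac (1 + 1) w).den := hw.pos
    rw [QNum.lt_iff (by rw [QNum.den_add]; positivity) hb1, QNum.val_add ha1 hf, ha2, hb2,
      QNum.val_frac] at h
    refine ⟨w, hw, ?_⟩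
    push_cast at h
    rwa [one_add_one_eq_two] at h
  · rintro ⟨w, hw, h⟩
    obtain ⟨a, ha⟩ := hX.ex w hw
    obtain ⟨b, hb⟩ := hY.ex w hw
    obtain ⟨ha1, ha2⟩ := hX.val w a hw ha
    obtain ⟨hb1, hb2⟩ := hY.val w b hw hb
    have hf : (0 : Frac M) < (QNum.frac (1 + 1) w).den := hw.pos
    refine ⟨w, a, b, hw, ha, hb, ?_⟩
    rw [QNum.lt_iff (by rw [QNum.den_add]; positivity) hb1, QNum.val_add ha1 hf, ha2, hb2,
      QNum.val_frac]
    push_cast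
    rwa [one_add_one_eq_two]

include hX hY in
theorem le_iff : X.Le Y ↔ ∀ w, IsPow2 w → L w ≤ K w + 2 / w := by
  rw [Approx.Le, hY.lt_iff hX]
  push Not
  rfl

include hX hY in
theorem distLt_iff {r : QNum M} (hr : (0 : Frac M) < r.den) :
    X.DistLt Y r ↔ ∃ w, IsPow2 w ∧ |L w - K w| + 2 / w < r.val := by
  have key : ∀ w a b, IsPow2 w → X w a → Y w b →
      ((((a.sub b).add (QNum.frac (1 + 1) w)).Lt r ∧ ((b.sub a).add (QNum.frac (1 + 1) w)).Lt r) ↔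
        |L w - K w| + 2 / w < r.val) := by
    intro w a b hw ha hb
    obtain ⟨ha1, ha2⟩ := hX.val w a hw ha
    obtain ⟨hb1, hb2⟩ := hY.val w b hw hb
    have hf : (0 : Frac M) < (QNum.frac (1 + 1) w).den := hw.pos
    have h1 : (0 : Frac M) < (a.sub b).den := by rw [QNum.den_sub]; positivity
    have h2 : (0 : Frac M) < (b.sub a).den := by rw [QNum.den_sub]; positivity
    rw [QNum.lt_iff (by rw [QNum.den_add]; positivity) hr,
      QNum.lt_iff (by rw [QNum.den_add]; positivity) hr, QNum.val_add h1 hf, QNum.val_add h2 hf,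
      QNum.val_sub ha1 hb1, QNum.val_sub hb1 ha1, ha2, hb2, QNum.val_frac]
    push_cast
    rw [one_add_one_eq_two, ← lt_sub_iff_add_lt, ← lt_sub_iff_add_lt, ← lt_sub_iff_add_lt, abs_lt]
    constructor <;> rintro ⟨h1, h2⟩ <;> constructor <;> linarith
  constructor
  · rintro ⟨w, a, b, hw, ha, hb, h⟩
    exact ⟨w, hw, (key w a b hw ha hb).1 h⟩
  · rintro ⟨w, hw, h⟩
    obtain ⟨a, ha⟩ := hX.ex w hw
    obtain ⟨b, hb⟩ := hY.ex w hw
    exact ⟨w, a, b, hw, ha, hb, (key w a b hw ha hb).2 h⟩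

include hX hY in
/-- A bound of the distance, in terms of approximations of arbitrary precision. -/
theorem lt_of_distLt {r : QNum M} (hr : (0 : Frac M) < r.den) (h : X.DistLt Y r) {u w : M.Num}
    (hu : IsPow2 u) (hw : IsPow2 w) : L u < K w + 2 / w + r.val ∧ K w < L u + 2 / u + r.val := by
  obtain ⟨v, hv, h1⟩ := (hX.distLt_iff hY hr).1 h
  rw [← lt_sub_iff_add_lt, abs_lt] at h1
  have h2 := hX.cross hu hv; have h3 := hX.cross hv hu
  have h4 := hY.cross hw hv; have h5 := hY.cross hv hw
  constructor <;> linarith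

end Approx.Conv

theorem Approx.conv_ofRat {q : QNum M} (hq : (0 : Frac M) < q.den) :
    (Approx.ofRat q).Conv fun _ => q.val where
  ex w _ := ⟨q, rfl⟩
  val w a _ h := by
    have h' : a = q := h
    rw [h']; exact ⟨hq, rfl⟩
  mono u w hu hw h := ⟨le_rfl, by
    have := div_le_div_of_nonneg_left (zero_le_two (α := Frac M)) hu.pos h
    linarith⟩

/-- `s` is the sequence of the numbers `s (2 ^ t) = ∑_{i = 1}^t d (2 ^ i) 2 ^ (t - i)`. -/
structure IsDigSum (d s : M.Num → M.Num) : Prop where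
  fn : ∃ h : M.Fn, ∀ w, M.app h w = s w
  one : s 1 = 0
  double : ∀ u, IsPow2 u → s ((1 + 1) * u) = (1 + 1) * s u + d ((1 + 1) * u)
  dig : ∀ u, IsPow2 u → d ((1 + 1) * u) ≤ 1 + 1

/-- As `s (2 w) = 2 s w + d` with `0 ≤ d ≤ 2`, the quotient `s w / w` does not decrease and `(s w +
2) / w` does not increase. The inequalities are multiplied out so that induction in the model
applies. -/
theorem IsDigSum.mono {d s : M.Num → M.Num} (h : IsDigSum d s) {u w : M.Num} (hu : IsPow2 u)
    (hw : IsPow2 w) (huw : (u : Frac M) ≤ w) :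
    (s u : Frac M) * w ≤ s w * u ∧ ((s w : Frac M) + 2) * u ≤ (s u + 2) * w := by
  obtain ⟨f, hf⟩ := h.fn
  have := IsPow2.induction₂ (fun M p u w => u ≤ w →
    M.app (p.fn 0) u * w ≤ M.app (p.fn 0) w * u ∧
      (M.app (p.fn 0) w + (1 + 1)) * u ≤ (M.app (p.fn 0) u + (1 + 1)) * w)
    ⟨fun _ => f, fun _ => 0⟩ u ?_ ?_ hw
  · simp only [hf] at this
    obtain ⟨h1, h2⟩ := this (Frac.coe_le.1 huw)
    rw [← Frac.coe_le] at h1 h2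
    push_cast at h1 h2
    rw [one_add_one_eq_two] at h2
    exact ⟨h1, h2⟩
  · intro hu1
    have : u = 1 := Frac.coe_inj.1 (by
      rw [← Frac.coe_le, Frac.coe_one] at hu1
      rw [Frac.coe_one]; exact le_antisymm hu1 hu.one_le)
    rw [this]
    exact ⟨.inr rfl, .inr rfl⟩
  · intro w hw ih huw
    simp only [hf] at ih ⊢
    rw [← Frac.coe_le] at huw
    rcases huw.lt_or_eq with h1 | h1
    · have h2 := hu.two_mul_le hw.double h1
      push_cast at h2
      obtain ⟨h3, h4⟩ := ih (Frac.coe_le.1 (by linarith))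
      have h5 := Frac.coe_le.2 (h.dig w hw)
      have h6 := Frac.coe_nonneg (d ((1 + 1) * w))
      have h7 := hu.pos
      rw [h.double w hw, ← Frac.coe_le, ← Frac.coe_le]
      rw [← Frac.coe_le] at h3 h4
      push_cast at *
      constructor
      · nlinarith [mul_nonneg h6 h7.le]
      · nlinarith [mul_le_mul_of_nonneg_right h5 h7.le]
    · rw [Frac.coe_inj] at h1
      rw [h1]
      exact ⟨.inr rfl, .inr rfl⟩

/-- `Approx.ofDigits` admits any function that satisfies the recursion up to `w`; all of them give
the same approximation. -/
theorem IsDigSum.unique {d s : M.Num → M.Num} (h : IsDigSum d s) (g : M.Fn) {w : M.Num}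
    (hw : IsPow2 w) (hg1 : M.app g 1 = 0)
    (hg : ∀ u, IsPow2 u → u < w →
      M.app g ((1 + 1) * u) = (1 + 1) * M.app g u + d ((1 + 1) * u)) : M.app g w = s w := by
  obtain ⟨f, hf⟩ := h.fn
  rw [← hf]
  refine IsPow2.induction₂ (fun M p w u => u ≤ w → M.app (p.fn 0) u = M.app (p.fn 1) u)
    ⟨fun i => if i = 0 then g else f, fun _ => 0⟩ w ?_ ?_ hw (.inr rfl)
  · intro _
    simp [hg1, hf, h.one]
  · intro u hu ih huw
    have hu0 := hu.pos
    have h1 : u < w := by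
      rw [← Frac.coe_lt]; rw [← Frac.coe_le] at huw; push_cast at huw; linarith
    have h2 := ih (.inl h1)
    simp only [if_true, Fin.isValue, one_ne_zero, if_false] at h2 ⊢
    rw [hg u hu h1, hf, h.double u hu, h2, hf]

theorem IsDigSum.conv {d s : M.Num → M.Num} (h : IsDigSum d s) (p m : M.Num) :
    (Approx.ofDigits p m d).Conv fun w => (p : Frac M) - m + s w / w where
  ex w hw := by
    obtain ⟨f, hf⟩ := h.fn
    refine ⟨_, f, ?_, ?_, rfl⟩
    · rw [hf, h.one]
    · intro u hu _
      rw [hf, hf, h.double u hu]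
  val w a hw := by
    rintro ⟨g, hg1, hg, rfl⟩
    have hw0 := hw.pos
    refine ⟨hw0, ?_⟩
    rw [h.unique g hw hg1 hg, QNum.val]
    push_cast
    field_simp
    ring
  mono u w hu hw huw := by
    obtain ⟨h1, h2⟩ := h.mono hu hw huw
    have hu0 := hu.pos; have hw0 := hw.pos
    rw [← div_le_div_iff₀ hu0 hw0] at h1
    rw [← div_le_div_iff₀ hw0 hu0, add_div, add_div] at h2
    constructor <;> linarith

end Approx

/-! ### Sums of digits -/

theorem UFun₂.repr_right {F : ∀ M : BaseStructure.{u}, Par M → M.Num → M.Num → M.Num}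
    [h : UFun₂ F] {M : BaseStructure.{u}} [hM : Fact (BaseSystem M)] (p : Par M) (x : M.Num) :
    ∃ g : M.Fn, ∀ w, M.app g w = F M p x w := by
  obtain ⟨f, hf⟩ := h.out.repr M hM.out p
  obtain ⟨g, hg⟩ := (inferInstance : UFun.{u} fun M p w => M.app (p.fn 0) (pair (p.num 0) w)).repr M
    hM.out ⟨fun _ => f, fun _ => x⟩
  exact ⟨g, fun w => by rw [hg, hf, fst_pair, snd_pair]⟩

section DigSum

/-- The sums of the digits `δ x`. -/
noncomputable def digSum (δ : ∀ M : BaseStructure.{u}, Par M → M.Num → M.Num → M.Num) :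
    ∀ M : BaseStructure.{u}, Par M → M.Num → M.Num → M.Num :=
  recFun (fun M p x u y => (1 + 1) * y + δ M p x ((1 + 1) * u)) (fun _ _ _ => 0)
    -- This is `2 u - 2`, the sum when all digits are `2`. It is preserved by the recursion: `2 (2 u
    -- - 2) + 2 = 2 (2 u) - 2`.
    (fun _ _ _ u => mu ((1 + 1) * u) fun z => z + (1 + 1) = (1 + 1) * u)

variable {δ : ∀ M : BaseStructure.{u}, Par M → M.Num → M.Num → M.Num} [hδ : UFun₂ δ]

instance : UFun₂.{u} fun _ _ _ u => mu ((1 + 1) * u) fun z => z + (1 + 1) = (1 + 1) * u :=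
  ⟨inferInstance⟩

instance : UFun₃ fun M p x u y => (1 + 1) * y + δ M p x ((1 + 1) * u) := ⟨inferInstance⟩

instance : UFun₁.{u} fun _ _ _ => 0 := ⟨inferInstance⟩

instance : UFun₂ (digSum δ) := by unfold digSum; infer_instance

theorem mu_two_mul_sub_two {M : BaseStructure.{u}} [hM : Fact (BaseSystem M)] {u : M.Num}
    (hu : IsPow2 u) :
    (mu ((1 + 1) * u) (fun z => z + (1 + 1) = (1 + 1) * u) : Frac M) + 2 = 2 * u := by
  have h1 := mu_spec (fun M p u z => z + (1 + 1) = (1 + 1) * u) (Par.any M) ((1 + 1) * u) u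
  have h2 := hu.one_le
  obtain ⟨z, hz⟩ := Frac.exists_sub (x := 1 + 1) (y := (1 + 1) * u) (by push_cast; linarith)
  have h3 := h1.of_exists ⟨z, by rw [← Frac.coe_lt, hz]; push_cast; linarith, by
    rw [← Frac.coe_inj (M := M), hz]; push_cast; ring⟩
  rw [← Frac.coe_inj (M := M)] at h3
  push_cast at h3
  linarith

theorem isDigSum_digSum {M : BaseStructure.{u}} [hM : Fact (BaseSystem M)] {p : Par M} {x : M.Num}
    (h : ∀ u, IsPow2 u → δ M p x ((1 + 1) * u) ≤ 1 + 1) :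
    IsDigSum (δ M p x) (digSum δ M p x) := by
  have hmono : ∀ u v : M.Num, IsPow2 u → IsPow2 v → (u : Frac M) ≤ v →
      ((mu ((1 + 1) * u) (fun z => z + (1 + 1) = (1 + 1) * u) : M.Num) : Frac M) ≤
        (mu ((1 + 1) * v) (fun z => z + (1 + 1) = (1 + 1) * v) : M.Num) := by
    intro u v hu hv huv
    have := mu_two_mul_sub_two hu
    have := mu_two_mul_sub_two hv
    linarith
  have h1 : (0 : M.Num) ≤ mu ((1 + 1) * 1) (fun z => z + (1 + 1) = (1 + 1) * 1) :=
    hM.out.basic.zero_le _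
  have hstep : ∀ u y : M.Num, IsPow2 u → y ≤ mu ((1 + 1) * u) (fun z => z + (1 + 1) = (1 + 1) * u) →
      (1 + 1) * y + δ M p x ((1 + 1) * u) ≤
        mu ((1 + 1) * ((1 + 1) * u)) (fun z => z + (1 + 1) = (1 + 1) * ((1 + 1) * u)) := by
    intro u y hu hy
    have h2 := mu_two_mul_sub_two hu
    have h3 := mu_two_mul_sub_two hu.double
    have h4 := h u hu
    rw [← Frac.coe_le] at *
    push_cast at *
    linarith
  exact ⟨UFun₂.repr_right p x, recFun_one (hG := inferInstance) (hS := inferInstance)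
      (hb := inferInstance) hmono h1 hstep,
    fun u hu => recFun_double (hG := inferInstance) (hS := inferInstance)
      (hb := inferInstance) hmono h1 hstep hu, h⟩

end DigSum

/-! ### Reals from rapidly converging sequences -/

section Scale

variable {M : BaseStructure.{u}}

/-- The number `16 u`. -/
def scale (u : M.Num) : M.Num := (1 + 1) * ((1 + 1) * ((1 + 1) * ((1 + 1) * u)))

instance : UFun₁.{u} fun _ _ u => scale u := ⟨by unfold scale; infer_instance⟩

variable [hM : Fact (BaseSystem M)]

@[simp]
theorem coe_scale (u : M.Num) : (scale u : Frac M) = 16 * u := by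
  simp only [scale, Frac.coe_mul, Frac.coe_add, Frac.coe_one]; ring

theorem IsPow2.scale {u : M.Num} (h : IsPow2 u) : IsPow2 (scale u) := h.double.double.double.double

theorem IsPow2.one_lt_double {u : M.Num} (h : IsPow2 u) : (1 : M.Num) < (1 + 1) * u := by
  have := h.one_le
  rw [← Frac.coe_lt]; push_cast; linarith

theorem RealCode.Valid.exists_isDigSum {x : RealCode M} (h : x.Valid) :
    ∃ s, IsDigSum (M.app x.dig) s := by
  have : UFun₂.{u} fun M p _ w => M.app (p.fn 0) w := ⟨inferInstance⟩
  exact ⟨_, isDigSum_digSum (δ := fun M p _ w => M.app (p.fn 0) w) (p := ⟨fun _ => x.dig, fun _ => 0⟩)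
    (x := 0) fun u hu => h _ hu.double hu.one_lt_double⟩

theorem RealCode.Valid.exists_conv {x : RealCode M} (h : x.Valid) : ∃ L, x.val.Conv L := by
  obtain ⟨s, hs⟩ := h.exists_isDigSum
  exact ⟨_, hs.conv x.pos x.neg⟩

end Scale

section RealOf

variable (P Q : ∀ M : BaseStructure.{u}, Par M → M.Num → M.Num)
  (ν : ∀ M : BaseStructure.{u}, Par M → M.Num)

/-- The integer part of `u (P u - Q u) / (16 u) + u ν - 1 / 2`. -/
noncomputable def floorSeq (M : BaseStructure.{u}) (p : Par M) (u : M.Num) : M.Num :=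
  mu (P M p u + ν M p * scale u + 1) fun a =>
    scale a + (1 + 1) * ((1 + 1) * (1 + 1)) + Q M p u ≤ P M p u + ν M p * scale u ∧
    P M p u + ν M p * scale u < scale (a + 1) + (1 + 1) * ((1 + 1) * (1 + 1)) + Q M p u

/-- The digits of the limit of `(P u - Q u) / (16 u)`. -/
noncomputable def limDig (M : BaseStructure.{u}) (p : Par M) (n : M.Num) : M.Num :=
  mu (1 + 1 + 1) fun z => ∃ u, u < n ∧
    (n = (1 + 1) * u ∧ floorSeq P Q ν M p n = (1 + 1) * floorSeq P Q ν M p u + z)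

variable {P Q ν} [hP : UFun₁ P] [hQ : UFun₁ Q] [hν : UFun fun M p _ => ν M p]

instance : UFun₁ (floorSeq P Q ν) := ⟨by unfold floorSeq; infer_instance⟩

instance : UFun₁ (limDig P Q ν) := ⟨by unfold limDig; infer_instance⟩

variable {M : BaseStructure.{u}} [hM : Fact (BaseSystem M)] {p : Par M}

/-- The hypothesis says that the quantity whose integer part is taken is nonnegative, so a natural
quotient on division by `16` exists and lies below the bound of the search. -/
theorem floorSeq_spec {u : M.Num}
    (h : (Q M p u : Frac M) + 8 ≤ P M p u + ν M p * (16 * u)) :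
    16 * (floorSeq P Q ν M p u : Frac M) + 8 + Q M p u ≤ P M p u + ν M p * (16 * u) ∧
    (P M p u : Frac M) + ν M p * (16 * u) < 16 * floorSeq P Q ν M p u + 24 + Q M p u := by
  have h1 := mu_spec (fun M p u a =>
    scale a + (1 + 1) * ((1 + 1) * (1 + 1)) + Q M p u ≤ P M p u + ν M p * scale u ∧
    P M p u + ν M p * scale u < scale (a + 1) + (1 + 1) * ((1 + 1) * (1 + 1)) + Q M p u) p
    (P M p u + ν M p * scale u + 1) u
  obtain ⟨X, hX⟩ := Frac.exists_sub (x := Q M p u + (1 + 1) * ((1 + 1) * (1 + 1)))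
    (y := P M p u + ν M p * scale u) (by push_cast; rw [coe_scale]; linarith)
  obtain ⟨a, ha1, ha2⟩ := exists_floor X (scale 1) (by rw [coe_scale, Frac.coe_one]; norm_num)
  rw [coe_scale, Frac.coe_one] at ha1 ha2
  push_cast at hX
  rw [coe_scale] at hX
  have hq := Frac.coe_nonneg (Q M p u)
  have ha := Frac.coe_nonneg a
  have h2 := h1.of_exists ⟨a, by
    rw [← Frac.coe_lt, ]; push_cast; rw [coe_scale]; linarith, by
    rw [← Frac.coe_le]; push_cast; rw [coe_scale, coe_scale]; linarith, by
    rw [← Frac.coe_lt]; push_cast; rw [coe_scale, coe_scale]; push_cast; linarith⟩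
  rw [← Frac.coe_le, ← Frac.coe_lt] at h2
  push_cast at h2
  rw [coe_scale, coe_scale, coe_scale] at h2
  push_cast at h2
  unfold floorSeq
  constructor
  · linarith [h2.1]
  · linarith [h2.2]

/-- Let `T u = (P u - Q u) / (16 u)`, let `x u = u T u + u ν - 1 / 2`, and let `A u` be the integer
part of `x u`. By `hstep`, `x (2 u) - 2 x u = 2 u (T (2 u) - T u) + 1 / 2` lies in `[0, 1]`, so `2 A
u - 1 < A (2 u) < 2 A u + 3`: the difference `A (2 u) - 2 A u` is a legal digit. The shift by `1 /
2` centres the error. The number `ν` only keeps `x u` nonnegative and reappears as the negative part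
of the code. -/
theorem exists_limit
    (hpos : ∀ u, IsPow2 u → (Q M p u : Frac M) + 8 ≤ P M p u + ν M p * (16 * u))
    (hstep : ∀ u, IsPow2 u → |((P M p ((1 + 1) * u) : Frac M) - Q M p ((1 + 1) * u)) / (32 * u) -
      ((P M p u : Frac M) - Q M p u) / (16 * u)| ≤ 1 / (4 * u)) :
    ∃ g : M.Fn, (∀ n, M.app g n = limDig P Q ν M p n) ∧
      (RealCode.mk (floorSeq P Q ν M p 1) (ν M p) g).Valid ∧
      ∃ L, (RealCode.mk (floorSeq P Q ν M p 1) (ν M p) g).val.Conv L ∧ ∀ u, IsPow2 u →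
        ((P M p u : Frac M) - Q M p u) / (16 * u) - 3 / (2 * u) < L u ∧
        L u ≤ ((P M p u : Frac M) - Q M p u) / (16 * u) - 1 / (2 * u) := by
  obtain ⟨g, hg⟩ := (UFun₁.out (F := limDig P Q ν)).repr M hM.out p
  obtain ⟨f, hf⟩ := (UFun₁.out (F := floorSeq P Q ν)).repr M hM.out p
  have hdig : ∀ u, IsPow2 u → M.app g ((1 + 1) * u) ≤ 1 + 1 ∧
      floorSeq P Q ν M p ((1 + 1) * u) = (1 + 1) * floorSeq P Q ν M p u + M.app g ((1 + 1) * u) := by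
    intro u hu
    have h1 := mu_spec (fun M p n z => ∃ u, u < n ∧
      (n = (1 + 1) * u ∧ floorSeq P Q ν M p n = (1 + 1) * floorSeq P Q ν M p u + z)) p
      (1 + 1 + 1) ((1 + 1) * u)
    obtain ⟨h2, h3⟩ := floorSeq_spec (hpos u hu)
    obtain ⟨h4, h5⟩ := floorSeq_spec (hpos _ hu.double)
    have h6 := abs_le.1 (hstep u hu)
    have hu0 := hu.pos
    set A := (floorSeq P Q ν M p u : Frac M)
    set A' := (floorSeq P Q ν M p ((1 + 1) * u) : Frac M)
    set S := (P M p u : Frac M) - Q M p u with hS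
    set S' := (P M p ((1 + 1) * u) : Frac M) - Q M p ((1 + 1) * u) with hS'
    have e1 : (S' / (32 * u) - S / (16 * u)) * (32 * u) = S' - 2 * S := by field_simp; ring
    have e2 : 1 / (4 * u) * (32 * u) = (8 : Frac M) := by field_simp; norm_num
    have h7 : S' - 2 * S ≤ 8 := by
      rw [← e1, ← e2]; exact mul_le_mul_of_nonneg_right h6.2 (by positivity)
    have h8 : -8 ≤ S' - 2 * S := by
      rw [← e1, ← e2, ← neg_mul]; exact mul_le_mul_of_nonneg_right h6.1 (by positivity)
    push_cast at h4 h5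
    have h9 : 2 * A - 1 < A' := by linarith
    have h10 : A' < 2 * A + 3 := by linarith
    have h11 : ((1 + 1) * floorSeq P Q ν M p u : M.Num) ≤ (A' : Frac M) := by
      refine Frac.coe_le_of_lt_add_one ?_
      push_cast; linarith
    obtain ⟨z, hz⟩ := Frac.exists_sub h11
    have hz3 : z < 1 + 1 + 1 := by
      rw [← Frac.coe_lt]; push_cast at hz ⊢; linarith
    have hzz : ∃ v, v < (1 + 1) * u ∧ ((1 + 1) * u = (1 + 1) * v ∧
        floorSeq P Q ν M p ((1 + 1) * u) = (1 + 1) * floorSeq P Q ν M p v + z) := by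
      refine ⟨u, by rw [← Frac.coe_lt]; push_cast; linarith, rfl, ?_⟩
      rw [← Frac.coe_inj (M := M)]; push_cast at hz ⊢; linarith
    rw [hg]
    obtain ⟨v, -, hv1, hv2⟩ := h1.of_exists ⟨z, hz3, hzz⟩
    have hvu : v = u := by
      rw [← Frac.coe_inj (M := M)] at hv1 ⊢; push_cast at hv1; linarith
    rw [hvu] at hv2
    refine ⟨?_, hv2⟩
    have h12 : ((limDig P Q ν M p ((1 + 1) * u) : M.Num) : Frac M) ≤ 2 := by
      have := congrArg (Frac.of (M := M)) hv2
      push_cast at this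
      unfold limDig
      have h13 := Frac.coe_add_one_le (x := mu (1 + 1 + 1) fun z => ∃ v, v < (1 + 1) * u ∧
        ((1 + 1) * u = (1 + 1) * v ∧
        floorSeq P Q ν M p ((1 + 1) * u) = (1 + 1) * floorSeq P Q ν M p v + z))
        (y := 1 + 1 + 1) (by push_cast; linarith)
      push_cast at h13
      linarith
    rw [← Frac.coe_le]; push_cast; linarith
  have hvalid : (RealCode.mk (floorSeq P Q ν M p 1) (ν M p) g).Valid := by
    intro w hw hw1
    rcases hw.cases with rfl | ⟨u, hu, -, rfl⟩
    · exact absurd hw1 (hM.out.basic.lt_irrefl _)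
    · exact (hdig u hu).1
  obtain ⟨s, hs⟩ := hvalid.exists_isDigSum
  -- The digit recursion started at `A 1` instead of `0` adds `u A 1` to the digit sum; `A 1` is the
  -- positive integer part of the code.
  have hAs : ∀ u, IsPow2 u → floorSeq P Q ν M p u = s u + u * floorSeq P Q ν M p 1 := by
    intro u hu
    obtain ⟨h, hh⟩ := hs.fn
    have := IsPow2.induction (fun M p u => M.app (p.fn 0) u = M.app (p.fn 1) u + u * M.app (p.fn 0) 1)
      ⟨fun i => if i = 0 then f else h, fun _ => 0⟩ ?_ ?_ hu
    · simpa [hf, hh] using this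
    · simp only [if_true, Fin.isValue, one_ne_zero, if_false, hf, hh, hs.one]
      rw [← Frac.coe_inj (M := M)]; push_cast; ring
    · intro v hv ih
      simp only [if_true, Fin.isValue, one_ne_zero, if_false, hf, hh] at ih ⊢
      rw [hs.double v hv, (hdig v hv).2, ih]
      rw [← Frac.coe_inj (M := M)]; push_cast; ring
  refine ⟨g, hg, hvalid, _, hs.conv _ _, fun u hu => ?_⟩
  obtain ⟨h2, h3⟩ := floorSeq_spec (hpos u hu)
  have hu0 := hu.pos
  have h4 := congrArg (Frac.of (M := M)) (hAs u hu)
  push_cast at h4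
  have e1 : (floorSeq P Q ν M p 1 : Frac M) - ν M p + s u / u =
      (16 * floorSeq P Q ν M p u - ν M p * (16 * u)) / (16 * u) := by
    rw [h4]; field_simp; ring
  have e2 : ((P M p u : Frac M) - Q M p u) / (16 * u) - 3 / (2 * u) =
      (P M p u - Q M p u - 24) / (16 * u) := by field_simp; ring
  have e3 : ((P M p u : Frac M) - Q M p u) / (16 * u) - 1 / (2 * u) =
      (P M p u - Q M p u - 8) / (16 * u) := by field_simp; ring
  rw [e2, e3]
  change _ < (floorSeq P Q ν M p 1 : Frac M) - ν M p + s u / u ∧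
    (floorSeq P Q ν M p 1 : Frac M) - ν M p + s u / u ≤ _
  rw [e1]
  constructor
  · apply div_lt_div_of_pos_right _ (by positivity); linarith
  · apply div_le_div_of_nonneg_right _ (by positivity); linarith

end RealOf

/-! ### Maxima over initial segments -/

section ArgMax

/-- A number `j ≤ n` at which the difference `P c j - Q c j` is maximal. -/
noncomputable def argMax (P Q : ∀ M : BaseStructure.{u}, Par M → M.Num → M.Num → M.Num)
    (M : BaseStructure.{u}) (p : Par M) (c n : M.Num) : M.Num :=
  mu (n + 1) fun j => ∀ k, k < n + 1 → P M p c k + Q M p c j ≤ P M p c j + Q M p c k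

variable {P Q : ∀ M : BaseStructure.{u}, Par M → M.Num → M.Num → M.Num} [hP : UFun₂ P] [hQ : UFun₂ Q]

instance : UFun₂ (argMax P Q) := ⟨by unfold argMax; infer_instance⟩

variable {M : BaseStructure.{u}} [hM : Fact (BaseSystem M)]

/-- The maximum exists by induction on `n`, comparing the maximum so far with the new value; the
search then finds a maximal place. -/
theorem argMax_spec (p : Par M) (c n : M.Num) : argMax P Q M p c n ≤ n ∧
    ∀ k, k ≤ n → (P M p c k : Frac M) - Q M p c k ≤
      P M p c (argMax P Q M p c n) - Q M p c (argMax P Q M p c n) := by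
  have h1 : ∃ j, j < n + 1 ∧ ∀ k, k < n + 1 →
      P M p c k + Q M p c j ≤ P M p c j + Q M p c k := by
    refine Def.induction₂ (fun M p c n => ∃ j, j < n + 1 ∧ ∀ k, k < n + 1 →
      P M p c k + Q M p c j ≤ P M p c j + Q M p c k) p c ?_ ?_ n
    · refine ⟨0, hM.out.basic.lt_succ _, fun k hk => ?_⟩
      have hk0 : k = 0 := by
        rw [lt_add_one_iff, ← Frac.coe_le, Frac.coe_zero] at hk
        exact Frac.coe_inj.1 (by rw [Frac.coe_zero]; exact le_antisymm hk (Frac.coe_nonneg k))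
      rw [hk0]; exact .inr rfl
    · rintro n ⟨j, hj, h⟩
      rcases le_total ((P M p c (n + 1) : Frac M) - Q M p c (n + 1)) (P M p c j - Q M p c j)
        with h2 | h2
      · refine ⟨j, hM.out.basic.lt_trans _ _ _ hj (hM.out.basic.lt_succ _), fun k hk => ?_⟩
        rcases lt_add_one_iff.1 hk with hk | rfl
        · exact h k hk
        · rw [← Frac.coe_le]; push_cast at h2 ⊢; linarith
      · refine ⟨n + 1, hM.out.basic.lt_succ _, fun k hk => ?_⟩
        rcases lt_add_one_iff.1 hk with hk | rfl
        · have h3 := h k hk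
          rw [← Frac.coe_le] at h3 ⊢; push_cast at h3 h2 ⊢; linarith
        · exact .inr rfl
  have h2 := mu_spec (fun M p z j => ∀ k, k < snd z + 1 →
    P M p (fst z) k + Q M p (fst z) j ≤ P M p (fst z) j + Q M p (fst z) k) p (n + 1) (pair c n)
  simp only [fst_pair, snd_pair] at h2
  have h3 := h2.of_exists h1
  have h4 : argMax P Q M p c n < n + 1 := by
    rcases h2 with ⟨h, -⟩ | ⟨-, h⟩
    · exact h
    · obtain ⟨j, hj, hj'⟩ := h1
      exact absurd hj' (h j hj)
  refine ⟨lt_add_one_iff.1 h4, fun k hk => ?_⟩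
  have h5 := h3 k (lt_add_one_iff.2 hk)
  rw [← Frac.coe_le] at h5
  push_cast at h5
  unfold argMax
  linarith

end ArgMax

/-! ### Continuous functions -/

/-- The continuous function that is coded by the first four function parameters. -/
def Par.code {M : BaseStructure.{u}} (p : Par M) : FunCode M := ⟨p.fn 0, p.fn 1, p.fn 2, p.fn 3⟩

section Code

/-- The digit sums of the value at the rational point with index `x`. -/
noncomputable def valSum : ∀ M : BaseStructure.{u}, Par M → M.Num → M.Num → M.Num :=
  digSum fun M p x w => M.app (p.fn 2) (pair x w)

instance : UFun₂.{u} fun M p x w => M.app (p.fn 2) (pair x w) := ⟨inferInstance⟩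

instance : UFun₂ valSum.{u} := by unfold valSum; infer_instance

/-- The positive and the negative part of `w` times the value at `x`, with precision `w`. -/
noncomputable def valP (M : BaseStructure.{u}) (p : Par M) (x w : M.Num) : M.Num :=
  M.app (p.fn 0) x * w + valSum M p x w

noncomputable def valN (M : BaseStructure.{u}) (p : Par M) (x w : M.Num) : M.Num :=
  M.app (p.fn 1) x * w

instance : UFun₂ valP.{u} := ⟨by unfold valP; infer_instance⟩
instance : UFun₂ valN.{u} := ⟨by unfold valN; infer_instance⟩

/-- A power of two above `u` and above the moduli of continuity for precisions up to `16 u`. -/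
noncomputable def grid (M : BaseStructure.{u}) (p : Par M) (u : M.Num) : M.Num :=
  M.powLen (1 + 1) (M.app (p.fn 3)
    (argMax (fun M p _ k => M.app (p.fn 3) k) (fun _ _ _ _ => 0) M p 0 (scale u)) + u)

instance : UFun₂.{u} fun M p _ k => M.app (p.fn 3) k := ⟨inferInstance⟩
instance : UFun₂.{u} fun _ _ _ _ => 0 := ⟨inferInstance⟩
instance : UFun₁ grid.{u} := ⟨by unfold grid; infer_instance⟩

variable {M : BaseStructure.{u}} [hM : Fact (BaseSystem M)] {p : Par M}

/-- The lower approximation with precision `w` of the value at `x`. -/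
noncomputable def valL (p : Par M) (x w : M.Num) : Frac M :=
  (M.app (p.fn 0) x : Frac M) - M.app (p.fn 1) x + valSum M p x w / w

theorem valP_sub_valN (x : M.Num) {w : M.Num} (hw : (0 : Frac M) < w) :
    ((valP M p x w : Frac M) - valN M p x w) = valL p x w * w := by
  rw [valP, valN, valL]; push_cast; field_simp; ring

theorem isPow2_grid (u : M.Num) : IsPow2 (grid M p u) := isPow2_powLen _

/-- A modulus need not be monotone in the precision, so the grid is built from its maximum over an
initial segment. The summand `u` forces the grids to become arbitrarily fine. -/
theorem modulus_add_lt_grid {k u : M.Num} (h : k ≤ scale u) :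
    (M.app (p.fn 3) k : Frac M) + u < grid M p u := by
  refine lt_of_le_of_lt ?_ (lt_powLen_two _)
  have := (argMax_spec (P := fun M p _ k => M.app (p.fn 3) k) (Q := fun _ _ _ _ => 0)
    (hP := inferInstance) (hQ := inferInstance) p 0 (scale u)).2 k h
  push_cast at this ⊢
  linarith

theorem grid_mono {u v : M.Num} (h : (u : Frac M) ≤ v) : (grid M p u : Frac M) ≤ grid M p v := by
  refine powLen_two_mono ?_
  have h1 := (argMax_spec (P := fun M p _ k => M.app (p.fn 3) k) (Q := fun _ _ _ _ => 0)
    (hP := inferInstance) (hQ := inferInstance) p 0 (scale u)).1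
  have h2 := (argMax_spec (P := fun M p _ k => M.app (p.fn 3) k) (Q := fun _ _ _ _ => 0)
    (hP := inferInstance) (hQ := inferInstance) p 0 (scale v)).2 _
    (show _ ≤ scale v by
      refine Frac.coe_le.1 ((Frac.coe_le.2 h1).trans ?_)
      rw [coe_scale, coe_scale]; linarith)
  rw [← Frac.coe_le]
  push_cast at h2 ⊢
  linarith

section

variable (hc : p.code.Continuous)
include hc

theorem isDigSum_valSum {a b : M.Num} (hab : UnitPoint a b) :
    IsDigSum (fun w => M.app (p.fn 2) (pair (pair a b) w)) (valSum M p (pair a b)) :=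
  isDigSum_digSum (δ := fun M p x w => M.app (p.fn 2) (pair x w)) fun _ hu =>
    hc.1 a b hab _ hu.double hu.one_lt_double

theorem conv_valueAt {a b : M.Num} (hab : UnitPoint a b) :
    (p.code.valueAt a b).Conv (valL p (pair a b)) :=
  (isDigSum_valSum hc hab).conv _ _

theorem valL_lt {a b a' b' k u w : M.Num} (hab : UnitPoint a b) (hab' : UnitPoint a' b')
    (hk : (0 : Frac M) < k) (h : |(a : Frac M) / b - a' / b'| < 1 / M.app (p.fn 3) k)
    (hu : IsPow2 u) (hw : IsPow2 w) :
    valL p (pair a b) u < valL p (pair a' b') w + 2 / w + 1 / k ∧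
      valL p (pair a' b') w < valL p (pair a b) u + 2 / u + 1 / k := by
  obtain ⟨he, hcont⟩ := hc.2 k (Frac.coe_lt.1 (by rwa [Frac.coe_zero]))
  have h0 : ∀ {x : M.Num}, 0 < x → (0 : Frac M) < x := fun hx => by
    rwa [← Frac.coe_lt, Frac.coe_zero] at hx
  have h1 := hcont a b a' b' hab hab' (by
    rw [QNum.distLt_iff (h0 hab.1) (h0 hab'.1) (h0 he)]
    simpa [Par.code] using h)
  have h2 := (conv_valueAt hc hab).lt_of_distLt (conv_valueAt hc hab') (r := QNum.frac 1 k) hk h1 hu hw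
  simpa using h2

theorem modulus_pos {k : M.Num} (hk : (0 : Frac M) < k) : (0 : Frac M) < M.app (p.fn 3) k := by
  have := (hc.2 k (Frac.coe_lt.1 (by rwa [Frac.coe_zero]))).1
  rwa [← Frac.coe_lt, Frac.coe_zero] at this

/-- Values at points whose distance is at most the mesh of the grid. -/
theorem valL_lt_of_grid {a b a' b' u w w' : M.Num} (hab : UnitPoint a b) (hab' : UnitPoint a' b')
    (hu : IsPow2 u) (h : |(a : Frac M) / b - a' / b'| ≤ 1 / grid M p u)
    (hw : IsPow2 w) (hw' : IsPow2 w') :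
    valL p (pair a b) w < valL p (pair a' b') w' + 2 / w' + 1 / (16 * u) ∧
      valL p (pair a' b') w' < valL p (pair a b) w + 2 / w + 1 / (16 * u) := by
  have h1 := hu.scale.pos
  have h2 := modulus_add_lt_grid (p := p) (u := u) (k := scale u) (.inr rfl)
  have h3 := modulus_pos hc h1
  have := valL_lt hc hab hab' h1 (h.trans_lt (one_div_lt_one_div_of_lt h3 (by
    linarith [hu.pos]))) hw hw'
  rwa [coe_scale] at this

end

theorem exists_grid_point {a b u : M.Num} (hab : UnitPoint a b) :
    ∃ l, UnitPoint l (grid M p u) ∧ (l : Frac M) / grid M p u ≤ (a : Frac M) / b ∧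
      (a : Frac M) / b < ((l : Frac M) + 1) / grid M p u := by
  have hN := (isPow2_grid (p := p) u).pos
  have hb : (0 : Frac M) < b := by have := hab.1; rwa [← Frac.coe_lt, Frac.coe_zero] at this
  have ha : (a : Frac M) ≤ b := Frac.coe_le.2 hab.2
  obtain ⟨l, hl1, hl2⟩ := exists_floor (a * grid M p u) b hb
  push_cast at hl1 hl2
  refine ⟨l, ⟨Frac.coe_lt.1 (by rwa [Frac.coe_zero]), Frac.coe_le.1 ?_⟩, ?_, ?_⟩
  · have : (b : Frac M) * l ≤ b * grid M p u := hl1.trans (mul_le_mul_of_nonneg_right ha hN.le)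
    exact le_of_mul_le_mul_left this hb
  · rw [div_le_div_iff₀ hN hb]; linarith
  · rw [div_lt_div_iff₀ hb hN]; linarith

end Code

/-! ### Rational points and reals -/

section Rational

variable {M : BaseStructure.{u}} [hM : Fact (BaseSystem M)]

theorem UnitPoint.den_pos {a b : M.Num} (h : UnitPoint a b) : (0 : Frac M) < b := by
  have := h.1; rwa [← Frac.coe_lt, Frac.coe_zero] at this

theorem UnitPoint.val_le_one {a b : M.Num} (h : UnitPoint a b) : (a : Frac M) / b ≤ 1 :=
  (div_le_one h.den_pos).2 (Frac.coe_le.2 h.2)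

theorem UnitPoint.val_nonneg {a b : M.Num} (h : UnitPoint a b) : 0 ≤ (a : Frac M) / b :=
  div_nonneg (Frac.coe_nonneg a) h.den_pos.le

theorem unitPoint_zero : UnitPoint (0 : M.Num) 1 := by
  constructor
  · rw [← Frac.coe_lt]; push_cast; exact one_pos
  · rw [← Frac.coe_le]; push_cast; exact zero_le_one

theorem unitPoint_one : UnitPoint (1 : M.Num) 1 := by
  constructor
  · rw [← Frac.coe_lt]; push_cast; exact one_pos
  · exact .inr rfl

/-- A rational approximation of a real in `[0, 1]` may fall slightly outside the interval; it is
then replaced by the nearer end point. -/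
theorem Approx.Conv.exists_unitPoint {X : Approx M} {L : M.Num → Frac M} (hX : X.Conv L)
    (h : ∀ w, IsPow2 w → -(2 / w) ≤ L w ∧ L w ≤ 1 + 2 / w) {e : M.Num} (he : (0 : Frac M) < e) :
    ∃ a b, UnitPoint a b ∧ X.DistLt (Approx.ofRat (QNum.frac a b)) (QNum.frac 1 e) := by
  obtain ⟨w, hw, hw4⟩ := exists_isPow2_gt (M := M) (4 * e)
  have hw0 := hw.pos
  obtain ⟨h1, h2⟩ := h w hw
  have key : ∃ a b : M.Num, UnitPoint a b ∧ |L w - (a : Frac M) / b| ≤ 2 / (w : Frac M) := by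
    obtain ⟨c, hc⟩ := hX.ex w hw
    obtain ⟨hd, hcL⟩ := hX.val w c hw hc
    have h2w : (0 : Frac M) < 2 / w := by positivity
    rcases le_total (L w) 0 with h3 | h3
    · refine ⟨0, 1, unitPoint_zero, ?_⟩
      rw [Frac.coe_zero, zero_div, abs_le]; constructor <;> linarith
    rcases le_total 1 (L w) with h4 | h4
    · refine ⟨1, 1, unitPoint_one, ?_⟩
      rw [Frac.coe_one, div_one, abs_le]; constructor <;> linarith
    rw [← hcL, QNum.val] at h3 h4
    have h5 : (c.neg : Frac M) ≤ c.pos := by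
      by_contra hn
      exact absurd h3 (not_le.2 (div_neg_of_neg_of_pos (by linarith) hd))
    obtain ⟨z, hz⟩ := Frac.exists_sub h5
    refine ⟨z, c.den, ⟨Frac.coe_lt.1 (by rwa [Frac.coe_zero]), Frac.coe_le.1 ?_⟩, ?_⟩
    · rw [div_le_one hd] at h4; linarith
    · rw [← hcL, QNum.val, hz, add_sub_cancel_left, sub_self, abs_zero]; exact h2w.le
  obtain ⟨a, b, hab, hd⟩ := key
  refine ⟨a, b, hab, ?_⟩
  rw [hX.distLt_iff (Approx.conv_ofRat (by exact hab.den_pos)) (by exact he)]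
  refine ⟨w, hw, ?_⟩
  rw [QNum.val_frac, QNum.val_frac, Frac.coe_one]
  have h3 : (2 : Frac M) / w + 2 / w < 1 / e := by
    rw [← add_div, div_lt_div_iff₀ hw0 he]; linarith
  linarith

/-- The integer part of `16 u` times the rational number that is given by the parameters. -/
noncomputable def ratFloor (M : BaseStructure.{u}) (p : Par M) (u : M.Num) : M.Num :=
  mu (p.num 0 * scale u + 1) fun t =>
    p.num 1 * t ≤ p.num 0 * scale u ∧ p.num 0 * scale u < p.num 1 * t + p.num 1

instance : UFun₁ ratFloor.{u} := ⟨by unfold ratFloor; infer_instance⟩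

theorem ratFloor_spec {p : Par M} (h : (0 : Frac M) < p.num 1) (u : M.Num) :
    (p.num 1 : Frac M) * ratFloor M p u ≤ p.num 0 * (16 * u) ∧
      (p.num 0 : Frac M) * (16 * u) < p.num 1 * ratFloor M p u + p.num 1 := by
  obtain ⟨t, ht1, ht2⟩ := exists_floor (p.num 0 * scale u) (p.num 1) h
  have h1 := (mu_spec (fun M p u t => p.num 1 * t ≤ p.num 0 * scale u ∧
    p.num 0 * scale u < p.num 1 * t + p.num 1) p (p.num 0 * scale u + 1) u).of_exists
    ⟨t, by
      have h2 : (t : Frac M) ≤ p.num 1 * t :=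
        le_mul_of_one_le_left (Frac.coe_nonneg _) (Frac.one_le_coe h)
      rw [← Frac.coe_lt]; push_cast at *; linarith, Frac.coe_le.1 (by push_cast at *; exact ht1),
      Frac.coe_lt.1 (by push_cast at *; exact ht2)⟩
  rw [← Frac.coe_le, ← Frac.coe_lt] at h1
  push_cast at h1
  simp only [coe_scale] at h1
  exact h1

instance : UFun.{u} fun _ _ _ => 1 := inferInstance

/-- Upper bounds are tested at coded reals only, so rational points need codes as well. The code
arises from the quotients `⌊16 u a / b⌋ / (16 u)` by `exists_limit`; `ν = 1` suffices because these
are nonnegative. -/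
theorem UnitPoint.exists_realCode {a b : M.Num} (hab : UnitPoint a b) :
    ∃ x : RealCode M, x.Valid ∧ x.InUnit ∧ ∃ L, x.val.Conv L ∧
      ∀ w, IsPow2 w → |L w - (a : Frac M) / b| ≤ 2 / w := by
  set p : Par M := ⟨(Par.any M).fn, fun i => if i = 0 then a else b⟩ with hp
  have hb := hab.den_pos
  have hs : ∀ u, IsPow2 u → (ratFloor M p u : Frac M) / (16 * u) ≤ a / b ∧
      (a : Frac M) / b - 1 / (16 * u) < ratFloor M p u / (16 * u) := by
    intro u hu
    have hu0 := hu.pos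
    obtain ⟨h1, h2⟩ := ratFloor_spec (p := p) (by simpa [hp] using hb) u
    simp only [hp, if_true, one_ne_zero, if_false] at h1 h2
    rw [sub_lt_iff_lt_add, ← add_div]
    constructor
    · rw [div_le_div_iff₀ (by positivity) hb]; linarith
    · rw [div_lt_div_iff₀ hb (by positivity)]; linarith
  obtain ⟨g, -, hv, L, hL, hLu⟩ := exists_limit (P := ratFloor) (Q := fun _ _ _ => 0)
    (ν := fun _ _ => 1) (M := M) (p := p) (fun u hu => by
      have := hu.one_le
      have := Frac.coe_nonneg (ratFloor M p u)
      push_cast; linarith) (fun u hu => by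
      have hu0 := hu.pos
      obtain ⟨h1, h2⟩ := hs u hu
      obtain ⟨h3, h4⟩ := hs _ hu.double
      have e1 : (16 : Frac M) * ((1 + 1) * u : M.Num) = 32 * u := by push_cast; ring
      have e2 : (1 : Frac M) / (16 * u) ≤ 1 / (4 * u) :=
        one_div_le_one_div_of_le (by positivity) (by linarith)
      have e3 : (1 : Frac M) / (32 * u) ≤ 1 / (4 * u) :=
        one_div_le_one_div_of_le (by positivity) (by linarith)
      rw [e1] at h3 h4
      rw [Frac.coe_zero, sub_zero, sub_zero, abs_le]
      constructor <;> linarith)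
  have key : ∀ w, IsPow2 w → L w ≤ (a : Frac M) / b ∧ (a : Frac M) / b ≤ L w + 2 / w := by
    intro w hw
    have hw0 := hw.pos
    obtain ⟨h1, h2⟩ := hs w hw
    obtain ⟨h3, h4⟩ := hLu w hw
    rw [Frac.coe_zero, sub_zero] at h3 h4
    have e1 : (0 : Frac M) < 1 / (2 * w) := by positivity
    have e2 : (3 : Frac M) / (2 * w) + 1 / (16 * w) ≤ 2 / w := by
      rw [div_add_div _ _ (by positivity) (by positivity), div_le_div_iff₀ (by positivity) hw0]
      nlinarith [mul_pos hw0 hw0, mul_pos (mul_pos hw0 hw0) hw0]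
    constructor <;> linarith
  have h0 : (0 : Frac M) < (QNum.frac (M := M) 0 1).den := by
    rw [QNum.den_frac, Frac.coe_one]; exact one_pos
  refine ⟨_, hv, ⟨?_, ?_⟩, L, hL, fun w hw => ?_⟩
  · rw [(Approx.conv_ofRat (q := QNum.frac 0 1) h0).le_iff hL]
    intro w hw
    rw [QNum.val_frac, Frac.coe_zero, zero_div]
    exact hab.val_nonneg.trans (key w hw).2
  · rw [hL.le_iff (Approx.conv_ofRat (q := QNum.frac 1 1) h0)]
    intro w hw
    rw [QNum.val_frac, Frac.coe_one, div_one]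
    have := hab.val_le_one
    have h2w : (0 : Frac M) < 2 / w := div_pos two_pos hw.pos
    linarith [(key w hw).1]
  · rw [abs_le]
    have h2w : (0 : Frac M) < 2 / w := div_pos two_pos hw.pos
    constructor <;> linarith [key w hw]

theorem RealCode.InUnit.bounds {x : RealCode M} (hx : x.InUnit) {L : M.Num → Frac M}
    (hL : x.val.Conv L) (w : M.Num) (hw : IsPow2 w) : -(2 / w) ≤ L w ∧ L w ≤ 1 + 2 / w := by
  have h0 : (0 : Frac M) < (QNum.frac (M := M) 0 1).den := by
    rw [QNum.den_frac, Frac.coe_one]; exact one_pos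
  have h1 := ((Approx.conv_ofRat (q := QNum.frac 0 1) h0).le_iff hL).1 hx.1 w hw
  have h2 := (hL.le_iff (Approx.conv_ofRat (q := QNum.frac 1 1) h0)).1 hx.2 w hw
  rw [QNum.val_frac, Frac.coe_zero, zero_div] at h1
  rw [QNum.val_frac, Frac.coe_one, div_one] at h2
  exact ⟨by linarith, h2⟩

end Rational

/-! ### The supremum -/

section Sup

/-- The positive and the negative part of `16 u` times the value at the `l`-th grid point. -/
noncomputable def gridP (M : BaseStructure.{u}) (p : Par M) (u l : M.Num) : M.Num :=
  valP M p (pair l (grid M p u)) (scale u)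

noncomputable def gridN (M : BaseStructure.{u}) (p : Par M) (u l : M.Num) : M.Num :=
  valN M p (pair l (grid M p u)) (scale u)

instance : UFun₂ gridP.{u} := ⟨by unfold gridP; infer_instance⟩
instance : UFun₂ gridN.{u} := ⟨by unfold gridN; infer_instance⟩

/-- A grid point where the value is maximal. -/
noncomputable def topPoint (M : BaseStructure.{u}) (p : Par M) (u : M.Num) : M.Num :=
  argMax gridP gridN M p u (grid M p u)

instance : UFun₁ topPoint.{u} := ⟨by unfold topPoint; infer_instance⟩

noncomputable def topP (M : BaseStructure.{u}) (p : Par M) (u : M.Num) : M.Num :=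
  gridP M p u (topPoint M p u)

noncomputable def topN (M : BaseStructure.{u}) (p : Par M) (u : M.Num) : M.Num :=
  gridN M p u (topPoint M p u)

instance : UFun₁ topP.{u} := ⟨by unfold topP; infer_instance⟩
instance : UFun₁ topN.{u} := ⟨by unfold topN; infer_instance⟩

/-- The negative part of the supremum. -/
noncomputable def supNeg (M : BaseStructure.{u}) (p : Par M) : M.Num := M.app (p.fn 1) (pair 0 1) + 1

instance : UFun.{u} fun M p _ => supNeg M p := by unfold supNeg; infer_instance

variable {M : BaseStructure.{u}} [hM : Fact (BaseSystem M)] {p : Par M}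

theorem gridP_sub_gridN {u : M.Num} (hu : IsPow2 u) (l : M.Num) :
    ((gridP M p u l : Frac M) - gridN M p u l) =
      valL p (pair l (grid M p u)) (scale u) * (16 * u) := by
  rw [gridP, gridN, valP_sub_valN _ hu.scale.pos, coe_scale]

theorem unitPoint_topPoint (u : M.Num) : UnitPoint (topPoint M p u) (grid M p u) :=
  ⟨Frac.coe_lt.1 (by rw [Frac.coe_zero]; exact (isPow2_grid u).pos), (argMax_spec p u _).1⟩

/-- The value at the top grid point. -/
noncomputable def topVal (p : Par M) (u : M.Num) : Frac M :=
  valL p (pair (topPoint M p u) (grid M p u)) (scale u)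

theorem topP_sub_topN {u : M.Num} (hu : IsPow2 u) :
    ((topP M p u : Frac M) - topN M p u) = topVal p u * (16 * u) := by
  rw [topP, topN, gridP_sub_gridN hu, topVal]

theorem valL_zero_ge : -(M.app (p.fn 1) (pair 0 1) : Frac M) ≤ valL p (pair 0 1) 1 := by
  rw [valL, Frac.coe_one, div_one]
  have := Frac.coe_nonneg (M.app (p.fn 0) (pair 0 1))
  have := Frac.coe_nonneg (valSum M p (pair 0 1) 1)
  linarith

variable (hc : p.code.Continuous)
include hc

/-- Each point has a grid point within the mesh. The passage to it costs `1 / (16 u)` by the modulus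
and `2 / (16 u)` by the precision of the computed value. -/
theorem valL_le_topVal {a b u w : M.Num} (hab : UnitPoint a b) (hu : IsPow2 u) (hw : IsPow2 w) :
    valL p (pair a b) w ≤ topVal p u + 3 / (16 * u) := by
  have hu0 := hu.pos
  have hN := (isPow2_grid (p := p) u).pos
  obtain ⟨l, hl, h1, h2⟩ := exists_grid_point (p := p) (u := u) hab
  rw [add_div] at h2
  have h3 := (valL_lt_of_grid hc hab hl hu (by rw [abs_le]; constructor <;> linarith [div_pos one_pos hN])
    hw hu.scale).1
  have h4 := (argMax_spec (P := gridP) (Q := gridN) p u (grid M p u)).2 l hl.2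
  rw [gridP_sub_gridN hu, gridP_sub_gridN hu] at h4
  have h5 := le_of_mul_le_mul_right h4 (by positivity)
  rw [coe_scale] at h3
  have e : (3 : Frac M) / (16 * u) = 2 / (16 * u) + 1 / (16 * u) := by rw [← add_div]; norm_num
  rw [e]
  unfold topVal topPoint
  linarith

/-- The top values of the stages `u` and `2 u` are values at rational points, so each is bounded by
the other up to `3 / (16 u)`, less than the `1 / (4 u)` allowed in `exists_limit`. They are bounded
below through the value at `0`, which explains `supNeg`. -/
theorem exists_sup : ∃ g : M.Fn, (∀ n, M.app g n = limDig topP topN supNeg M p n) ∧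
    (RealCode.mk (floorSeq topP topN supNeg M p 1) (supNeg M p) g).Valid ∧
    ∃ L, (RealCode.mk (floorSeq topP topN supNeg M p 1) (supNeg M p) g).val.Conv L ∧
      ∀ u, IsPow2 u → topVal p u - 3 / (2 * u) < L u ∧ L u ≤ topVal p u - 1 / (2 * u) := by
  have hdiv : ∀ u, IsPow2 u → ((topP M p u : Frac M) - topN M p u) / (16 * u) = topVal p u := by
    intro u hu
    have := hu.pos
    rw [topP_sub_topN hu]; field_simp
  obtain ⟨g, hg, hv, L, hL, h⟩ := exists_limit (P := topP) (Q := topN) (ν := supNeg) (M := M) (p := p)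
    (fun u hu => by
      have hu0 := hu.one_le
      have h1 := valL_le_topVal hc unitPoint_zero hu .one
      have h2 := valL_zero_ge (p := p)
      have h3 := topP_sub_topN (p := p) hu
      have h4 : (supNeg M p : Frac M) = M.app (p.fn 1) (pair 0 1) + 1 := by
        rw [supNeg]; push_cast; rfl
      have h5 : (-(supNeg M p : Frac M) + 1 - 3 / (16 * u)) * (16 * u) ≤ topVal p u * (16 * u) := by
        apply mul_le_mul_of_nonneg_right _ (by positivity); linarith
      have h6 : (3 : Frac M) / (16 * u) * (16 * u) = 3 := by field_simp
      rw [sub_mul, h6] at h5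
      linarith)
    (fun u hu => by
      have hu0 := hu.pos
      have e1 : (32 : Frac M) * u = 16 * ((1 + 1) * u : M.Num) := by push_cast; ring
      rw [e1, hdiv u hu, hdiv _ hu.double]
      have h1 := valL_le_topVal hc (unitPoint_topPoint (p := p) ((1 + 1) * u)) hu hu.double.scale
      have h2 := valL_le_topVal hc (unitPoint_topPoint (p := p) u) hu.double hu.scale
      rw [← e1] at h2
      have e2 : (3 : Frac M) / (16 * u) ≤ 1 / (4 * u) := by
        rw [div_le_div_iff₀ (by positivity) (by positivity)]; linarith
      have e3 : (3 : Frac M) / (32 * u) ≤ 1 / (4 * u) := by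
        rw [div_le_div_iff₀ (by positivity) (by positivity)]; linarith
      rw [← topVal] at h1 h2
      rw [abs_le]
      constructor <;> linarith)
  refine ⟨g, hg, hv, L, hL, fun u hu => ?_⟩
  rw [← hdiv u hu]; exact h u hu

/-- The value at a rational point as a coded real. -/
theorem exists_valueAt_code {a b : M.Num} (hab : UnitPoint a b) :
    ∃ v : RealCode M, v.Valid ∧ v.val = p.code.valueAt a b := by
  obtain ⟨g, hg⟩ := UFun₂.repr_right (F := fun M p x w => M.app (p.fn 2) (pair x w)) p (pair a b)
  refine ⟨⟨M.app (p.fn 0) (pair a b), M.app (p.fn 1) (pair a b), g⟩, fun w hw h1 => ?_, ?_⟩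
  · rw [hg]; exact hc.1 a b hab w hw h1
  · rw [RealCode.val, funext hg]; rfl

/-- The modulus for precision `k` itself serves as the required nearness to the point. -/
theorem evalsTo_of_rational {a b : M.Num} (hab : UnitPoint a b) {x v : RealCode M}
    {L : M.Num → Frac M} (hL : x.val.Conv L)
    (hx : ∀ w, IsPow2 w → |L w - (a : Frac M) / b| ≤ 2 / w)
    (hv : v.val = p.code.valueAt a b) : p.code.EvalsTo x v := by
  intro k hk
  obtain ⟨he, hcont⟩ := hc.2 k hk
  have he' : (0 : Frac M) < M.app p.code.modulus k := by
    rwa [← Frac.coe_lt, Frac.coe_zero] at he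
  refine ⟨_, he, fun c d hcd h => ?_⟩
  rw [hv]
  refine hcont c d a b hcd hab ?_
  rw [hL.distLt_iff (Approx.conv_ofRat (by exact hcd.den_pos)) (by exact he')] at h
  obtain ⟨w, hw, h⟩ := h
  rw [QNum.distLt_iff (by exact hcd.den_pos) (by exact hab.den_pos) (by exact he')]
  have h1 := abs_sub_le ((c : Frac M) / d) (L w) (a / b)
  rw [abs_sub_comm _ (L w)] at h1
  rw [QNum.val_frac] at h
  rw [QNum.val_frac, QNum.val_frac]
  linarith [hx w hw]

/-- If `f(x)` exceeded `y`, so would the value at a rational point close enough to `x`, against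
`valL_le_topVal`. Conversely the top grid points are themselves coded points of `[0, 1]`, so every
upper bound lies above their values and hence above `y`. -/
theorem isSupremum {y : RealCode M} {L : M.Num → Frac M} (hL : y.val.Conv L)
    (h : ∀ u, IsPow2 u → topVal p u - 3 / (2 * u) < L u ∧ L u ≤ topVal p u - 1 / (2 * u)) :
    p.code.IsSupremum y := by
  constructor
  · intro x hx hxu v hv hxv
    obtain ⟨Lx, hLx⟩ := hx.exists_conv
    obtain ⟨Lv, hLv⟩ := hv.exists_conv
    rw [hLv.le_iff hL]
    intro w hw
    by_contra hn
    have hw0 := hw.pos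
    have hgap := sub_pos.2 (not_le.1 hn)
    obtain ⟨k, hk, hk1⟩ := exists_isPow2_gt (1 / (Lv w - (L w + 2 / (w : Frac M))))
    have hk0 := hk.pos
    have hk2 : 1 / (k : Frac M) < Lv w - (L w + 2 / w) := by
      rw [div_lt_iff₀ hgap] at hk1
      rw [div_lt_iff₀ hk0]; linarith
    obtain ⟨e, he, hev⟩ := hxv k (Frac.coe_lt.1 (by rwa [Frac.coe_zero]))
    have he' : (0 : Frac M) < e := by rwa [← Frac.coe_lt, Frac.coe_zero] at he
    obtain ⟨a, b, hab, hd⟩ := hLx.exists_unitPoint (hxu.bounds hLx) he'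
    have h1 := ((conv_valueAt hc hab).lt_of_distLt hLv (r := QNum.frac 1 k) (by exact hk0)
      (hev a b hab hd) hw.scale hw).2
    have h2 := valL_le_topVal hc hab hw hw.scale
    have h3 := (h w hw).1
    rw [coe_scale, QNum.val_frac, Frac.coe_one] at h1
    have e1 : (3 : Frac M) / (16 * w) + 3 / (2 * w) + 2 / (16 * w) ≤ 2 / w := by
      rw [← sub_nonneg]
      have : 2 / (w : Frac M) - (3 / (16 * w) + 3 / (2 * w) + 2 / (16 * w)) = 3 / (16 * w) := by
        field_simp; norm_num
      rw [this]; positivity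
    linarith
  · intro z hz hub
    obtain ⟨Lz, hLz⟩ := hz.exists_conv
    rw [hL.le_iff hLz]
    intro w hw
    have hw0 := hw.pos
    have hab := unitPoint_topPoint (p := p) w
    obtain ⟨x, hx, hxu, Lx, hLx, hxd⟩ := hab.exists_realCode
    obtain ⟨v, hv, hveq⟩ := exists_valueAt_code hc hab
    have h1 := hub x hx hxu v hv (evalsTo_of_rational hc hab hLx hxd hveq)
    rw [hveq, (conv_valueAt hc hab).le_iff hLz] at h1
    have h2 := h1 _ hw.scale
    have h3 := (hLz.mono w _ hw hw.scale (by rw [coe_scale]; linarith)).2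
    have h4 := (h w hw).2
    have e1 : (0 : Frac M) < 1 / (2 * w) := by positivity
    rw [← topVal] at h2
    linarith

end Sup

/-! ### The formulas that compute the supremum. -/

section Formulas

/-- An assignment agrees with the code of `f` only on the first four function variables, so the
construction must not depend on other parameters. -/
theorem floorSeq_congr {M : BaseStructure.{u}} {p q : Par M} (h : p.code = q.code) :
    floorSeq topP topN supNeg M p = floorSeq topP topN supNeg M q ∧
      supNeg M p = supNeg M q := by
  simp only [Par.code, FunCode.mk.injEq] at h
  obtain ⟨h0, h1, h2, h3⟩ := h
  have h4 : supNeg M p = supNeg M q := by simp only [supNeg, h1]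
  have hg : grid M p = grid M q := by funext u; simp only [grid, argMax, h3]
  have hs : valSum M p = valSum M q := by
    funext x w; simp only [valSum, digSum, recFun, h2]
  have hP : gridP M p = gridP M q := by funext u l; simp only [gridP, valP, hg, hs, h0]
  have hN : gridN M p = gridN M q := by funext u l; simp only [gridN, valN, hg, h1]
  have ht : topPoint M p = topPoint M q := by
    funext u; simp only [topPoint, argMax, hP, hN, hg]
  exact ⟨by funext u; simp only [floorSeq, topP, topN, hP, hN, ht, h4], h4⟩

theorem limDig_congr {M : BaseStructure.{u}} {p q : Par M} (h : p.code = q.code) :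
    limDig topP topN supNeg M p = limDig topP topN supNeg M q := by
  funext n
  simp only [limDig, floorSeq_congr h]

theorem exists_computesSupremum : ∃ φp φm φd : BForm,
    ∀ M : BaseStructure.{u}, BaseSystem M → ComputesSupremum M φp φm φd := by
  obtain ⟨φp, hp⟩ :=
    (inferInstance : Def.{u} fun M p z => z = floorSeq topP topN supNeg M p 1).out
  obtain ⟨φm, hm⟩ := (inferInstance : Def.{u} fun M p z => z = supNeg M p).out
  obtain ⟨φd, hd⟩ := Def.toDef2.{u} fun M p z n => z = limDig topP topN supNeg M p n
  beta_reduce at hp hm hd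
  refine ⟨φp, φm, φd, fun M hM f hf => ?_⟩
  have : Fact (BaseSystem M) := ⟨hM⟩
  let q : Par M := ⟨fun i => if i = 0 then f.valPos else if i = 1 then f.valNeg else
    if i = 2 then f.valDig else f.modulus, fun _ => 0⟩
  have hq : q.code = f := rfl
  have hc : q.code.Continuous := hf
  obtain ⟨g, hg, hv, L, hL, h⟩ := exists_sup hc
  refine ⟨_, hv, isSupremum hc hL h, fun e h0 h1 h2 h3 => ?_⟩
  have he : e.par.code = q.code := by
    rw [hq, Par.code, ← show _ = f from congr (congr (congr (congrArg FunCode.mk h0) h1) h2) h3]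
    rfl
  refine ⟨fun z => ?_, fun z => ?_, fun n z => ?_⟩
  · rw [hp M hM, Val.setNum_par _ (by decide), Val.setNum_num_self, (floorSeq_congr he).1]
  · rw [hm M hM, Val.setNum_par _ (by decide), Val.setNum_num_self, (floorSeq_congr he).2]
  · rw [hd M hM, Val.setNum_par _ (by decide), Val.setNum_par _ (by decide),
      Val.setNum_num_self, Val.setNum_num_ne _ (by decide), Val.setNum_num_self, limDig_congr he, hg]

end Formulas

/-! ### Values of continuous functions at real points -/

section Value

theorem Approx.Conv.unique {M : BaseStructure.{u}} [hM : Fact (BaseSystem M)] {X : Approx M}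
    {L K : M.Num → Frac M} (hL : X.Conv L) (hK : X.Conv K) {w : M.Num} (hw : IsPow2 w) :
    L w = K w := by
  obtain ⟨a, ha⟩ := hL.ex w hw
  rw [← (hL.val w a hw ha).2, (hK.val w a hw ha).2]

/-- The digit sums of the real that is coded by the parameters. -/
noncomputable def argSum (M : BaseStructure.{u}) (p : Par M) (w : M.Num) : M.Num :=
  digSum (fun M p _ w => M.app (p.fn 4) w) M p 0 w

instance : UFun₂.{u} fun M p _ w => M.app (p.fn 4) w := ⟨inferInstance⟩

instance : UFun₁ argSum.{u} := ⟨by unfold argSum; infer_instance⟩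

/-- Denominator and numerator of a rational point close to the coded real. -/
noncomputable def argDen (M : BaseStructure.{u}) (p : Par M) (u : M.Num) : M.Num :=
  (1 + 1) * ((1 + 1) * ((1 + 1) * grid M p u))

instance : UFun₁ argDen.{u} := ⟨by unfold argDen; infer_instance⟩

noncomputable def argNum (M : BaseStructure.{u}) (p : Par M) (u : M.Num) : M.Num :=
  mu (argDen M p u) fun t =>
    p.num 0 * argDen M p u + argSum M p (argDen M p u) ≤ t + p.num 1 * argDen M p u

instance : UFun₁ argNum.{u} := ⟨by unfold argNum; infer_instance⟩

noncomputable def argValP (M : BaseStructure.{u}) (p : Par M) (u : M.Num) : M.Num :=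
  valP M p (pair (argNum M p u) (argDen M p u)) (scale u)

noncomputable def argValN (M : BaseStructure.{u}) (p : Par M) (u : M.Num) : M.Num :=
  valN M p (pair (argNum M p u) (argDen M p u)) (scale u)

instance : UFun₁ argValP.{u} := ⟨by unfold argValP; infer_instance⟩
instance : UFun₁ argValN.{u} := ⟨by unfold argValN; infer_instance⟩

noncomputable def argNeg (M : BaseStructure.{u}) (p : Par M) : M.Num :=
  M.app (p.fn 1) (pair (argNum M p 1) (argDen M p 1)) + 1

instance : UFun.{u} fun M p _ => argNeg M p := by unfold argNeg; infer_instance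

variable {M : BaseStructure.{u}} [hM : Fact (BaseSystem M)] {p : Par M}

theorem coe_argDen (u : M.Num) : (argDen M p u : Frac M) = 8 * grid M p u := by
  rw [argDen]; push_cast; ring

theorem isPow2_argDen (u : M.Num) : IsPow2 (argDen M p u) := (isPow2_grid u).double.double.double

theorem valL_ge (x w : M.Num) : -(M.app (p.fn 1) x : Frac M) ≤ valL p x w := by
  rw [valL]
  have := Frac.coe_nonneg (M.app (p.fn 0) x)
  have := div_nonneg (Frac.coe_nonneg (valSum M p x w)) (Frac.coe_nonneg w)
  linarith

/-- The real that is coded by the parameters. -/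
def Par.arg (p : Par M) : RealCode M := ⟨p.num 0, p.num 1, p.fn 4⟩

variable (hx : p.arg.Valid)
include hx

theorem conv_arg : p.arg.val.Conv fun w => (p.num 0 : Frac M) - p.num 1 + argSum M p w / w :=
  (isDigSum_digSum (δ := fun M p _ w => M.app (p.fn 4) w) (x := 0)
    fun _ hu => hx _ hu.double hu.one_lt_double).conv _ _

variable {L : M.Num → Frac M} (hL : p.arg.val.Conv L)
  (hb : ∀ w, IsPow2 w → -(2 / w) ≤ L w ∧ L w ≤ 1 + 2 / w)
include hL hb

/-- The least admissible numerator is the approximation with denominator `argDen` cut off to `[0,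
1]`: truncation at `0` is automatic, and a failing search returns the denominator, hence the point
`1`. Cutting off moves the point by at most the `2 / w` of `hb`. -/
theorem argNum_spec (u : M.Num) : UnitPoint (argNum M p u) (argDen M p u) ∧
    |(argNum M p u : Frac M) / argDen M p u - L (argDen M p u)| ≤ 2 / argDen M p u := by
  have hw := isPow2_argDen (p := p) u
  have hw0 := hw.pos
  have h1 := mu_spec (fun M p u t =>
    p.num 0 * argDen M p u + argSum M p (argDen M p u) ≤ t + p.num 1 * argDen M p u) p
    (argDen M p u) u
  obtain ⟨h2, h3⟩ := hb _ hw
  rw [(conv_arg hx).unique hL hw |>.symm] at h2 h3 ⊢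
  change IsMu _ _ (argNum M p u) at h1
  refine ⟨⟨Frac.coe_lt.1 (by rwa [Frac.coe_zero]), h1.le⟩, ?_⟩
  set w := argDen M p u
  set t := argNum M p u
  have e1 : (t : Frac M) / w - (p.num 0 - p.num 1 + argSum M p w / w) =
      (t - (p.num 0 * w + argSum M p w - p.num 1 * w)) / w := by field_simp; ring
  have e2 : (p.num 0 - p.num 1 + argSum M p w / w : Frac M) =
      (p.num 0 * w + argSum M p w - p.num 1 * w) / w := by field_simp; ring
  have e3 : (1 : Frac M) + 2 / w = (w + 2) / w := by field_simp
  rw [e2, e3, div_le_div_iff_of_pos_right hw0] at h3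
  rw [e2, ← neg_div, div_le_div_iff_of_pos_right hw0] at h2
  rw [e1, abs_div, abs_of_pos hw0, div_le_div_iff_of_pos_right hw0, abs_le]
  rcases h1 with ⟨h4, h5, h6⟩ | ⟨h4, h5⟩
  · rw [← Frac.coe_le] at h5
    push_cast at h5
    refine ⟨by linarith, ?_⟩
    rcases (Frac.coe_nonneg t).eq_or_lt with h7 | h7
    · linarith
    · obtain ⟨z, hz⟩ := Frac.exists_sub (x := 1) (y := t) (by
        rw [Frac.coe_one]; exact Frac.one_le_coe h7)
      rw [Frac.coe_one] at hz
      have h8 := h6 z (Frac.coe_lt.1 (by linarith))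
      beta_reduce at h8
      rw [← Frac.coe_le] at h8
      push_cast at h8
      linarith
  · rw [h4]
    refine ⟨by linarith, ?_⟩
    obtain ⟨z, hz⟩ := Frac.exists_sub (x := 1) (y := w) (by rw [Frac.coe_one]; exact hw.one_le)
    rw [Frac.coe_one] at hz
    have h8 := h5 z (Frac.coe_lt.1 (by linarith))
    beta_reduce at h8
    rw [← Frac.coe_le] at h8
    push_cast at h8
    linarith

/-- Both rational points and both approximations of the real together deviate by at most `6 /
argDen`. The factor `8` in `argDen` brings this below the mesh of the grid. -/
theorem abs_argNum_sub_le {u v : M.Num} (h : (u : Frac M) ≤ v) :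
    |(argNum M p u : Frac M) / argDen M p u - argNum M p v / argDen M p v| ≤ 1 / grid M p u := by
  have h1 := abs_le.1 (argNum_spec hx hL hb u).2
  have h2 := abs_le.1 (argNum_spec hx hL hb v).2
  have h3 := grid_mono (p := p) h
  have hg := (isPow2_grid (p := p) u).pos
  have hle : (argDen M p u : Frac M) ≤ argDen M p v := by rw [coe_argDen, coe_argDen]; linarith
  have h4 := hL.mono _ _ (isPow2_argDen (p := p) u) (isPow2_argDen (p := p) v) hle
  have h5 : (2 : Frac M) / argDen M p v ≤ 2 / argDen M p u :=
    div_le_div_of_nonneg_left zero_le_two (isPow2_argDen (p := p) u).pos hle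
  have h6 : (2 : Frac M) / argDen M p u + 2 / argDen M p u + 2 / argDen M p u ≤
      1 / grid M p u := by
    rw [coe_argDen, ← add_div, ← add_div, div_le_div_iff₀ (by positivity) hg]
    linarith
  have h7 : (0 : Frac M) < 2 / argDen M p v := div_pos two_pos (isPow2_argDen (p := p) v).pos
  rw [abs_le]
  constructor <;> linarith

variable (hc : p.code.Continuous)
include hc

/-- The values at the rational points `argNum / argDen` are close enough together for
`exists_limit`, and their limit is `f(x)`. The bound from below by the value at stage `1` explains
`argNeg`. -/
theorem exists_evalsTo_arg : ∃ y : RealCode M, y.Valid ∧ p.code.EvalsTo p.arg y := by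
  set T : M.Num → Frac M := fun u => valL p (pair (argNum M p u) (argDen M p u)) (scale u) with hT
  have hpt : ∀ u, UnitPoint (argNum M p u) (argDen M p u) := fun u => (argNum_spec hx hL hb u).1
  have hPN : ∀ u, IsPow2 u → ((argValP M p u : Frac M) - argValN M p u) = T u * (16 * u) := by
    intro u hu
    rw [argValP, argValN, valP_sub_valN _ hu.scale.pos, coe_scale]
  have hdiv : ∀ u, IsPow2 u → ((argValP M p u : Frac M) - argValN M p u) / (16 * u) = T u := by
    intro u hu
    have := hu.pos
    rw [hPN u hu]; field_simp
  obtain ⟨g, -, hv, K, hK, h⟩ := exists_limit (P := argValP) (Q := argValN) (ν := argNeg) (M := M)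
    (p := p)
    (fun u hu => by
      have hu1 := hu.one_le
      have h1 := (valL_lt_of_grid hc (hpt 1) (hpt u) .one
        (abs_argNum_sub_le hx hL hb (by rw [Frac.coe_one]; exact hu1)) (IsPow2.one).scale hu.scale).1
      have h2 := valL_ge (p := p) (pair (argNum M p 1) (argDen M p 1)) (scale 1)
      have h3 := hPN u hu
      have h4 : (argNeg M p : Frac M) = M.app (p.fn 1) (pair (argNum M p 1) (argDen M p 1)) + 1 := by
        rw [argNeg]; push_cast; rfl
      rw [Frac.coe_one, coe_scale u] at h1
      have h5 : (-(argNeg M p : Frac M) + 1 - 2 / (16 * u) - 1 / 16) * (16 * u) ≤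
          T u * (16 * u) := by
        apply mul_le_mul_of_nonneg_right _ (by positivity); simp only [hT]; linarith
      have h6 : (2 : Frac M) / (16 * u) * (16 * u) = 2 := by field_simp
      rw [sub_mul, sub_mul, h6] at h5
      linarith)
    (fun u hu => by
      have hu0 := hu.pos
      have e1 : (32 : Frac M) * u = 16 * ((1 + 1) * u : M.Num) := by push_cast; ring
      rw [e1, hdiv u hu, hdiv _ hu.double]
      have h1 := valL_lt_of_grid hc (hpt u) (hpt ((1 + 1) * u)) hu
        (abs_argNum_sub_le hx hL hb (by push_cast; linarith)) hu.scale hu.double.scale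
      rw [coe_scale, coe_scale, ← e1] at h1
      have e2 : (2 : Frac M) / (16 * u) + 1 / (16 * u) ≤ 1 / (4 * u) := by
        rw [← add_div, div_le_div_iff₀ (by positivity) (by positivity)]; linarith
      have e3 : (2 : Frac M) / (32 * u) + 1 / (16 * u) ≤ 1 / (4 * u) := by
        rw [div_add_div _ _ (by positivity) (by positivity),
          div_le_div_iff₀ (by positivity) (by positivity)]
        nlinarith [mul_pos hu0 hu0, mul_pos (mul_pos hu0 hu0) hu0]
      simp only [hT]
      rw [abs_le]
      constructor <;> linarith)
  refine ⟨_, hv, fun k hk => ?_⟩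
  rw [← Frac.coe_lt, Frac.coe_zero] at hk
  have hk2 : (0 : Frac M) < ((1 + 1) * k : M.Num) := by push_cast; linarith
  have hm := modulus_pos hc hk2
  -- Precision `2 k` leaves half of `1 / k` for passing to the limit. Twice the modulus leaves half
  -- of the permitted distance for the gap between `x` and its rational approximation.
  refine ⟨(1 + 1) * M.app (p.fn 3) ((1 + 1) * k), Frac.coe_lt.1 (by push_cast; linarith),
    fun a b hab hd => ?_⟩
  set e : M.Num := (1 + 1) * M.app (p.fn 3) ((1 + 1) * k) with he
  have he2 : (e : Frac M) = 2 * M.app (p.fn 3) ((1 + 1) * k) := by rw [he]; push_cast; ring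
  have he0 : (0 : Frac M) < e := by rw [he2]; linarith
  -- The summand `e` makes the point at stage `u` close to `x`, since `argDen` exceeds `8 u`; the
  -- summand `12 k` yields `11 / (2 u) < 1 / (2 k)` for the errors of the values.
  obtain ⟨u, hu, hlt⟩ := exists_isPow2_gt (M := M) (e + 12 * k)
  have hu0 := hu.pos
  have hw0 := (isPow2_argDen (p := p) u).pos
  have h1 := hL.lt_of_distLt (Approx.conv_ofRat (q := QNum.frac a b) (by exact hab.den_pos))
    (r := QNum.frac 1 e) (by exact he0) hd (isPow2_argDen (p := p) u) (isPow2_argDen (p := p) u)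
  rw [QNum.val_frac, QNum.val_frac, Frac.coe_one] at h1
  have h2 := abs_le.1 (argNum_spec hx hL hb u).2
  have h3 : (2 : Frac M) / argDen M p u + 2 / argDen M p u < 1 / e := by
    have := modulus_add_lt_grid (p := p) (k := 0) (u := u) (hM.out.basic.zero_le _)
    have := Frac.coe_nonneg (M.app (p.fn 3) 0)
    rw [← add_div, div_lt_div_iff₀ hw0 he0, coe_argDen]
    linarith
  have h4 : (1 : Frac M) / M.app (p.fn 3) ((1 + 1) * k) = 1 / e + 1 / e := by
    rw [he2]; field_simp; norm_num
  have h5 := valL_lt hc hab (hpt u) hk2 (by rw [abs_lt, h4]; constructor <;> linarith) hu hu.scale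
  rw [(conv_valueAt hc hab).distLt_iff hK (by exact hk)]
  refine ⟨u, hu, ?_⟩
  have h6 := h u hu
  rw [hdiv u hu] at h6
  rw [QNum.val_frac, Frac.coe_one]
  have h7 : (1 : Frac M) / ((1 + 1) * k : M.Num) = 1 / (2 * k) := by
    push_cast; rw [one_add_one_eq_two]
  rw [coe_scale, h7] at h5
  have h8 : (2 : Frac M) / u + 3 / (2 * u) + 2 / u < 1 / (2 * k) := by
    have : (2 : Frac M) / u + 3 / (2 * u) + 2 / u = 11 / (2 * u) := by field_simp; norm_num
    rw [this, div_lt_div_iff₀ (by positivity) (by positivity)]; linarith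
  have h9 : (1 : Frac M) / k = 1 / (2 * k) + 1 / (2 * k) := by field_simp; norm_num
  have h10 : (2 : Frac M) / (16 * u) ≤ 2 / u :=
    div_le_div_of_nonneg_left zero_le_two hu0 (by linarith)
  have h11 : (0 : Frac M) < 1 / (2 * u) := by positivity
  have h12 : (0 : Frac M) < 3 / (2 * u) := by positivity
  have h13 : |valL p (pair a b) u - K u| < 1 / k - 2 / u := by
    rw [h9, abs_lt]
    simp only [hT] at h6
    constructor <;> linarith
  linarith

end Value

theorem FunCode.Continuous.exists_evalsTo {M : BaseStructure.{u}} [hM : Fact (BaseSystem M)]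
    {f : FunCode M} (hf : f.Continuous) {x : RealCode M} (hx : x.Valid) {L : M.Num → Frac M}
    (hL : x.val.Conv L) (hb : ∀ w, IsPow2 w → -(2 / w) ≤ L w ∧ L w ≤ 1 + 2 / w) :
    ∃ y : RealCode M, y.Valid ∧ f.EvalsTo x y :=
  exists_evalsTo_arg (p := ⟨fun i => if i = 0 then f.valPos else if i = 1 then f.valNeg else
    if i = 2 then f.valDig else if i = 3 then f.modulus else x.dig,
    fun i => if i = 0 then x.pos else x.neg⟩) hx hL hb hf

/-! ### Nested intervals with a change of sign -/

section Nested

/-- The number of grid points at the stage `u`; the parameter `p.num 0` is the initial precision. -/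
noncomputable def ivGrid (M : BaseStructure.{u}) (p : Par M) (u : M.Num) : M.Num :=
  grid M p (p.num 0 * u)

noncomputable def ivP (M : BaseStructure.{u}) (p : Par M) (u l : M.Num) : M.Num :=
  gridP M p (p.num 0 * u) l

noncomputable def ivN (M : BaseStructure.{u}) (p : Par M) (u l : M.Num) : M.Num :=
  gridN M p (p.num 0 * u) l

instance : UFun₁ ivGrid.{u} := ⟨by unfold ivGrid; infer_instance⟩
instance : UFun₂ ivP.{u} := ⟨by unfold ivP; infer_instance⟩
instance : UFun₂ ivN.{u} := ⟨by unfold ivN; infer_instance⟩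

/-- The value at the `l`-th grid point is clearly negative, or clearly positive. -/
def IsNeg (M : BaseStructure.{u}) (p : Par M) (u l : M.Num) : Prop :=
  ivP M p u l + ((1 + 1) * ((1 + 1) * (1 + 1)) + 1) ≤ ivN M p u l

def IsPos (M : BaseStructure.{u}) (p : Par M) (u l : M.Num) : Prop :=
  ivN M p u l + ((1 + 1) * ((1 + 1) * (1 + 1)) + 1) ≤ ivP M p u l

instance Def.isNeg {A B : ∀ M : BaseStructure.{u}, Par M → M.Num → M.Num} [UFun A] [UFun B] :
    Def fun M p x => IsNeg M p (A M p x) (B M p x) := by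
  unfold IsNeg; infer_instance

instance Def.isPos {A B : ∀ M : BaseStructure.{u}, Par M → M.Num → M.Num} [UFun A] [UFun B] :
    Def fun M p x => IsPos M p (A M p x) (B M p x) := by
  unfold IsPos; infer_instance

/-- The interval `[i', j']` of the stage `2 u` is a change of sign inside the interval `[i, j]` of
the stage `u`. -/
def IvStep (M : BaseStructure.{u}) (p : Par M) (u i j i' j' : M.Num) : Prop :=
  i * ivGrid M p ((1 + 1) * u) < i' * ivGrid M p u ∧ i' < j' ∧
    j' * ivGrid M p u < j * ivGrid M p ((1 + 1) * u) ∧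
    IsNeg M p ((1 + 1) * u) i' ∧ IsPos M p ((1 + 1) * u) j' ∧
    ∀ l, l < j' → i' < l → ¬ IsNeg M p ((1 + 1) * u) l ∧ ¬ IsPos M p ((1 + 1) * u) l

noncomputable def ivNext (M : BaseStructure.{u}) (p : Par M) (_ u y : M.Num) : M.Num :=
  mu (pair (ivGrid M p ((1 + 1) * u)) (ivGrid M p ((1 + 1) * u)) + 1) fun y' =>
    IvStep M p u (fst y) (snd y) (fst y') (snd y')

instance : UFun₃ ivNext.{u} := ⟨by unfold ivNext IvStep; infer_instance⟩

noncomputable def ivStart (M : BaseStructure.{u}) (p : Par M) (_ : M.Num) : M.Num :=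
  pair 0 (ivGrid M p 1)

noncomputable def ivBound (M : BaseStructure.{u}) (p : Par M) (_ u : M.Num) : M.Num :=
  -- The summand `1` makes room for the default value of the search in `ivNext`, because the
  -- recursion asks for the bound at every `y`, also where no step exists.
  pair (ivGrid M p u) (ivGrid M p u) + 1

instance : UFun₁ ivStart.{u} := ⟨by unfold ivStart; infer_instance⟩
instance : UFun₂ ivBound.{u} := ⟨by unfold ivBound; infer_instance⟩

/-- The left and the right end point of the interval of the stage `u`. -/
noncomputable def ivLo (M : BaseStructure.{u}) (p : Par M) (u : M.Num) : M.Num :=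
  fst (recFun ivNext ivStart ivBound M p 0 u)

noncomputable def ivHi (M : BaseStructure.{u}) (p : Par M) (u : M.Num) : M.Num :=
  snd (recFun ivNext ivStart ivBound M p 0 u)

instance : UFun₁ ivLo.{u} := ⟨by unfold ivLo; infer_instance⟩
instance : UFun₁ ivHi.{u} := ⟨by unfold ivHi; infer_instance⟩

variable {M : BaseStructure.{u}} [hM : Fact (BaseSystem M)] {p : Par M}

/-- The scaled value at a grid point. -/
noncomputable def ivVal (p : Par M) (u l : M.Num) : Frac M := (ivP M p u l : Frac M) - ivN M p u l

theorem isNeg_iff {u l : M.Num} : IsNeg M p u l ↔ ivVal p u l ≤ -9 := by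
  rw [IsNeg, ← Frac.coe_le, ivVal]
  push_cast
  constructor <;> intro h <;> linarith

theorem isPos_iff {u l : M.Num} : IsPos M p u l ↔ 9 ≤ ivVal p u l := by
  rw [IsPos, ← Frac.coe_le, ivVal]
  push_cast
  constructor <;> intro h <;> linarith

theorem unitPoint_ivGrid {u l : M.Num} (h : l ≤ ivGrid M p u) : UnitPoint l (ivGrid M p u) :=
  ⟨Frac.coe_lt.1 (by rw [Frac.coe_zero]; exact (isPow2_grid _).pos), h⟩

theorem isPow2_ivGrid (u : M.Num) : IsPow2 (ivGrid M p u) := isPow2_grid _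

theorem ivGrid_mono {u v : M.Num} (h : (u : Frac M) ≤ v) : (ivGrid M p u : Frac M) ≤ ivGrid M p v :=
  grid_mono (by push_cast; exact mul_le_mul_of_nonneg_left h (Frac.coe_nonneg _))

variable (hκ : IsPow2 (p.num 0))
include hκ

theorem ivVal_eq {u : M.Num} (hu : IsPow2 u) (l : M.Num) :
    ivVal p u l = valL p (pair l (ivGrid M p u)) (scale (p.num 0 * u)) * (16 * (p.num 0 * u)) := by
  rw [ivVal, ivP, ivN, gridP_sub_gridN (hκ.mul hu), ivGrid]; push_cast; rfl

section

variable (hc : p.code.Continuous)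
include hc

theorem valL_lt_ivVal {u l a b w : M.Num} (hu : IsPow2 u) (hl : l ≤ ivGrid M p u)
    (hab : UnitPoint a b) (h : |(a : Frac M) / b - l / ivGrid M p u| ≤ 1 / ivGrid M p u)
    (hw : IsPow2 w) :
    valL p (pair a b) w * (16 * (p.num 0 * u)) < ivVal p u l + 3 ∧
      ivVal p u l < (valL p (pair a b) w + 2 / w) * (16 * (p.num 0 * u)) + 1 := by
  have hku := hκ.mul hu
  have h0 : (0 : Frac M) < 16 * (p.num 0 * u) := by
    have := hku.pos; push_cast at this; positivity
  obtain ⟨h1, h2⟩ := valL_lt_of_grid hc hab (unitPoint_ivGrid hl) hku h hw hku.scale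
  rw [coe_scale, Frac.coe_mul] at h1
  rw [Frac.coe_mul] at h2
  rw [ivVal_eq hκ hu]
  have h3 := mul_lt_mul_of_pos_right h1 h0
  have h4 := mul_lt_mul_of_pos_right h2 h0
  have e1 : (1 : Frac M) / (16 * (p.num 0 * u)) * (16 * (p.num 0 * u)) = 1 := div_mul_cancel₀ _ h0.ne'
  have e2 : (2 : Frac M) / (16 * (p.num 0 * u)) * (16 * (p.num 0 * u)) = 2 := div_mul_cancel₀ _ h0.ne'
  rw [add_mul, add_mul, e1, e2] at h3
  rw [add_mul, e1] at h4
  constructor <;> linarith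

/-- In the unit of stage `u` the modulus contributes `1` and the precision of the computed value
`2`. -/
theorem ivVal_succ {u l : M.Num} (hu : IsPow2 u) (hl : l + 1 ≤ ivGrid M p u) :
    ivVal p u (l + 1) < ivVal p u l + 3 ∧ ivVal p u l < ivVal p u (l + 1) + 3 := by
  have hN := (isPow2_ivGrid (p := p) u).pos
  have hl' : l ≤ ivGrid M p u := by
    rw [← Frac.coe_le] at hl ⊢; push_cast at hl; linarith
  have hd : ((l + 1 : M.Num) : Frac M) / ivGrid M p u - l / ivGrid M p u = 1 / ivGrid M p u := by
    push_cast; field_simp; ring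
  have hpos : (0 : Frac M) ≤ 1 / ivGrid M p u := by positivity
  have h1 := (valL_lt_ivVal hκ hc hu hl' (unitPoint_ivGrid hl) (by rw [hd, abs_of_nonneg hpos])
    (hκ.mul hu).scale).1
  have h2 := (valL_lt_ivVal hκ hc hu hl (unitPoint_ivGrid hl')
    (by rw [abs_sub_comm, hd, abs_of_nonneg hpos]) (hκ.mul hu).scale).1
  rw [← ivVal_eq hκ hu] at h1 h2
  exact ⟨h1, h2⟩

/-- The unit of measurement is halved from stage `u` to stage `2 u`, so values double up to the
errors. In particular `-9` drops below `-12` and `9` rises above `14`: clear signs become clearer,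
with room for one step on the new grid. -/
theorem ivVal_double {u l l' : M.Num} (hu : IsPow2 u) (hl : l ≤ ivGrid M p u)
    (hl' : l' ≤ ivGrid M p ((1 + 1) * u))
    (h : |(l' : Frac M) / ivGrid M p ((1 + 1) * u) - l / ivGrid M p u| ≤ 1 / ivGrid M p u) :
    ivVal p ((1 + 1) * u) l' < 2 * ivVal p u l + 6 ∧
      2 * ivVal p u l - 4 < ivVal p ((1 + 1) * u) l' := by
  have h0 : (0 : Frac M) < p.num 0 * u := by
    have := (hκ.mul hu).pos; push_cast at this; exact this
  obtain ⟨h1, h2⟩ := valL_lt_ivVal hκ hc hu hl (unitPoint_ivGrid hl') h (hκ.mul hu.double).scale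
  have h3 := ivVal_eq hκ hu.double l'
  set V := valL p (pair l' (ivGrid M p ((1 + 1) * u))) (scale (p.num 0 * ((1 + 1) * u)))
  rw [coe_scale] at h2
  push_cast at h2 h3
  have hk0 := hκ.pos
  have hu0 := hu.pos
  have e : (2 : Frac M) / (16 * (p.num 0 * ((1 + 1) * u))) * (16 * (p.num 0 * u)) = 1 := by
    field_simp; norm_num
  rw [add_mul, e] at h2
  constructor <;> linarith

/-- The old ends are the points `i r` and `j r` of the refined grid. Even one grid step inside them,
at `i r + 1` and `d = j r - 1`, the signs stay clear, so the new interval can be chosen strictly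
inside the old one. -/
theorem exists_ivStep {u i j : M.Num} (hu : IsPow2 u) (hij : i < j) (hj : j ≤ ivGrid M p u)
    (hi' : IsNeg M p u i) (hj' : IsPos M p u j) : ∃ i' j', IvStep M p u i j i' j' := by
  have hu0 := hu.pos
  have hN := (isPow2_ivGrid (p := p) u).pos
  have hN' := (isPow2_ivGrid (p := p) ((1 + 1) * u)).pos
  have hNN : (ivGrid M p u : Frac M) ≤ ivGrid M p ((1 + 1) * u) :=
    ivGrid_mono (by push_cast; linarith)
  obtain ⟨r, hr, hrN⟩ := (isPow2_ivGrid (p := p) u).exists_mul (isPow2_ivGrid _) hNN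
  have hr0 := hr.pos
  have hrN' : (ivGrid M p ((1 + 1) * u) : Frac M) = ivGrid M p u * r := by rw [hrN, Frac.coe_mul]
  have hij1 := Frac.coe_add_one_le (Frac.coe_lt.2 hij)
  have hjN := Frac.coe_le.2 hj
  have hir : ((i : Frac M) + 1) * r ≤ j * r := mul_le_mul_of_nonneg_right hij1 hr0.le
  have hjr : (j : Frac M) * r ≤ ivGrid M p u * r := mul_le_mul_of_nonneg_right hjN hr0.le
  have hi0 := mul_nonneg (Frac.coe_nonneg i) hr0.le
  have hr1 := hr.one_le
  obtain ⟨d, hd⟩ := Frac.exists_sub (x := 1) (y := j * r) (by push_cast; linarith)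
  push_cast at hd
  rw [isNeg_iff] at hi'
  rw [isPos_iff] at hj'
  have hdiv : ∀ x : M.Num, (x : Frac M) / ivGrid M p u = (x * r) / ivGrid M p ((1 + 1) * u) := by
    intro x; rw [hrN']; field_simp
  have hinv : (1 : Frac M) / ivGrid M p ((1 + 1) * u) ≤ 1 / ivGrid M p u :=
    one_div_le_one_div_of_le hN hNN
  have hinv0 : (0 : Frac M) < 1 / ivGrid M p ((1 + 1) * u) := by positivity
  have hiN : i ≤ ivGrid M p u := by rw [← Frac.coe_le]; linarith
  have h1 : ivVal p ((1 + 1) * u) (i * r) < -9 := by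
    have := (ivVal_double hκ hc (l' := i * r) hu hiN (by
      rw [← Frac.coe_le]; push_cast; linarith) (by
      rw [hdiv]; push_cast; rw [sub_self, abs_zero]; positivity)).1
    linarith
  have h2 : ivVal p ((1 + 1) * u) (i * r + 1) < -9 := by
    have := (ivVal_double hκ hc (l' := i * r + 1) hu hiN (by
      rw [← Frac.coe_le]; push_cast; linarith) (by
      rw [hdiv, ← sub_div]; push_cast; rw [add_sub_cancel_left, abs_of_pos hinv0]; exact hinv)).1
    linarith
  have h3 : 9 < ivVal p ((1 + 1) * u) d := by
    have := (ivVal_double hκ hc (l' := d) hu hj (by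
      rw [← Frac.coe_le]; linarith) (by
      rw [hdiv, ← sub_div, hd, sub_add_cancel_right, neg_div, abs_neg, abs_of_pos hinv0]
      exact hinv)).2
    linarith
  have h4 : (i * r : Frac M) < d := by
    refine lt_of_le_of_ne (by linarith) fun h => ?_
    have : i * r = d := by rw [← Frac.coe_inj (M := M)]; push_cast; exact h
    rw [this] at h1; linarith
  -- The right end is the first clearly positive point after `i r`; it does not exceed `d`.
  obtain ⟨b, ⟨hb1, hb2⟩, hb3⟩ := Def.exists_least₂
    (fun M p c b => snd c < b ∧ IsPos M p (fst c) b) p (pair ((1 + 1) * u) (i * r)) ⟨d, by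
      simp only [fst_pair, snd_pair]
      exact ⟨by rw [← Frac.coe_lt]; push_cast; exact h4, isPos_iff.2 h3.le⟩⟩
  simp only [fst_pair, snd_pair] at hb1 hb2 hb3
  have hbd : (b : Frac M) ≤ d := by
    by_contra hn
    exact hb3 d (Frac.coe_lt.1 (not_le.1 hn))
      ⟨by rw [← Frac.coe_lt]; push_cast; exact h4, isPos_iff.2 h3.le⟩
  have h5 : (i * r + 1 : Frac M) < b := by
    rw [← Frac.coe_lt] at hb1
    have h6 := Frac.coe_add_one_le hb1
    push_cast at h6
    refine lt_of_le_of_ne h6 fun h => ?_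
    have : i * r + 1 = b := by rw [← Frac.coe_inj (M := M)]; push_cast; exact h
    rw [isPos_iff, ← this] at hb2; linarith
  obtain ⟨t₀, ht₀⟩ := Frac.exists_sub (x := i * r + 1) (y := b) (by push_cast; exact h5.le)
  push_cast at ht₀
  have ht₀' : (∃ a, a < b ∧ (a + t₀ = b ∧ IsNeg M p ((1 + 1) * u) a)) :=
    ⟨i * r + 1, by rw [← Frac.coe_lt]; push_cast; exact h5, by
      rw [← Frac.coe_inj (M := M)]; push_cast; exact ht₀.symm, isNeg_iff.2 h2.le⟩
  -- The last clearly negative point before `b` is found by minimizing its distance `t` from `b`. It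
  -- is not to the left of `i r + 1`, as that point is a candidate.
  obtain ⟨t, ht, htl⟩ := Def.exists_least₂
    (fun M p c t => ∃ a, a < snd c ∧ (a + t = snd c ∧ IsNeg M p (fst c) a)) p
    (pair ((1 + 1) * u) b) ⟨t₀, by simp only [fst_pair, snd_pair]; exact ht₀'⟩
  simp only [fst_pair, snd_pair] at ht htl
  obtain ⟨a, hab, hat, hneg⟩ := ht
  rw [← Frac.coe_inj (M := M)] at hat
  push_cast at hat
  have htt : (t : Frac M) ≤ t₀ := by
    by_contra hn
    exact htl t₀ (Frac.coe_lt.1 (not_le.1 hn)) ht₀'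
  refine ⟨a, b, ?_, hab, ?_, hneg, hb2, fun l hlb hal => ⟨fun hl => ?_, fun hl => ?_⟩⟩
  · rw [← Frac.coe_lt]; push_cast
    rw [hrN', mul_comm (ivGrid M p u : Frac M), ← mul_assoc]
    exact mul_lt_mul_of_pos_right (by linarith) hN
  · rw [← Frac.coe_lt]; push_cast
    rw [hrN', mul_comm (ivGrid M p u : Frac M) r, ← mul_assoc]
    exact mul_lt_mul_of_pos_right (by linarith) hN
  · rw [← Frac.coe_lt] at hlb hal
    obtain ⟨s, hs⟩ := Frac.exists_sub hlb.le
    exact htl s (by rw [← Frac.coe_lt]; linarith) ⟨l, Frac.coe_lt.1 hlb, by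
      rw [← Frac.coe_inj (M := M)]; push_cast; exact hs.symm, hl⟩
  · rw [← Frac.coe_lt] at hal
    refine hb3 l hlb ⟨?_, hl⟩
    rw [← Frac.coe_lt]; push_cast; linarith

end

end Nested

/-! ### The sequence of nested intervals. -/

section Stages

variable {M : BaseStructure.{u}} [hM : Fact (BaseSystem M)] {p : Par M}

/-- The interval of the stage `u` has a change of sign. -/
def IvInv (M : BaseStructure.{u}) (p : Par M) (u : M.Num) : Prop :=
  ivLo M p u < ivHi M p u ∧ ivHi M p u ≤ ivGrid M p u ∧
    IsNeg M p u (ivLo M p u) ∧ IsPos M p u (ivHi M p u)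

instance : Def IvInv.{u} := by unfold IvInv; infer_instance

theorem ivBound_mono (u v : M.Num) (_ : IsPow2 u) (_ : IsPow2 v) (h : (u : Frac M) ≤ v) :
    (ivBound M p 0 u : Frac M) ≤ ivBound M p 0 v := by
  have h1 := Frac.coe_le.1 (ivGrid_mono (p := p) h)
  have := Frac.coe_le.2 (pair_mono h1 h1)
  rw [ivBound, ivBound]; push_cast; linarith

theorem ivStart_le : ivStart M p 0 ≤ ivBound M p 0 1 := by
  have := pair_mono (hM.out.basic.zero_le (ivGrid M p 1)) (.inr rfl : ivGrid M p 1 ≤ ivGrid M p 1)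
  rw [ivStart, ivBound]
  rw [← Frac.coe_le] at this ⊢; push_cast; linarith

theorem ivNext_spec (u y : M.Num) :
    IsMu (ivBound M p 0 ((1 + 1) * u))
      (fun y' => IvStep M p u (fst y) (snd y) (fst y') (snd y')) (ivNext M p 0 u y) := by
  have := mu_spec (fun M p c y' => IvStep M p (fst c) (fst (snd c)) (snd (snd c)) (fst y') (snd y'))
    (h := by unfold IvStep; infer_instance) p
    (pair (ivGrid M p ((1 + 1) * u)) (ivGrid M p ((1 + 1) * u)) + 1) (pair u y)
  simp only [fst_pair, snd_pair] at this
  exact this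

theorem ivNext_le (u y : M.Num) (_ : IsPow2 u) (_ : y ≤ ivBound M p 0 u) :
    ivNext M p 0 u y ≤ ivBound M p 0 ((1 + 1) * u) := (ivNext_spec u y).le

theorem ivStep_of_inv (hκ : IsPow2 (p.num 0)) (hc : p.code.Continuous) {u : M.Num} (hu : IsPow2 u)
    (h : IvInv M p u) :
    IvStep M p u (ivLo M p u) (ivHi M p u) (ivLo M p ((1 + 1) * u)) (ivHi M p ((1 + 1) * u)) := by
  obtain ⟨h1, h2, h3, h4⟩ := h
  obtain ⟨i', j', hs⟩ := exists_ivStep hκ hc hu h1 h2 h3 h4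
  have h5 := ivNext_spec (p := p) u (recFun ivNext ivStart ivBound M p 0 u)
  rw [ivLo, ivHi, ivLo, ivHi, recFun_double ivBound_mono ivStart_le ivNext_le hu]
  refine h5.of_exists ⟨pair i' j', lt_add_one_iff.2 ?_, ?_⟩
  · obtain ⟨-, h6, h7, -⟩ := hs
    have hN := (isPow2_ivGrid (p := p) u).pos
    have hj : j' ≤ ivGrid M p ((1 + 1) * u) := by
      rw [← Frac.coe_lt] at h7; push_cast at h7
      rw [← Frac.coe_le]
      have h8 := mul_le_mul_of_nonneg_right (Frac.coe_le.2 h2)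
        (Frac.coe_nonneg (ivGrid M p ((1 + 1) * u)))
      have h9 : (j' : Frac M) * ivGrid M p u ≤ ivGrid M p ((1 + 1) * u) * ivGrid M p u := by
        linarith
      exact le_of_mul_le_mul_right h9 hN
    refine pair_mono ?_ hj
    rw [← Frac.coe_lt] at h6
    rw [← Frac.coe_le] at hj ⊢; linarith
  · simp only [fst_pair, snd_pair]; exact hs

variable (hκ : IsPow2 (p.num 0)) (hc : p.code.Continuous) (h0 : IsNeg M p 1 0)
  (h1 : IsPos M p 1 (ivGrid M p 1))
include hκ hc h0 h1

theorem ivInv {u : M.Num} (hu : IsPow2 u) : IvInv M p u := by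
  refine (IsPow2.induction (fun M p u => IvInv M p u) p ?_ ?_ hu)
  · have hN := (isPow2_ivGrid (p := p) 1).pos
    rw [IvInv, ivLo, ivHi, recFun_one ivBound_mono ivStart_le ivNext_le, ivStart, fst_pair, snd_pair]
    exact ⟨Frac.coe_lt.1 (by rwa [Frac.coe_zero]), .inr rfl, h0, h1⟩
  · intro u hu h
    obtain ⟨-, h3, h4, h5, h6, -⟩ := ivStep_of_inv hκ hc hu h
    refine ⟨h3, ?_, h5, h6⟩
    have hN := (isPow2_ivGrid (p := p) u).pos
    rw [← Frac.coe_lt] at h4; push_cast at h4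
    rw [← Frac.coe_le]
    have h8 := mul_le_mul_of_nonneg_right (Frac.coe_le.2 h.2.1)
      (Frac.coe_nonneg (ivGrid M p ((1 + 1) * u)))
    have h9 : (ivHi M p ((1 + 1) * u) : Frac M) * ivGrid M p u ≤
        ivGrid M p ((1 + 1) * u) * ivGrid M p u := by
      linarith
    exact le_of_mul_le_mul_right h9 hN

/-- The end points as rational numbers. -/
noncomputable def ivA (p : Par M) (u : M.Num) : Frac M := (ivLo M p u : Frac M) / ivGrid M p u

noncomputable def ivB (p : Par M) (u : M.Num) : Frac M := (ivHi M p u : Frac M) / ivGrid M p u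

theorem ivA_lt_double {u : M.Num} (hu : IsPow2 u) : ivA p u < ivA p ((1 + 1) * u) := by
  have h := (ivStep_of_inv hκ hc hu (ivInv hκ hc h0 h1 hu)).1
  rw [← Frac.coe_lt] at h; push_cast at h
  rw [ivA, ivA, div_lt_div_iff₀ (isPow2_ivGrid _).pos (isPow2_ivGrid _).pos]
  exact h

theorem ivB_double_lt {u : M.Num} (hu : IsPow2 u) : ivB p ((1 + 1) * u) < ivB p u := by
  have h := (ivStep_of_inv hκ hc hu (ivInv hκ hc h0 h1 hu)).2.2.1
  rw [← Frac.coe_lt] at h; push_cast at h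
  rw [ivB, ivB, div_lt_div_iff₀ (isPow2_ivGrid _).pos (isPow2_ivGrid _).pos]
  exact h

theorem iv_mono {u v : M.Num} (hu : IsPow2 u) (hv : IsPow2 v) (huv : (u : Frac M) ≤ v) :
    ivA p u ≤ ivA p v ∧ ivB p v ≤ ivB p u := by
  have := IsPow2.induction₂ (fun M p u v => u ≤ v →
    ivLo M p u * ivGrid M p v ≤ ivLo M p v * ivGrid M p u ∧
      ivHi M p v * ivGrid M p u ≤ ivHi M p u * ivGrid M p v) p u ?_ ?_ hv (Frac.coe_le.1 huv)
  · rw [← Frac.coe_le, ← Frac.coe_le] at this; push_cast at this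
    rwa [ivA, ivA, ivB, ivB, div_le_div_iff₀ (isPow2_ivGrid _).pos (isPow2_ivGrid _).pos,
      div_le_div_iff₀ (isPow2_ivGrid _).pos (isPow2_ivGrid _).pos]
  · intro hu1
    have : u = 1 := Frac.coe_inj.1 (by
      rw [← Frac.coe_le, Frac.coe_one] at hu1
      rw [Frac.coe_one]; exact le_antisymm hu1 hu.one_le)
    rw [this]
    exact ⟨.inr rfl, .inr rfl⟩
  · intro w hw ih huw
    rw [← Frac.coe_le] at huw
    rcases huw.lt_or_eq with h | h
    · have h2 := hu.two_mul_le hw.double h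
      push_cast at h2
      have h3 := ih (Frac.coe_le.1 (by linarith))
      have h4 := (ivA_lt_double hκ hc h0 h1 hw).le
      have h5 := (ivB_double_lt hκ hc h0 h1 hw).le
      rw [← Frac.coe_le, ← Frac.coe_le] at h3 ⊢; push_cast at h3 ⊢
      rw [← div_le_div_iff₀ (isPow2_ivGrid _).pos (isPow2_ivGrid _).pos,
        ← div_le_div_iff₀ (isPow2_ivGrid _).pos (isPow2_ivGrid _).pos] at h3 ⊢
      exact ⟨h3.1.trans h4, h5.trans h3.2⟩
    · rw [Frac.coe_inj] at h
      rw [h]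
      exact ⟨.inr rfl, .inr rfl⟩

/-- The values on the interval of the stage `2 u` are small. -/
theorem abs_ivVal_le {u l : M.Num} (hu : IsPow2 u) (hl : ivLo M p ((1 + 1) * u) ≤ l)
    (hl' : l ≤ ivHi M p ((1 + 1) * u)) : |ivVal p ((1 + 1) * u) l| ≤ 12 := by
  obtain ⟨-, hlt, -, hneg, hpos, hmid⟩ := ivStep_of_inv hκ hc hu (ivInv hκ hc h0 h1 hu)
  have hN := Frac.coe_le.2 (ivInv hκ hc h0 h1 hu.double).2.1
  set v := (1 + 1) * u with hv
  have hv2 : IsPow2 v := hu.double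
  simp only [isNeg_iff, isPos_iff, not_le] at hneg hpos hmid
  have hmid' : ∀ l : M.Num, (ivLo M p v : Frac M) < l → (l : Frac M) < ivHi M p v →
      -9 < ivVal p v l ∧ ivVal p v l < 9 := fun l h h' =>
    hmid l (Frac.coe_lt.1 h') (Frac.coe_lt.1 h)
  have hlt1 := Frac.coe_add_one_le (Frac.coe_lt.2 hlt)
  -- Interior points have values between `-9` and `9`. An end point differs by less than `3` from
  -- its inner neighbour; this neighbour is interior, since a jump from `-9` to `9` within one grid
  -- step is impossible.
  rw [abs_le]
  rcases (Frac.coe_le.2 hl).eq_or_lt with h2 | h2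
  · rw [Frac.coe_inj] at h2
    have h3 := ivVal_succ hκ hc (l := l) hv2 (by
      rw [← Frac.coe_le, ← h2]; push_cast; linarith)
    rw [← h2] at h3 ⊢
    rcases hlt1.eq_or_lt with h4 | h4
    · have : ivLo M p v + 1 = ivHi M p v := by rw [← Frac.coe_inj (M := M)]; push_cast; exact h4
      rw [this] at h3
      constructor <;> linarith
    · have := hmid' (ivLo M p v + 1) (by push_cast; linarith) (by push_cast; linarith)
      constructor <;> linarith
  rcases (Frac.coe_le.2 hl').eq_or_lt with h5 | h5
  · rw [Frac.coe_inj] at h5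
    obtain ⟨d, hd⟩ := Frac.exists_sub (x := 1) (y := l) (by
      rw [h5]; have := Frac.coe_nonneg (ivLo M p v); push_cast; linarith)
    have hd' : d + 1 = l := by rw [← Frac.coe_inj (M := M)]; push_cast at hd ⊢; linarith
    push_cast at hd
    have h3 := ivVal_succ hκ hc (l := d) hv2 (by rw [hd', h5, ← Frac.coe_le]; exact hN)
    rw [hd', h5] at h3
    rw [h5] at h2 hd ⊢
    rcases hlt1.eq_or_lt with h4 | h4
    · have : d = ivLo M p v := by rw [← Frac.coe_inj (M := M)]; linarith
      rw [this] at h3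
      constructor <;> linarith
    · have := hmid' d (by linarith) (by linarith)
      constructor <;> linarith
  · have := hmid' l h2 h5
    constructor <;> linarith

/-- A rational point of the interval lies within the mesh to the right of a grid point of the
interval. To the `12` for that grid point come at most `3` for the modulus and the precision; since
`κ ≥ 1`, the unit is at most `1 / (32 u)`. -/
theorem abs_valL_le {u a b w : M.Num} (hu : IsPow2 u) (hab : UnitPoint a b)
    (ha : ivA p ((1 + 1) * u) ≤ (a : Frac M) / b) (hb : (a : Frac M) / b ≤ ivB p ((1 + 1) * u))
    (hw : IsPow2 w) : valL p (pair a b) w ≤ 15 / (32 * u) ∧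
      -(15 / (32 * u)) - 2 / w ≤ valL p (pair a b) w := by
  have hN := (isPow2_ivGrid (p := p) ((1 + 1) * u)).pos
  obtain ⟨l, hl, h2, h3⟩ := exists_grid_point (p := p) (u := p.num 0 * ((1 + 1) * u)) hab
  rw [← ivGrid] at hl h2 h3
  have h4 : ivLo M p ((1 + 1) * u) ≤ l := by
    have := ha.trans_lt h3
    rw [ivA, div_lt_div_iff_of_pos_right hN] at this
    rw [← Frac.coe_le]; exact Frac.coe_le_of_lt_add_one this
  have h5 : l ≤ ivHi M p ((1 + 1) * u) := by
    have := h2.trans hb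
    rw [ivB, div_le_div_iff_of_pos_right hN] at this
    exact Frac.coe_le.1 this
  have h6 := abs_le.1 (abs_ivVal_le hκ hc h0 h1 hu h4 h5)
  have hpos : (0 : Frac M) < 1 / ivGrid M p ((1 + 1) * u) := by positivity
  rw [add_div] at h3
  obtain ⟨h7, h8⟩ := valL_lt_ivVal hκ hc hu.double hl.2 hab (by
    rw [abs_le]; constructor <;> linarith) hw
  have hu0 := hu.pos
  have hk0 := hκ.one_le
  push_cast at h7 h8
  rw [one_add_one_eq_two] at h7 h8
  set X : Frac M := 16 * (p.num 0 * (2 * u)) with hX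
  have hXu : 32 * u ≤ X := by
    rw [hX]; nlinarith [mul_le_mul_of_nonneg_right hk0 hu0.le]
  have hX0 : 0 < X := by linarith
  have h9 : 15 / X ≤ 15 / (32 * u) := div_le_div_of_nonneg_left (by norm_num) (by linarith) hXu
  constructor
  · refine le_trans ?_ h9
    rw [le_div_iff₀ hX0]; linarith
  · have h10 : -(15 / X) ≤ valL p (pair a b) w + 2 / w := by
      rw [← neg_div, div_le_iff₀ hX0]; linarith
    linarith

end Stages

/-! ### The constructive intermediate value theorem -/

section Mediant

variable {K : Type*} [Field K] [LinearOrder K] [IsStrictOrderedRing K] {a b c d j k : K}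

/-- A mediant moves strictly towards the second fraction as the weight grows. This provides strictly
monotone end points between two stages with numerators and denominators given by simple terms. -/
theorem mediant_lt_mediant (hc : 0 < c) (hd : 0 < d) (h : a / c < b / d) (hj : 0 ≤ j) (hjk : j < k) :
    (a + j * b) / (c + j * d) < (a + k * b) / (c + k * d) := by
  have hk : 0 < k := hj.trans_lt hjk
  rw [div_lt_div_iff₀ hc hd] at h
  rw [div_lt_div_iff₀ (by positivity) (by positivity)]
  have := mul_pos (sub_pos.2 hjk) (sub_pos.2 h)
  nlinarith

theorem mediant_lt_mediant' (hc : 0 < c) (hd : 0 < d) (h : b / d < a / c) (hj : 0 ≤ j)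
    (hjk : j < k) : (a + k * b) / (c + k * d) < (a + j * b) / (c + j * d) := by
  have := mediant_lt_mediant hc hd (a := -a) (b := -b) (by rw [neg_div, neg_div]; linarith) hj hjk
  simp only [mul_neg, ← neg_add, neg_div] at this
  linarith

theorem mediant_lt (hc : 0 < c) (hd : 0 < d) (h : a / c < b / d) (hk : 0 ≤ k) :
    (a + k * b) / (c + k * d) < b / d := by
  rw [div_lt_div_iff₀ hc hd] at h
  rw [div_lt_div_iff₀ (by positivity) hd]
  linarith

theorem lt_mediant (hc : 0 < c) (hd : 0 < d) (h : b / d < a / c) (hk : 0 ≤ k) :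
    b / d < (a + k * b) / (c + k * d) := by
  rw [div_lt_div_iff₀ hd hc] at h
  rw [div_lt_div_iff₀ hd (by positivity)]
  linarith

end Mediant

/-! ### The intervals indexed by all positive numbers. -/

section Intervals

/-- Numerators and denominator of the end points of the `n`-th interval: the mediants with weight
`n` of the end points of two successive stages. -/
noncomputable def lowNum (M : BaseStructure.{u}) (p : Par M) (n : M.Num) : M.Num :=
  ivLo M p (M.powLen (1 + 1) n) + n * ivLo M p ((1 + 1) * M.powLen (1 + 1) n)

noncomputable def highNum (M : BaseStructure.{u}) (p : Par M) (n : M.Num) : M.Num :=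
  ivHi M p (M.powLen (1 + 1) n) + n * ivHi M p ((1 + 1) * M.powLen (1 + 1) n)

noncomputable def endDen (M : BaseStructure.{u}) (p : Par M) (n : M.Num) : M.Num :=
  ivGrid M p (M.powLen (1 + 1) n) + n * ivGrid M p ((1 + 1) * M.powLen (1 + 1) n)

instance : UFun₁ lowNum.{u} := ⟨by unfold lowNum; infer_instance⟩
instance : UFun₁ highNum.{u} := ⟨by unfold highNum; infer_instance⟩
instance : UFun₁ endDen.{u} := ⟨by unfold endDen; infer_instance⟩

variable {M : BaseStructure.{u}} [hM : Fact (BaseSystem M)] {p : Par M}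

theorem endDen_pos (n : M.Num) : (0 : Frac M) < endDen M p n := by
  have h1 := (isPow2_ivGrid (p := p) (M.powLen (1 + 1) n)).pos
  have h2 := mul_nonneg (Frac.coe_nonneg n)
    (Frac.coe_nonneg (ivGrid M p ((1 + 1) * M.powLen (1 + 1) n)))
  rw [endDen]; push_cast; linarith

/-- The end points of the `n`-th interval. -/
noncomputable def lowEnd (p : Par M) (n : M.Num) : Frac M := (lowNum M p n : Frac M) / endDen M p n

noncomputable def highEnd (p : Par M) (n : M.Num) : Frac M := (highNum M p n : Frac M) / endDen M p n

variable (hκ : IsPow2 (p.num 0)) (hc : p.code.Continuous) (h0 : IsNeg M p 1 0)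
  (h1 : IsPos M p 1 (ivGrid M p 1))
include hκ hc h0 h1

theorem lowEnd_lt_highEnd (n : M.Num) : lowEnd p n < highEnd p n := by
  have hu := isPow2_powLen (M := M) n
  have h2 := Frac.coe_lt.2 (ivInv hκ hc h0 h1 hu).1
  have h3 := mul_le_mul_of_nonneg_left (Frac.coe_lt.2 (ivInv hκ hc h0 h1 hu.double).1).le
    (Frac.coe_nonneg n)
  refine div_lt_div_of_pos_right ?_ (endDen_pos n)
  rw [lowNum, highNum]; push_cast; linarith

theorem lowEnd_bounds {n : M.Num} (hn : (0 : Frac M) < n) :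
    ivA p (M.powLen (1 + 1) n) < lowEnd p n ∧
      lowEnd p n < ivA p ((1 + 1) * M.powLen (1 + 1) n) := by
  have hu := isPow2_powLen (M := M) n
  have h2 := ivA_lt_double hκ hc h0 h1 hu
  rw [lowEnd, lowNum, endDen]
  rw [ivA, ivA] at *
  have hN := (isPow2_ivGrid (p := p) (M.powLen (1 + 1) n)).pos
  have hN' := (isPow2_ivGrid (p := p) ((1 + 1) * M.powLen (1 + 1) n)).pos
  simp only [Frac.coe_add, Frac.coe_mul] at *
  constructor
  · have := mediant_lt_mediant hN hN' h2 le_rfl hn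
    simpa only [zero_mul, add_zero] using this
  · exact mediant_lt hN hN' h2 hn.le

theorem highEnd_bounds {n : M.Num} (hn : (0 : Frac M) < n) :
    highEnd p n < ivB p (M.powLen (1 + 1) n) ∧
      ivB p ((1 + 1) * M.powLen (1 + 1) n) < highEnd p n := by
  have hu := isPow2_powLen (M := M) n
  have h2 := ivB_double_lt hκ hc h0 h1 hu
  rw [highEnd, highNum, endDen]
  rw [ivB, ivB] at *
  have hN := (isPow2_ivGrid (p := p) (M.powLen (1 + 1) n)).pos
  have hN' := (isPow2_ivGrid (p := p) ((1 + 1) * M.powLen (1 + 1) n)).pos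
  simp only [Frac.coe_add, Frac.coe_mul] at *
  constructor
  · have := mediant_lt_mediant' hN hN' h2 le_rfl hn
    simpa only [zero_mul, add_zero] using this
  · exact lt_mediant hN hN' h2 hn.le

/-- If `j` and `k` have the same power `2 ^ len`, both intervals are mediants of the same two stages
and the weights decide. Otherwise the second stage of `j` comes no later than the first stage of `k`
and separates them. -/
theorem ends_strictMono {j k : M.Num} (hj : (0 : Frac M) < j) (hjk : (j : Frac M) < k) :
    lowEnd p j < lowEnd p k ∧ highEnd p k < highEnd p j := by
  have hu := isPow2_powLen (M := M) j
  have hv := isPow2_powLen (M := M) k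
  rcases (powLen_two_mono (Frac.coe_le.1 hjk.le)).eq_or_lt with h2 | h2
  · rw [Frac.coe_inj] at h2
    have h3 := ivA_lt_double hκ hc h0 h1 hu
    have h4 := ivB_double_lt hκ hc h0 h1 hu
    rw [lowEnd, lowEnd, highEnd, highEnd, lowNum, lowNum, highNum, highNum, endDen, endDen, ← h2]
    rw [ivA, ivA] at h3
    rw [ivB, ivB] at h4
    have hN := (isPow2_ivGrid (p := p) (M.powLen (1 + 1) j)).pos
    have hN' := (isPow2_ivGrid (p := p) ((1 + 1) * M.powLen (1 + 1) j)).pos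
    simp only [Frac.coe_add, Frac.coe_mul] at *
    exact ⟨mediant_lt_mediant hN hN' h3 hj.le hjk, mediant_lt_mediant' hN hN' h4 hj.le hjk⟩
  · have h3 := hu.two_mul_le hv h2
    have h4 := iv_mono hκ hc h0 h1 hu.double hv (by push_cast; linarith)
    have h5 := lowEnd_bounds hκ hc h0 h1 hj
    have h6 := highEnd_bounds hκ hc h0 h1 hj
    have h7 := lowEnd_bounds hκ hc h0 h1 (hj.trans hjk)
    have h8 := highEnd_bounds hκ hc h0 h1 (hj.trans hjk)
    constructor <;> linarith

theorem highNum_le (n : M.Num) : highNum M p n ≤ endDen M p n := by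
  have hu := isPow2_powLen (M := M) n
  have h2 := Frac.coe_le.2 (ivInv hκ hc h0 h1 hu).2.1
  have h3 := mul_le_mul_of_nonneg_left (Frac.coe_le.2 (ivInv hκ hc h0 h1 hu.double).2.1)
    (Frac.coe_nonneg n)
  rw [highNum, endDen, ← Frac.coe_le]; push_cast; linarith

/-- The values at rational points of the `n`-th interval are smaller than `1 / n`. -/
theorem valL_lt_of_mem {n a b w : M.Num} (hn : (0 : Frac M) < n) (hab : UnitPoint a b)
    (ha : lowEnd p n ≤ (a : Frac M) / b) (hb : (a : Frac M) / b ≤ highEnd p n) (hw : IsPow2 w) :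
    valL p (pair a b) w ≤ 15 / (16 * M.powLen (1 + 1) n) ∧
      -(15 / (16 * M.powLen (1 + 1) n)) - 2 / w ≤ valL p (pair a b) w := by
  have h2 := lowEnd_bounds hκ hc h0 h1 hn
  have h3 := highEnd_bounds hκ hc h0 h1 hn
  have hlt := lt_powLen_two n
  -- For `n ≥ 1` the power `2 ^ len n` exceeds `1`, so it is a stage of the form `2 v`, and the
  -- bound on values at doubled stages applies.
  rcases (isPow2_powLen (M := M) n).cases with h4 | ⟨v, hv, -, h4⟩
  · rw [h4, Frac.coe_one] at hlt
    exact absurd (Frac.one_le_coe hn) (not_le.2 hlt)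
  · rw [h4] at h2 h3 ⊢
    have h5 := abs_valL_le hκ hc h0 h1 hv hab (h2.1.le.trans ha) (hb.trans h3.1.le) hw
    have e : (16 : Frac M) * ((1 + 1) * v : M.Num) = 32 * v := by push_cast; ring
    rw [e]; exact h5

/-- A rational point near `x` lies in the interval too, because `x` is strictly inside. The value
there is at most `15 / (16 v)` up to error, and `f(x)` is close to it; strictness comes from `n <
v`. -/
theorem distLt_of_evalsTo {n : M.Num} (hn : (0 : Frac M) < n) {x y : RealCode M}
    {L : M.Num → Frac M} (hL : x.val.Conv L)
    (hb : ∀ w, IsPow2 w → -(2 / w) ≤ L w ∧ L w ≤ 1 + 2 / w)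
    (hlow : ∃ w, IsPow2 w ∧ lowEnd p n + 2 / w < L w)
    (hhigh : ∃ w, IsPow2 w ∧ L w + 2 / w < highEnd p n) (hy : y.Valid)
    (hxy : p.code.EvalsTo x y) :
    y.val.DistLt (Approx.ofRat (QNum.frac 0 1)) (QNum.frac 1 n) := by
  obtain ⟨w₁, hw₁, hlow⟩ := hlow
  obtain ⟨w₂, hw₂, hhigh⟩ := hhigh
  obtain ⟨K, hK⟩ := hy.exists_conv
  have h01 : (0 : Frac M) < (QNum.frac (M := M) 0 1).den := by
    rw [QNum.den_frac, Frac.coe_one]; exact one_pos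
  set v := M.powLen (1 + 1) n with hv
  have hv0 : (0 : Frac M) < v := (isPow2_powLen n).pos
  have hnv : (n : Frac M) + 1 ≤ v := Frac.coe_add_one_le (lt_powLen_two n)
  -- The errors add up to `7 / t`, which has to be less than the remaining `1 / (16 v)`; hence `112
  -- = 7 * 16`.
  obtain ⟨t, ht, htv⟩ := exists_isPow2_gt (M := M) (112 * v)
  have ht0 := ht.pos
  obtain ⟨e, he, hev⟩ := hxy t (Frac.coe_lt.1 (by rwa [Frac.coe_zero]))
  rw [← Frac.coe_lt, Frac.coe_zero] at he
  have hδ := sub_pos.2 hhigh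
  obtain ⟨d, hd⟩ := Frac.exists_lt_coe (1 / (highEnd p n - (L w₂ + 2 / (w₂ : Frac M))))
  have hw₁0 := hw₁.pos
  have hd0 : (0 : Frac M) < d := (div_pos one_pos hδ).trans hd
  -- The three summands make the rational point near enough for the evaluation of `f` and keep it
  -- below the upper and above the lower end of the interval.
  have hE : ((e + d + w₁ : M.Num) : Frac M) = e + d + w₁ := by push_cast; rfl
  have hE0 : (0 : Frac M) < (e + d + w₁ : M.Num) := by rw [hE]; linarith
  obtain ⟨a, b, hab, hdist⟩ := hL.exists_unitPoint hb hE0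
  have hconv := Approx.conv_ofRat (q := QNum.frac a b) (by exact hab.den_pos)
  obtain ⟨s, hs, hdist⟩ := (hL.distLt_iff hconv (by exact hE0)).1 hdist
  have hs0 := hs.pos
  rw [QNum.val_frac, QNum.val_frac, Frac.coe_one] at hdist
  have hE1 : (1 : Frac M) / (e + d + w₁ : M.Num) ≤ 1 / e :=
    one_div_le_one_div_of_le he (by rw [hE]; linarith)
  have hE2 : (1 : Frac M) / (e + d + w₁ : M.Num) ≤ 1 / d :=
    one_div_le_one_div_of_le hd0 (by rw [hE]; linarith)
  have hE3 : (1 : Frac M) / (e + d + w₁ : M.Num) ≤ 1 / w₁ :=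
    one_div_le_one_div_of_le hw₁0 (by rw [hE]; linarith)
  have hE4 : (1 : Frac M) / d < highEnd p n - (L w₂ + 2 / w₂) := by
    rw [div_lt_iff₀ hδ] at hd
    rw [div_lt_iff₀ hd0]; linarith
  have hE5 : (1 : Frac M) / w₁ ≤ 2 / w₁ := div_le_div_of_nonneg_right one_le_two hw₁0.le
  have h2 := hev a b hab ((hL.distLt_iff hconv (by exact he)).2 ⟨s, hs, by
    rw [QNum.val_frac, QNum.val_frac, Frac.coe_one]; linarith⟩)
  have h3 := hL.cross hw₁ hs
  have h4 := hL.cross hs hw₂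
  have h5 : (0 : Frac M) < 2 / s := by positivity
  have h6 := abs_lt.1 (lt_sub_iff_add_lt.2 hdist)
  obtain ⟨h7, h8⟩ := valL_lt_of_mem hκ hc h0 h1 hn hab (w := t) (by linarith) (by linarith) ht
  obtain ⟨h9, h10⟩ := (conv_valueAt hc hab).lt_of_distLt hK (r := QNum.frac 1 t) (by exact ht0)
    h2 ht ht
  rw [QNum.val_frac, Frac.coe_one] at h9 h10
  rw [hK.distLt_iff (Approx.conv_ofRat h01) (by exact hn)]
  refine ⟨t, ht, ?_⟩
  rw [QNum.val_frac, QNum.val_frac, Frac.coe_zero, zero_div, sub_zero, Frac.coe_one,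
    ← lt_sub_iff_add_lt, abs_lt]
  have e1 : (7 : Frac M) / t < 1 / (16 * v) := by
    rw [div_lt_div_iff₀ ht0 (by positivity)]; linarith
  have e2 : (15 : Frac M) / (16 * v) + 1 / (16 * v) < 1 / n := by
    have : (15 : Frac M) / (16 * v) + 1 / (16 * v) = 1 / v := by field_simp; norm_num
    rw [this]; exact one_div_lt_one_div_of_lt hn (by linarith)
  have e3 : (7 : Frac M) / t = 2 / t + 2 / t + 2 / t + 1 / t := by rw [← add_div, ← add_div, ← add_div]; norm_num
  have e4 : (0 : Frac M) < 2 / t := by positivity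
  constructor <;> linarith

end Intervals

/-! ### Proof of the constructive intermediate value theorem. -/

section Theorem

variable {M : BaseStructure.{u}} [hM : Fact (BaseSystem M)]

/-- In the unit `1 / (16 κ)` the hypotheses put the value at `0` below `-16 + 1` and the value at
`1` above `16 - 3`, so both signs are clear at the first stage. -/
theorem exists_start {p : Par M} (hκ : IsPow2 (p.num 0)) (hc : p.code.Continuous) {v w : M.Num}
    (hv : IsPow2 v) (hw : IsPow2 w)
    (hneg : 1 < -(valL p (pair 0 1) v + 2 / v) * p.num 0)
    (hpos : 1 < valL p (pair 1 1) w * p.num 0) : IsNeg M p 1 0 ∧ IsPos M p 1 (ivGrid M p 1) := by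
  have hN := (isPow2_ivGrid (p := p) 1).pos
  have h2 := (valL_lt_ivVal hκ hc .one (hM.out.basic.zero_le (ivGrid M p 1)) unitPoint_zero
    (by rw [Frac.coe_zero, zero_div, zero_div, sub_zero, abs_zero]; positivity) hv).2
  have h3 := (valL_lt_ivVal hκ hc .one (.inr rfl : ivGrid M p 1 ≤ ivGrid M p 1) unitPoint_one
    (by rw [Frac.coe_one, div_one, div_self hN.ne', sub_self, abs_zero]; positivity) hw).1
  rw [Frac.coe_one] at h2 h3
  rw [isNeg_iff, isPos_iff]
  constructor <;> linarith

theorem constructiveIVT : ConstructiveIVT M := by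
  intro f hf hneg hpos
  have h01 : (0 : Frac M) < (QNum.frac (M := M) 0 1).den := by
    rw [QNum.den_frac, Frac.coe_one]; exact one_pos
  let q : M.Num → Par M := fun κ => ⟨fun i => if i = 0 then f.valPos else if i = 1 then f.valNeg else
    if i = 2 then f.valDig else f.modulus, fun _ => κ⟩
  have hc : ∀ κ, (q κ).code.Continuous := fun _ => hf
  have conv : ∀ κ {a b : M.Num}, UnitPoint a b → (f.valueAt a b).Conv (valL (q κ) (pair a b)) :=
    fun κ _ _ hab => conv_valueAt (hc κ) hab
  obtain ⟨v, hv, hneg⟩ := ((conv 0 unitPoint_zero).lt_iff (Approx.conv_ofRat h01)).1 hneg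
  obtain ⟨w, hw, hpos⟩ := ((Approx.conv_ofRat h01).lt_iff (conv 0 unitPoint_one)).1 hpos
  rw [QNum.val_frac, Frac.coe_zero, zero_div] at hneg hpos
  have hw2 : (0 : Frac M) < 2 / w := div_pos two_pos hw.pos
  -- The initial precision exceeds the reciprocals of both distances from `0`, that of `f(0)` and
  -- that of `f(1)`.
  obtain ⟨κ, hκ, hκ'⟩ := exists_isPow2_gt (1 / -(valL (q 0) (pair 0 1) v + 2 / (v : Frac M)) +
    1 / valL (q 0) (pair 1 1) w)
  have hg1 : 0 < -(valL (q 0) (pair 0 1) v + 2 / (v : Frac M)) := by linarith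
  have hg2 : 0 < valL (q 0) (pair 1 1) w := by linarith
  have hi1 := div_pos one_pos hg1
  have hi2 := div_pos one_pos hg2
  set p := q κ with hp
  obtain ⟨h0, h1⟩ := exists_start (p := p) hκ (hc κ) hv hw (by
    rw [← (conv 0 unitPoint_zero).unique (conv κ unitPoint_zero) hv, ← div_lt_iff₀' hg1]
    change _ < (κ : Frac M); linarith) (by
    rw [← (conv 0 unitPoint_one).unique (conv κ unitPoint_one) hw, ← div_lt_iff₀' hg2]
    change _ < (κ : Frac M); linarith)
  obtain ⟨g, hg⟩ := (inferInstance : UFun.{u} fun M p n => pair (pair (lowNum M p n) (endDen M p n))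
    (pair (highNum M p n) (endDen M p n))).repr M hM.out p
  have hden : ∀ n, 0 < endDen M p n := fun n => Frac.coe_lt.1 (by
    rw [Frac.coe_zero]; exact endDen_pos n)
  refine ⟨g, fun n hn => ⟨_, _, _, _, ⟨hg n, hden n, hden n⟩,
    highNum_le hκ (hc κ) h0 h1 n, fun x hx hax hxb => ?_⟩, ?_⟩
  · rw [← Frac.coe_lt, Frac.coe_zero] at hn
    obtain ⟨L, hL⟩ := hx.exists_conv
    have hlow := ((Approx.conv_ofRat (by exact endDen_pos n)).lt_iff hL).1 hax
    have hhigh := (hL.lt_iff (Approx.conv_ofRat (by exact endDen_pos n))).1 hxb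
    rw [QNum.val_frac, ← lowEnd] at hlow
    rw [QNum.val_frac, ← highEnd] at hhigh
    have hb : ∀ w, IsPow2 w → -(2 / w) ≤ L w ∧ L w ≤ 1 + 2 / w := by
      intro s hs
      obtain ⟨w₁, hw₁, h2⟩ := hlow
      obtain ⟨w₂, hw₂, h3⟩ := hhigh
      have h4 : 0 ≤ lowEnd p n := div_nonneg (Frac.coe_nonneg _) (Frac.coe_nonneg _)
      have h5 : highEnd p n ≤ 1 :=
        (div_le_one (endDen_pos n)).2 (Frac.coe_le.2 (highNum_le hκ (hc κ) h0 h1 n))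
      have h6 := hL.cross hw₁ hs
      have h7 := hL.cross hs hw₂
      have h8 : (0 : Frac M) < 2 / w₁ := div_pos two_pos hw₁.pos
      have h9 : (0 : Frac M) < 2 / s := div_pos two_pos hs.pos
      constructor <;> linarith
    exact ⟨hf.exists_evalsTo hx hL hb, fun y hy hxy =>
      distLt_of_evalsTo hκ (hc κ) h0 h1 hn hL hb hlow hhigh hy hxy⟩
  · intro j k hj hjk a b c d a' b' c' d' hj' hk'
    rw [← Frac.coe_lt, Frac.coe_zero] at hj
    rw [← Frac.coe_lt] at hjk
    have h2 := hj'.1.symm.trans (hg j)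
    have h3 := hk'.1.symm.trans (hg k)
    obtain ⟨rfl, rfl⟩ := pair_inj (pair_inj h2).1
    obtain ⟨rfl, rfl⟩ := pair_inj (pair_inj h2).2
    obtain ⟨rfl, rfl⟩ := pair_inj (pair_inj h3).1
    obtain ⟨rfl, rfl⟩ := pair_inj (pair_inj h3).2
    have hk := ends_strictMono hκ (hc κ) h0 h1 hj hjk
    rw [QNum.lt_iff (by exact endDen_pos j) (by exact endDen_pos k),
      QNum.lt_iff (by exact endDen_pos k) (by exact endDen_pos k),
      QNum.lt_iff (by exact endDen_pos k) (by exact endDen_pos j)]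
    simp only [QNum.val_frac]
    exact ⟨hk.1, lowEnd_lt_highEnd hκ (hc κ) h0 h1 k, hk.2⟩

end Theorem

end WeakAnalysis

theorem mainTheorem8 :
    (∀ M : WeakAnalysis.BaseStructure.{u}, WeakAnalysis.BaseSystem M →
      WeakAnalysis.ConstructiveIVT M) ∧
    (∃ φp φm φd : WeakAnalysis.BForm,
      ∀ M : WeakAnalysis.BaseStructure.{u}, WeakAnalysis.BaseSystem M →
        WeakAnalysis.ComputesSupremum M φp φm φd) := by
  exact ⟨fun M hM => have : Fact (WeakAnalysis.BaseSystem M) := ⟨hM⟩; WeakAnalysis.constructiveIVT,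
    WeakAnalysis.exists_computesSupremum⟩
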